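/- **Theorem 1.** Let $0<d<\frac15$, and let $r_j$ be a sequence of positive integers with $r_j\sim j^d$, i.e. $r_j/j^d\to1$. Let $T:X\to X$ be a staircase rank-one construction with cutting parameters $r_j$. That is: the stage-$j$ tower consists of $h_j$ disjoint half-open intervals $E_j,TE_j,\dots,T^{h_j-1}E_j\subset\mathbb R$ of equal length ($h_0\ge1$), on all but the last of which $T$ acts as a translation onto the next. The interval $E_j$ is cut into $r_j$ half-open intervals $E_j^1,\dots,E_j^{r_j}$ of equal length, the tower is cut correspondingly into columns, and $s_j(i)\ge 0$ new intervals (spacers), disjoint from everything in the tower, are put on top of the $i$-th column. Stacking the columns in order, with $E_{j+1}=E_j^1$ and $T^{h_j+s_j(i)}E_j^i=E_j^{i+1}$ for $i<r_j$, gives the stage-$(j+1)$ tower, of height $h_{j+1}=\sum_{i=1}^{r_j}(h_j+s_j(i))$. The space $X\subset\mathbb R$ is the union of all towers, with Lebesgue measure $\mu$, and for all sufficiently large $j$ $$(s_j(1),\dots,s_j(r_j))=(1,2,\dots,r_j-1,0).$$ Then $\mu(X)<\infty$, $T$ preserves $\mu$, and $Uf=f\circ T$ and $VF=F\circ(T\times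 T)$ define unitary operators on $L^2(X,\mu)$ and on $L^2(X\times X,\mu\times\mu)=L^2(X,\mu)\otimes L^2(X,\mu)$ (so $V=U\otimes U$, usually written $T\otimes T$). Moreover: 1. Let $\sigma_T$ be the maximal spectral type of $U$ on the orthogonal complement of the constants in $L^2(X,\mu)$; it exists. Then $\sigma_T$ does not have the group property: its convolution square $\sigma_T^{*2}$ is not absolutely continuous with respect to $\sigma_T$. In fact $\sigma_T$ and $\sigma_T^{*2}$ are mutually singular. 2. On the orthogonal complement of the constants in $L^2(X\times X,\mu\times\mu)$, the operator $V$ has homogeneous spectrum of multiplicity $2$: this space is the orthogonal sum of two cyclic subspaces generated by vectors with the same nonzero spectral measure. 3. The symmetric power $T\odot T$, i.e. the restriction of $V$ to the subspace of symmetric functions in $L^2(X\times X,\mu\times\mu)$, has simple spectrum: this subspace is the cyclic space of one vector. -/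

import Mathlib

open MeasureTheory Filter Asymptotics

noncomputable section

/-! ### Cutting and stacking on half-open intervals -/

/-- The floor number `k` of the tower of stage `j`: the half-open interval `[a j k, a j k + w j)`. -/
def towerLevel (a : ℕ → ℕ → ℝ) (w : ℕ → ℝ) (j k : ℕ) : Set ℝ :=
  Set.Ico (a j k) (a j k + w j)

/-- The number (in the tower of stage `j + 1`) of the bottom floor of the column number `i` of
stage `j`; columns are numbered from `0`, and the column `l` consists of `h j` floors with
`s j l` spacers on top. -/
def columnBase (h : ℕ → ℕ) (s : ℕ → ℕ → ℕ) (j i : ℕ) : ℕ :=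
  ∑ l ∈ Finset.range i, (h j + s j l)

/-- `T : X → X` is the rank-one transformation obtained by cutting and stacking, with cutting
parameters `r`, spacer parameters `s` (the column number `i` of stage `j`, `0 ≤ i < r j`, receives
`s j i` spacers), heights `h`, floors `[a j k, a j k + w j)`, `0 ≤ k < h j`. -/
structure IsCuttingAndStacking (r : ℕ → ℕ) (s : ℕ → ℕ → ℕ) (h : ℕ → ℕ) (a : ℕ → ℕ → ℝ)
    (w : ℕ → ℝ) (X : Set ℝ) (T : X → X) : Prop where
  cut_pos : ∀ j, 0 < r j
  height_zero : 0 < h 0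
  width_zero : 0 < w 0
  height_succ : ∀ j, h (j + 1) = columnBase h s j (r j)
  width_succ : ∀ j, w (j + 1) = w j / r j
  /-- The floors of one tower are disjoint. -/
  disjoint : ∀ j k l, k < h j → l < h j → k ≠ l →
    Disjoint (towerLevel a w j k) (towerLevel a w j l)
  /-- The bottom floor `E_j` is the union of the bottom floors `E_j^i` of the columns. -/
  cut : ∀ j, towerLevel a w j 0 = ⋃ i < r j, towerLevel a w (j + 1) (columnBase h s j i)
  /-- The floor `k < h j` of a column is the image of its bottom floor under the translation that
  takes `E_j` to the floor `k` of the tower of stage `j`. -/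
  column : ∀ j, ∀ i < r j, ∀ k < h j,
    a (j + 1) (columnBase h s j i + k) = a (j + 1) (columnBase h s j i) + (a j k - a j 0)
  /-- The space is the union of all the towers. -/
  space : X = ⋃ j, ⋃ k < h j, towerLevel a w j k
  /-- `T` translates each floor, except the top one, onto the next floor. -/
  move : ∀ j k, k + 1 < h j → ∀ x : X, (x : ℝ) ∈ towerLevel a w j k →
    (T x : ℝ) = x + (a j (k + 1) - a j k)

/-- `T : X → X` is a staircase construction with cutting parameters `r`: from some stage on, the
spacers over the `r j` columns are `(1, 2, …, r j - 1, 0)`. -/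
def IsStaircaseConstruction (r : ℕ → ℕ) (X : Set ℝ) (T : X → X) : Prop :=
  ∃ (s : ℕ → ℕ → ℕ) (h : ℕ → ℕ) (a : ℕ → ℕ → ℝ) (w : ℕ → ℝ),
    IsCuttingAndStacking r s h a w X T ∧
    ∀ᶠ j in atTop, ∀ i < r j, s j i = if i + 1 < r j then i + 1 else 0

/-- Lebesgue measure on a subset of the line. -/
def lebesgueOn (X : Set ℝ) : Measure X := Measure.comap (Subtype.val : X → ℝ) volume

/-! ### Operators on `L²` -/

/-- The operator `U` on `L²(μ)` is `f ↦ f ∘ T`. -/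
def IsKoopman {α : Type*} [MeasurableSpace α] {μ : Measure α} (T : α → α)
    (U : Lp ℂ 2 μ ≃ₗᵢ[ℂ] Lp ℂ 2 μ) : Prop :=
  ∀ f : Lp ℂ 2 μ, (U f : α → ℂ) =ᵐ[μ] (f : α → ℂ) ∘ T

/-- The constants in `L²(μ)`. -/
def constSubspace {α : Type*} [MeasurableSpace α] (μ : Measure α) : Submodule ℂ (Lp ℂ 2 μ) where
  carrier := {f | ∃ c : ℂ, (f : α → ℂ) =ᵐ[μ] fun _ => c}
  zero_mem' := ⟨0, Lp.coeFn_zero ℂ 2 μ⟩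
  add_mem' := by
    rintro f g ⟨c, hc⟩ ⟨d, hd⟩
    exact ⟨c + d, (Lp.coeFn_add f g).trans (hc.add hd)⟩
  smul_mem' := by
    rintro z f ⟨c, hc⟩
    exact ⟨z • c, (Lp.coeFn_smul z f).trans (hc.const_smul z)⟩

/-- The symmetric functions in `L²(μ × μ)`, i.e. the symmetric tensor square of `L²(μ)`. -/
def symmetricSubspace {α : Type*} [MeasurableSpace α] (μ : Measure α) :
    Submodule ℂ (Lp ℂ 2 (μ.prod μ)) where
  carrier := {F | ∃ G : α × α → ℂ, (∀ x y, G (x, y) = G (y, x)) ∧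
    (F : α × α → ℂ) =ᵐ[μ.prod μ] G}
  zero_mem' := ⟨0, fun _ _ => rfl, Lp.coeFn_zero ℂ 2 (μ.prod μ)⟩
  add_mem' := by
    rintro f g ⟨F, hF, hf⟩ ⟨G, hG, hg⟩
    exact ⟨F + G, fun x y => by simp [hF x y, hG x y], (Lp.coeFn_add f g).trans (hf.add hg)⟩
  smul_mem' := by
    rintro z f ⟨F, hF, hf⟩
    exact ⟨z • F, fun x y => by simp [hF x y], (Lp.coeFn_smul z f).trans (hf.const_smul z)⟩

/-! ### Spectral notions for a unitary operator -/

section Spectral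

variable {E : Type*} [NormedAddCommGroup E] [InnerProductSpace ℂ E]

/-- The finite measure `σ` on the circle `ℝ/ℤ` is the spectral measure of the vector `v`: its
Fourier coefficients are `⟨Uⁿ v, v⟩`, `n ∈ ℤ`. -/
def IsSpectralMeasure (U : E ≃ₗᵢ[ℂ] E) (v : E) (σ : Measure UnitAddCircle) : Prop :=
  IsFiniteMeasure σ ∧ ∀ n : ℤ, ∫ t, fourier n t ∂σ = inner ℂ v ((U ^ n) v)

/-- The cyclic space of `v`: the closed linear span of the vectors `Uⁿ v`, `n ∈ ℤ`. -/
def cyclicSpace (U : E ≃ₗᵢ[ℂ] E) (v : E) : Submodule ℂ E :=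
  (Submodule.span ℂ (Set.range fun n : ℤ => (U ^ n) v)).topologicalClosure

/-- `σ` represents the maximal spectral type of `U` on the invariant subspace `H`: it is the
spectral measure of a vector of `H`, and it dominates the spectral measures of all the vectors
of `H`. -/
def IsMaximalSpectralType (U : E ≃ₗᵢ[ℂ] E) (H : Submodule ℂ E) (σ : Measure UnitAddCircle) :
    Prop :=
  (∃ v ∈ H, IsSpectralMeasure U v σ) ∧
    ∀ v ∈ H, ∀ τ : Measure UnitAddCircle, IsSpectralMeasure U v τ → τ ≪ σ

/-- `U` has homogeneous spectrum of multiplicity `n` on the invariant subspace `H`: `H` is the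
orthogonal sum of `n` cyclic spaces with one and the same nonzero spectral measure. For `n = 1`
this says that the spectrum is simple. -/
def HasHomogeneousSpectrum (U : E ≃ₗᵢ[ℂ] E) (H : Submodule ℂ E) (n : ℕ) : Prop :=
  ∃ (σ : Measure UnitAddCircle) (v : Fin n → E), σ ≠ 0 ∧
    (∀ i, IsSpectralMeasure U (v i) σ) ∧
    (∀ i j, i ≠ j → cyclicSpace U (v i) ⟂ cyclicSpace U (v j)) ∧
    (⨆ i, cyclicSpace U (v i)) = H

end Spectral

/-- The group property of a spectral type: it dominates its convolution square. -/
def HasGroupProperty (σ : Measure UnitAddCircle) : Prop := Measure.conv σ σ ≪ σ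

end

/-! Composition with `T` moves indicators of floors downward, so let `W = U⁻¹`, which moves them
upward. In a staircase, `W ^ h_j` carries the part of a floor in column `c` to a place `c + 1`
floors too low in column `c + 1`. Tested against floors, `W ^ h_j` is therefore close to the average
`r_j⁻¹ ∑ W ^ (-(c + 1))`. By the mean ergodic theorem this gives mixing along times slightly larger
than the heights. Applied to `(1 - W) x`, the average telescopes, and the vector `b_j = r_j W ^ h_j
(1 - W) x` behaves like `W ^ (-(r_j - 1)) x - x` (`inner_diff_height`,
`norm_inner_diff_height_sub_le`). If `r_j - 1` is slightly larger than an earlier height, the first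
term is weakly close to the mean of `x`, so `b_j` is close to `-c`, where `c` is `x` minus its mean,
when tested against floors.

The norms of the `b_j` grow like `r_j`, but for indices at distance at least 2 with the same value
of `r` their inner products stay bounded (`norm_inner_bump_bump_le`). Averages over a large set `J`
of indices with `r_j = ρ` are hence bounded and converge weakly to `-c`. If `|J| ≥ ρ ^ 4`, the
averages of `b_j ⊗ b_j` are bounded as well and converge weakly to `c ⊗ c`. Such sets exist for `d <
1/5`: about `x ^ (1/d)` indices have `r_j` just above `x`, only `O(x)` values are available, and one
value is taken more than `(3 x) ^ 4` times (`eventually_exists_block`).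

Let `V = U ⊗ U` and `K = (U - 1) ⊗ (U - 1)`. Since `b_j = ρ U ^ (-(h_j + 1)) (U - 1) c`, the tensor
`b_j ⊗ b_j` is `ρ² V ^ (-(h_j + 1)) K (c ⊗ c)`. This has two consequences. First, `c ⊗ c` lies in
the cyclic space of `K (c ⊗ c)` (`tensor_mem_cyclicSpace`). Secondly, let `P` be the average over
`J` of the characters with exponents `-(h_j + 1)`, times one factor `ρ`. Then `P(U) (U - 1) c` tends
weakly to `-c`, whereas `P(V) K (c ⊗ c)` is `ρ⁻¹` times a bounded vector and tends to zero. The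
spectral measures of `c` and of `K (c ⊗ c)` are therefore mutually singular
(`mutuallySingular_of_trigApply`).

The rest is operator theory. From `U ⊗ 1 + 1 ⊗ U = V + 1 - K` it follows that the cyclic space of `c
⊗ c` contains the symmetric square of the cyclic space of `c` (`symm_t_mem`). Taking `c` from the
bottom floors of successive towers gives increasing cyclic spaces, and a Baire category argument
produces one generator for the complement of the constants and one for its symmetric square
(`exists_cyclicSpace_eq`). The operator `U ⊗ 1 - 1 ⊗ U` transfers the spectral type of the symmetric
square to the exterior square (`exists_alt_generator`). The types of `U` on the complement of the
constants and of `V` on the symmetric square are singular; together with the types of `1 ⊗ x` and `x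
⊗ 1` this gives the three assertions. -/

open scoped InnerProductSpace CompactlySupported Topology ENNReal ComplexConjugate

noncomputable section

/-! ### Functional calculus and existence of spectral measures -/

section SpectralMeasure

variable {E : Type*} [NormedAddCommGroup E] [InnerProductSpace ℂ E]

theorem unitary_zpow_one_add (U : E ≃ₗᵢ[ℂ] E) (n : ℤ) (v : E) : (U ^ (1 + n)) v = U ((U ^ n) v) := by
  rw [zpow_one_add]; rfl

/-- A continuous function on the circle, evaluated at a unitary operator. -/
theorem exists_circle_functionalCalculus [CompleteSpace E] (U : E ≃ₗᵢ[ℂ] E) :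
    ∃ Φ : C(UnitAddCircle, ℂ) →⋆ₐ[ℂ] (E →L[ℂ] E), ∀ (n : ℤ) (v : E), Φ (fourier n) v = (U ^ n) v := by
  let u : unitary (E →L[ℂ] E) := Unitary.linearIsometryEquiv.symm U
  have hu : IsStarNormal (u : E →L[ℂ] E) := inferInstance
  have hsp : spectrum ℂ (u : E →L[ℂ] E) ⊆ Metric.sphere 0 1 :=
    spectrum.subset_circle_of_unitary u.2
  let toC : C(spectrum ℂ (u : E →L[ℂ] E), Circle) :=
    ⟨fun z => ⟨z, hsp z.2⟩, by fun_prop⟩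
  let ψ : C(spectrum ℂ (u : E →L[ℂ] E), UnitAddCircle) :=
    ContinuousMap.comp ⟨(AddCircle.homeomorphCircle (T := 1) one_ne_zero).symm,
      (AddCircle.homeomorphCircle (T := 1) one_ne_zero).symm.continuous⟩ toC
  have hψ : ∀ z, ((ψ z).toCircle : ℂ) = z := fun z => by
    have := (AddCircle.homeomorphCircle (T := 1) one_ne_zero).apply_symm_apply (toC z)
    rw [AddCircle.homeomorphCircle_apply] at this
    change (((AddCircle.homeomorphCircle (T := 1) one_ne_zero).symm (toC z)).toCircle : ℂ) = z
    rw [this]; rfl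
  let Φ : C(UnitAddCircle, ℂ) →⋆ₐ[ℂ] (E →L[ℂ] E) :=
    (cfcHom hu).comp (ContinuousMap.compStarAlgHom' ℂ ℂ ψ)
  have h1 : Φ (fourier 1) = u := by
    have : (fourier 1 : C(UnitAddCircle, ℂ)).comp ψ
        = ContinuousMap.restrict (spectrum ℂ (u : E →L[ℂ] E)) (ContinuousMap.id ℂ) := by
      ext z
      simp [hψ]
    change cfcHom hu ((fourier 1 : C(UnitAddCircle, ℂ)).comp ψ) = u
    rw [this, cfcHom_id]
  have hu1 : ∀ v, (u : E →L[ℂ] E) v = U v := fun v => rfl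
  have hmul : ∀ (n : ℤ) (v : E), Φ (fourier (n + 1)) v = U (Φ (fourier n) v) := by
    intro n v
    have : (fourier (n + 1) : C(UnitAddCircle, ℂ)) = fourier 1 * fourier n := by
      ext x; simp [mul_comm]
    rw [this, map_mul, h1]; rfl
  refine ⟨Φ, fun n v => ?_⟩
  induction n with
  | zero =>
    have : (fourier 0 : C(UnitAddCircle, ℂ)) = 1 := by ext x; simp
    rw [this, map_one]; simp
  | succ n ih =>
    rw [hmul, ih, add_comm, unitary_zpow_one_add]
  | pred n ih =>
    have := hmul (-n - 1) v
    rw [sub_add_cancel, ih] at this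
    rw [← U.injective.eq_iff, ← this, ← unitary_zpow_one_add]
    congr 2; ring

/-- The characters span a dense subspace of the continuous functions, and integration against a
finite measure is continuous for the uniform norm. -/
theorem integral_circle_ext {σ τ : Measure UnitAddCircle} [IsFiniteMeasure σ] [IsFiniteMeasure τ]
    (h : ∀ n : ℤ, ∫ t, fourier n t ∂σ = ∫ t, fourier n t ∂τ) (g : C(UnitAddCircle, ℂ)) :
    ∫ t, g t ∂σ = ∫ t, g t ∂τ := by
  have key : ∀ (μ : Measure UnitAddCircle) [IsFiniteMeasure μ],
      Continuous fun g : C(UnitAddCircle, ℂ) => ∫ t, g t ∂μ := by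
    intro μ _
    have : (fun g : C(UnitAddCircle, ℂ) => ∫ t, g t ∂μ)
        = fun g => ∫ t, (BoundedContinuousFunction.mkOfCompact g) t ∂μ := rfl
    refine continuous_iff_continuousAt.2 fun g => ?_
    refine tendsto_iff_norm_sub_tendsto_zero.2 ?_
    refine squeeze_zero (fun _ => norm_nonneg _) (fun g' => ?_)
      (g := fun g' => ‖g' - g‖ * μ.real Set.univ) ?_
    · rw [← integral_sub]
      · exact norm_integral_le_of_norm_le_const (ae_of_all _ fun t => (g' - g).norm_coe_le_norm t)
      · exact g'.continuous.integrable_of_hasCompactSupport (HasCompactSupport.of_compactSpace _)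
      · exact g.continuous.integrable_of_hasCompactSupport (HasCompactSupport.of_compactSpace _)
    · have : Tendsto (fun g' : C(UnitAddCircle, ℂ) => ‖g' - g‖ * μ.real Set.univ) (𝓝 g)
          (𝓝 (‖g - g‖ * μ.real Set.univ)) := by
        apply Continuous.tendsto
        fun_prop
      simpa using this
  have hint : ∀ (μ : Measure UnitAddCircle) [IsFiniteMeasure μ] (g : C(UnitAddCircle, ℂ)),
      Integrable g μ := fun μ _ g =>
    g.continuous.integrable_of_hasCompactSupport (HasCompactSupport.of_compactSpace _)
  have hg : g ∈ (Submodule.span ℂ (Set.range (@fourier 1))).topologicalClosure := by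
    rw [span_fourier_closure_eq_top]; trivial
  refine closure_minimal (s := (Submodule.span ℂ (Set.range (@fourier 1)) : Set C(UnitAddCircle, ℂ)))
    (t := {g | ∫ t, g t ∂σ = ∫ t, g t ∂τ}) ?_
    (isClosed_eq (key σ) (key τ)) hg
  intro g hg
  refine Submodule.span_induction ?_ ?_ ?_ ?_ hg
  · rintro _ ⟨n, rfl⟩; exact h n
  · simp
  · intro x y _ _ hx hy
    simp only [Set.mem_ofPred_eq, ContinuousMap.add_apply] at *
    rw [integral_add (hint _ _) (hint _ _), integral_add (hint _ _) (hint _ _), hx, hy]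
  · intro c x _ hx
    simp only [Set.mem_ofPred_eq, ContinuousMap.smul_apply] at *
    rw [integral_smul, integral_smul, hx]

theorem measure_circle_ext {σ τ : Measure UnitAddCircle} [IsFiniteMeasure σ] [IsFiniteMeasure τ]
    (h : ∀ n : ℤ, ∫ t, fourier n t ∂σ = ∫ t, fourier n t ∂τ) : σ = τ := by
  refine ext_of_forall_integral_eq_of_IsFiniteMeasure fun g => ?_
  have := integral_circle_ext h ⟨fun t => (g t : ℂ), by fun_prop⟩
  simp only [ContinuousMap.coe_mk] at this
  rw [integral_complex_ofReal, integral_complex_ofReal] at this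
  exact_mod_cast this

/-- Riesz–Markov–Kakutani for the functional `g ↦ Re ⟨v, Φ(g) v⟩`. It is positive because `g ≥ 0`
equals `k* k` with `k = √g`, so that the value is `‖Φ(k) v‖²`. -/
theorem exists_measure_of_functionalCalculus [CompleteSpace E] 
    (Φ : C(UnitAddCircle, ℂ) →⋆ₐ[ℂ] (E →L[ℂ] E)) (v : E) :
    ∃ σ : Measure UnitAddCircle, IsFiniteMeasure σ ∧
      ∀ g : C(UnitAddCircle, ℂ), ∫ t, g t ∂σ = inner ℂ v (Φ g v) := by
  let ι : C(UnitAddCircle, ℝ) →ₗ[ℝ] C(UnitAddCircle, ℂ) :=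
    { toFun := fun g => ⟨fun t => (g t : ℂ), by fun_prop⟩
      map_add' := fun g h => by ext; simp
      map_smul' := fun c g => by ext; simp }
  have hsq : ∀ g : C(UnitAddCircle, ℝ), 0 ≤ g → ∃ k : C(UnitAddCircle, ℂ), ι g = star k * k := by
    intro g hg
    refine ⟨⟨fun t => (Real.sqrt (g t) : ℂ), by fun_prop⟩, ?_⟩
    ext t
    simp only [ι, LinearMap.coe_mk, AddHom.coe_mk, ContinuousMap.coe_mk, ContinuousMap.mul_apply,
      ContinuousMap.star_apply, RCLike.star_def, Complex.conj_ofReal]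
    rw [← Complex.ofReal_mul]
    exact congrArg _ (Real.mul_self_sqrt (hg t)).symm
  have hpos : ∀ g : C(UnitAddCircle, ℝ), 0 ≤ g → ∃ c : ℝ, 0 ≤ c ∧ inner ℂ v (Φ (ι g) v) = c := by
    intro g hg
    obtain ⟨k, hk⟩ := hsq g hg
    refine ⟨‖Φ k v‖ ^ 2, by positivity, ?_⟩
    rw [hk, map_mul, map_star, mul_apply_eq_comp, ContinuousLinearMap.star_eq_adjoint,
      ContinuousLinearMap.adjoint_inner_right, inner_self_eq_norm_sq_to_K]
    simp
  let Λ₀ : C_c(UnitAddCircle, ℝ) →ₗ[ℝ] ℝ :=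
    { toFun := fun g => (inner ℂ v (Φ (ι g.toContinuousMap) v)).re
      map_add' := fun g h => by
        have : (g + h).toContinuousMap = g.toContinuousMap + h.toContinuousMap := rfl
        rw [this, map_add, map_add, add_apply, inner_add_right, Complex.add_re]
      map_smul' := fun c g => by
        have : (c • g).toContinuousMap = c • g.toContinuousMap := rfl
        have h2 : ι (c • g.toContinuousMap) = (c : ℂ) • ι (g.toContinuousMap) := by
          ext; simp [ι]
        rw [this, h2, map_smul, smul_apply, inner_smul_right,
          Complex.re_ofReal_mul]
        simp }
  let Λ : C_c(UnitAddCircle, ℝ) →ₚ[ℝ] ℝ := PositiveLinearMap.mk₀ Λ₀ (by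
    intro g hg
    obtain ⟨c, hc, h⟩ := hpos g.toContinuousMap hg
    change 0 ≤ (inner ℂ v (Φ (ι g.toContinuousMap) v)).re
    rw [h]; simpa using hc)
  have hfin : IsFiniteMeasure (RealRMK.rieszMeasure Λ) := ⟨isCompact_univ.measure_lt_top⟩
  have hreal : ∀ g : C(UnitAddCircle, ℝ),
      ((∫ t, g t ∂(RealRMK.rieszMeasure Λ) : ℝ) : ℂ) = inner ℂ v (Φ (ι g) v) := by
    intro g
    have h1 := RealRMK.integral_rieszMeasure Λ
      (CompactlySupportedContinuousMap.continuousMapEquiv g)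
    have h2 : Λ (CompactlySupportedContinuousMap.continuousMapEquiv g)
        = (inner ℂ v (Φ (ι g) v)).re := rfl
    -- A real function is a difference of two nonnegative ones, on each of which the form takes a
    -- real value.
    have h3 : (inner ℂ v (Φ (ι g) v)).im = 0 := by
      have e : g = ⟨fun t => max (g t) 0, by fun_prop⟩ - ⟨fun t => max (-g t) 0, by fun_prop⟩ := by
        ext t
        simp only [ContinuousMap.sub_apply, ContinuousMap.coe_mk]
        rcases le_total (g t) 0 with h | h
        · rw [max_eq_right h, max_eq_left (by linarith)]; ring
        · rw [max_eq_left h, max_eq_right (by linarith)]; ring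
      obtain ⟨a, -, ha⟩ := hpos ⟨fun t => max (g t) 0, by fun_prop⟩ (fun t => le_max_right _ _)
      obtain ⟨b, -, hb⟩ := hpos ⟨fun t => max (-g t) 0, by fun_prop⟩ (fun t => le_max_right _ _)
      rw [e, map_sub, map_sub, sub_apply, inner_sub_right, ha, hb]
      simp
    rw [h2] at h1
    apply Complex.ext
    · rw [Complex.ofReal_re, ← h1]; rfl
    · simp [h3]
  refine ⟨RealRMK.rieszMeasure Λ, hfin, fun g => ?_⟩
  let gr : C(UnitAddCircle, ℝ) := ⟨fun t => (g t).re, by fun_prop⟩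
  let gi : C(UnitAddCircle, ℝ) := ⟨fun t => (g t).im, by fun_prop⟩
  have hg : g = ι gr + Complex.I • ι gi := by
    ext t; simp [ι, gr, gi, mul_comm Complex.I, Complex.re_add_im]
  have hint : Integrable g (RealRMK.rieszMeasure Λ) :=
    g.continuous.integrable_of_hasCompactSupport (HasCompactSupport.of_compactSpace _)
  have h1 := hreal gr
  have h2 := hreal gi
  rw [hg, map_add, map_smul, add_apply, smul_apply,
    inner_add_right, inner_smul_right, ← h1, ← h2, ← hg, ← integral_re_add_im hint]
  simp [gr, gi, mul_comm]

end SpectralMeasure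

/-! ### Calculus of spectral measures -/

section SpectralMeasureBasic

variable {E : Type*} [NormedAddCommGroup E] [InnerProductSpace ℂ E]

theorem inner_zpow_right (U : E ≃ₗᵢ[ℂ] E) (n : ℤ) (x y : E) :
    inner ℂ x ((U ^ n) y) = inner ℂ ((U ^ (-n)) x) y := by
  rw [← LinearIsometryEquiv.inner_map_map (U ^ (-n)) x ((U ^ n) y)]
  congr 1
  change (U ^ (-n) * U ^ n) y = y
  rw [← zpow_add]; simp

theorem zpow_add_apply (U : E ≃ₗᵢ[ℂ] E) (m n : ℤ) (x : E) :
    (U ^ (m + n)) x = (U ^ m) ((U ^ n) x) := by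
  rw [zpow_add]; rfl

theorem zpow_intertwine {F : Type*} [NormedAddCommGroup F] [InnerProductSpace ℂ F]
    {U : E ≃ₗᵢ[ℂ] E} {V : F ≃ₗᵢ[ℂ] F} {S : E → F} (hS : ∀ x, S (U x) = V (S x)) (n : ℤ) (x : E) :
    S ((U ^ n) x) = (V ^ n) (S x) := by
  induction n generalizing x with
  | zero => simp
  | succ n ih =>
    rw [add_comm, unitary_zpow_one_add, hS, ih, ← unitary_zpow_one_add]
  | pred n ih =>
    have h1 : (U ^ (-n : ℤ)) x = U ((U ^ (-n - 1 : ℤ)) x) := by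
      rw [← unitary_zpow_one_add]; congr 2; ring
    have h2 : (V ^ (-n : ℤ)) (S x) = V ((V ^ (-n - 1 : ℤ)) (S x)) := by
      rw [← unitary_zpow_one_add]; congr 2; ring
    have := ih x
    rw [h1, hS, h2] at this
    exact V.injective this

theorem zpow_apply_of_map_eq {U : E ≃ₗᵢ[ℂ] E} {x : E} (h : U x = x) (m : ℤ) : (U ^ m) x = x := by
  have h1 := zpow_intertwine (U := LinearIsometryEquiv.refl ℂ ℂ) (V := U)
    (S := fun c : ℂ => c • x) (fun c => by simp [h]) m 1
  have h2 : ((LinearIsometryEquiv.refl ℂ ℂ) ^ m : ℂ ≃ₗᵢ[ℂ] ℂ) = 1 := one_zpow m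
  rw [h2] at h1
  simpa using h1.symm

theorem IsSpectralMeasure.unique {U : E ≃ₗᵢ[ℂ] E} {v : E} {σ τ : Measure UnitAddCircle}
    (hσ : IsSpectralMeasure U v σ) (hτ : IsSpectralMeasure U v τ) : σ = τ := by
  have := hσ.1
  have := hτ.1
  exact measure_circle_ext fun n => by rw [hσ.2, hτ.2]

theorem exists_isSpectralMeasure [CompleteSpace E] (U : E ≃ₗᵢ[ℂ] E) (v : E) :
    ∃ σ, IsSpectralMeasure U v σ := by
  obtain ⟨Φ, hΦ⟩ := exists_circle_functionalCalculus U
  obtain ⟨σ, h1, h2⟩ := exists_measure_of_functionalCalculus Φ v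
  exact ⟨σ, h1, fun n => by rw [h2, hΦ]⟩

variable [CompleteSpace E]

/-- The spectral measure of a vector. -/
def spectralMeasure (U : E ≃ₗᵢ[ℂ] E) (v : E) : Measure UnitAddCircle :=
  (exists_isSpectralMeasure U v).choose

theorem isSpectralMeasure_spectralMeasure (U : E ≃ₗᵢ[ℂ] E) (v : E) :
    IsSpectralMeasure U v (spectralMeasure U v) :=
  (exists_isSpectralMeasure U v).choose_spec

instance (U : E ≃ₗᵢ[ℂ] E) (v : E) : IsFiniteMeasure (spectralMeasure U v) :=
  (isSpectralMeasure_spectralMeasure U v).1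

theorem integral_fourier_spectralMeasure (U : E ≃ₗᵢ[ℂ] E) (v : E) (n : ℤ) :
    ∫ t, fourier n t ∂(spectralMeasure U v) = inner ℂ v ((U ^ n) v) :=
  (isSpectralMeasure_spectralMeasure U v).2 n

theorem IsSpectralMeasure.eq_spectralMeasure {U : E ≃ₗᵢ[ℂ] E} {v : E} {σ : Measure UnitAddCircle}
    (h : IsSpectralMeasure U v σ) : σ = spectralMeasure U v :=
  h.unique (isSpectralMeasure_spectralMeasure U v)

theorem spectralMeasure_real_univ (U : E ≃ₗᵢ[ℂ] E) (v : E) :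
    (spectralMeasure U v).real Set.univ = ‖v‖ ^ 2 := by
  have := integral_fourier_spectralMeasure U v 0
  simp only [fourier_zero, integral_const, zpow_zero, LinearIsometryEquiv.coe_one, id,
    inner_self_eq_norm_sq_to_K] at this
  have h2 : (((spectralMeasure U v).real Set.univ : ℝ) : ℂ) = ((‖v‖ ^ 2 : ℝ) : ℂ) := by
    simpa using this
  exact_mod_cast h2

theorem spectralMeasure_eq_zero_iff {U : E ≃ₗᵢ[ℂ] E} {v : E} : spectralMeasure U v = 0 ↔ v = 0 := by
  constructor
  · intro h
    have := spectralMeasure_real_univ U v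
    rw [h] at this
    simpa using this.symm
  · rintro rfl
    have := spectralMeasure_real_univ U 0
    rw [norm_zero, zero_pow two_ne_zero, measureReal_eq_zero_iff (by finiteness)] at this
    exact Measure.measure_univ_eq_zero.1 this

theorem integrable_fourier (σ : Measure UnitAddCircle) [IsFiniteMeasure σ] (n : ℤ) :
    Integrable (fun t : UnitAddCircle => fourier n t) σ :=
  (fourier n).continuous.integrable_of_hasCompactSupport (HasCompactSupport.of_compactSpace _)

/-- The parallelogram identity, applied to every form `⟨x, Uⁿ y⟩`. It bounds the spectral measure of
a sum without introducing complex cross measures. -/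
theorem spectralMeasure_parallelogram (U : E ≃ₗᵢ[ℂ] E) (u v : E) :
    spectralMeasure U (u + v) + spectralMeasure U (u - v)
      = (spectralMeasure U u + spectralMeasure U u) + (spectralMeasure U v + spectralMeasure U v) := by
  refine measure_circle_ext fun n => ?_
  rw [integral_add_measure, integral_add_measure, integral_add_measure, integral_add_measure]
  · simp only [integral_fourier_spectralMeasure, map_add, map_sub, inner_add_left, inner_add_right,
      inner_sub_left, inner_sub_right]
    ring
  all_goals exact integrable_fourier _ n

theorem spectralMeasure_add_le (U : E ≃ₗᵢ[ℂ] E) (u v : E) :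
    spectralMeasure U (u + v)
      ≤ (spectralMeasure U u + spectralMeasure U u) + (spectralMeasure U v + spectralMeasure U v) := by
  rw [← spectralMeasure_parallelogram]
  exact Measure.le_add_right le_rfl

theorem spectralMeasure_add_of_orthogonal {U : E ≃ₗᵢ[ℂ] E} {u v : E}
    (h : ∀ n : ℤ, inner ℂ u ((U ^ n) v) = 0) :
    spectralMeasure U (u + v) = spectralMeasure U u + spectralMeasure U v := by
  refine measure_circle_ext fun n => ?_
  rw [integral_add_measure (integrable_fourier _ n) (integrable_fourier _ n)]
  have h2 : inner ℂ v ((U ^ n) u) = 0 := by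
    rw [inner_zpow_right, ← inner_conj_symm, h, map_zero]
  simp only [integral_fourier_spectralMeasure, map_add, inner_add_left, inner_add_right, h, h2]
  ring

theorem spectralMeasure_isometry {F : Type*} [NormedAddCommGroup F] [InnerProductSpace ℂ F]
    [CompleteSpace F] {U : E ≃ₗᵢ[ℂ] E} {V : F ≃ₗᵢ[ℂ] F} (S : E →ₗᵢ[ℂ] F)
    (hS : ∀ x, S (U x) = V (S x)) (v : E) : spectralMeasure V (S v) = spectralMeasure U v := by
  refine measure_circle_ext fun n => ?_
  rw [integral_fourier_spectralMeasure, integral_fourier_spectralMeasure,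
    ← zpow_intertwine (S := S) hS, S.inner_map_map]

theorem spectralMeasure_neg (U : E ≃ₗᵢ[ℂ] E) (v : E) :
    spectralMeasure U (-v) = spectralMeasure U v := by
  refine measure_circle_ext fun n => ?_
  rw [integral_fourier_spectralMeasure, integral_fourier_spectralMeasure]
  simp

theorem spectralMeasure_smul_absolutelyContinuous (U : E ≃ₗᵢ[ℂ] E) (c : ℂ) (v : E) :
    spectralMeasure U (c • v) ≪ spectralMeasure U v := by
  have : spectralMeasure U (c • v) = ((‖c‖₊ ^ 2 : NNReal)) • spectralMeasure U v := by
    refine measure_circle_ext fun n => ?_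
    rw [integral_smul_nnreal_measure]
    simp only [integral_fourier_spectralMeasure, map_smul, inner_smul_left, inner_smul_right,
      NNReal.smul_def]
    rw [← mul_assoc, mul_comm, mul_comm c, ← Complex.normSq_eq_conj_mul_self]
    simp [Complex.normSq_eq_norm_sq]
    ring
  rw [this]
  exact Measure.smul_absolutelyContinuous

theorem spectralMeasure_add_absolutelyContinuous {U : E ≃ₗᵢ[ℂ] E} {u v : E}
    {σ : Measure UnitAddCircle} (hu : spectralMeasure U u ≪ σ) (hv : spectralMeasure U v ≪ σ) :
    spectralMeasure U (u + v) ≪ σ :=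
  (Measure.absolutelyContinuous_of_le (spectralMeasure_add_le U u v)).trans
    (Measure.AbsolutelyContinuous.add_left (hu.add_left hu) (hv.add_left hv))

/-- The vectors whose spectral measure is dominated by `σ`. -/
def dominatedSubspace (U : E ≃ₗᵢ[ℂ] E) (σ : Measure UnitAddCircle) : Submodule ℂ E where
  carrier := {v | spectralMeasure U v ≪ σ}
  zero_mem' := by
    change spectralMeasure U 0 ≪ σ
    rw [spectralMeasure_eq_zero_iff.2 rfl]
    exact Measure.AbsolutelyContinuous.zero σ
  add_mem' := fun hu hv => spectralMeasure_add_absolutelyContinuous hu hv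
  smul_mem' := fun c v hv => (spectralMeasure_smul_absolutelyContinuous U c v).trans hv

theorem mem_dominatedSubspace {U : E ≃ₗᵢ[ℂ] E} {σ : Measure UnitAddCircle} {v : E} :
    v ∈ dominatedSubspace U σ ↔ spectralMeasure U v ≪ σ := Iff.rfl

/-- If `x` is dominated and close to `v`, then `σ_v ≤ 2 σ_x + 2 σ_{v - x}`. On a `σ`-null set only
the last measure counts, and its total mass is `‖v - x‖²`. -/
theorem isClosed_dominatedSubspace (U : E ≃ₗᵢ[ℂ] E) (σ : Measure UnitAddCircle) :
    IsClosed (dominatedSubspace U σ : Set E) := by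
  rw [← isSeqClosed_iff_isClosed]
  intro x v hx hv A hA
  rw [← measureReal_eq_zero_iff]
  have hbound : ∀ m, (spectralMeasure U v).real A ≤ 2 * ‖v - x m‖ ^ 2 := by
    intro m
    have h1 := spectralMeasure_add_le U (x m) (v - x m) A
    rw [add_sub_cancel] at h1
    simp only [Measure.coe_add, Pi.add_apply] at h1
    rw [hx m hA, zero_add, zero_add] at h1
    have h2 : (spectralMeasure U (v - x m)).real A ≤ ‖v - x m‖ ^ 2 := by
      rw [← spectralMeasure_real_univ U]
      exact measureReal_mono (Set.subset_univ _)
    have h3 := ENNReal.toReal_mono (by finiteness) h1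
    rw [ENNReal.toReal_add (by finiteness) (by finiteness)] at h3
    change (spectralMeasure U v).real A ≤ (spectralMeasure U (v - x m)).real A
      + (spectralMeasure U (v - x m)).real A at h3
    linarith
  have hlim : Tendsto (fun m => 2 * ‖v - x m‖ ^ 2) atTop (𝓝 (2 * ‖v - v‖ ^ 2)) :=
    ((tendsto_const_nhds.sub hv).norm.pow 2).const_mul 2
  have := ge_of_tendsto' hlim hbound
  simp only [sub_self, norm_zero] at this
  exact le_antisymm (by simpa using this) measureReal_nonneg

end SpectralMeasureBasic

/-! ### Cyclic spaces and mutually singular spectral measures -/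

section Cyclic

variable {E : Type*} [NormedAddCommGroup E] [InnerProductSpace ℂ E]

theorem zpow_mem_cyclicSpace (U : E ≃ₗᵢ[ℂ] E) (v : E) (n : ℤ) : (U ^ n) v ∈ cyclicSpace U v :=
  Submodule.le_topologicalClosure _ (Submodule.subset_span ⟨n, rfl⟩)

theorem mem_cyclicSpace_self (U : E ≃ₗᵢ[ℂ] E) (v : E) : v ∈ cyclicSpace U v := by
  simpa using zpow_mem_cyclicSpace U v 0

theorem isClosed_cyclicSpace (U : E ≃ₗᵢ[ℂ] E) (v : E) : IsClosed (cyclicSpace U v : Set E) :=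
  Submodule.isClosed_topologicalClosure _

theorem cyclicSpace_le {U : E ≃ₗᵢ[ℂ] E} {v : E} {M : Submodule ℂ E} (hM : IsClosed (M : Set E))
    (h : ∀ n : ℤ, (U ^ n) v ∈ M) : cyclicSpace U v ≤ M := by
  refine Submodule.topologicalClosure_minimal _ (Submodule.span_le.2 ?_) hM
  rintro _ ⟨n, rfl⟩
  exact h n

theorem isClosed_comap_isometry {F : Type*} [NormedAddCommGroup F] [InnerProductSpace ℂ F]
    {M : Submodule ℂ F} (hM : IsClosed (M : Set F)) (S : E →L[ℂ] F) :
    IsClosed ((M.comap (S : E →ₗ[ℂ] F) : Submodule ℂ E) : Set E) :=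
  hM.preimage S.continuous

theorem zpow_map_mem_cyclicSpace {U : E ≃ₗᵢ[ℂ] E} {v x : E} (hx : x ∈ cyclicSpace U v) (n : ℤ) :
    (U ^ n) x ∈ cyclicSpace U v := by
  refine cyclicSpace_le (isClosed_comap_isometry (isClosed_cyclicSpace U v)
    ((U ^ n).toContinuousLinearEquiv : E →L[ℂ] E)) (fun m => ?_) hx
  change (U ^ n) ((U ^ m) v) ∈ cyclicSpace U v
  rw [← zpow_add_apply]
  exact zpow_mem_cyclicSpace U v _

theorem cyclicSpace_mono {U : E ≃ₗᵢ[ℂ] E} {v x : E} (hx : x ∈ cyclicSpace U v) :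
    cyclicSpace U x ≤ cyclicSpace U v :=
  cyclicSpace_le (isClosed_cyclicSpace U v) (zpow_map_mem_cyclicSpace hx)

theorem mem_orthogonal_cyclicSpace {U : E ≃ₗᵢ[ℂ] E} {v q : E} :
    q ∈ (cyclicSpace U v)ᗮ ↔ ∀ n : ℤ, inner ℂ ((U ^ n) v) q = 0 := by
  constructor
  · intro h n
    exact (Submodule.mem_orthogonal _ _).1 h _ (zpow_mem_cyclicSpace U v n)
  · intro h
    have : cyclicSpace U v ≤ (ℂ ∙ q)ᗮ :=
      cyclicSpace_le (Submodule.isClosed_orthogonal _) fun n => by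
        rw [Submodule.mem_orthogonal_singleton_iff_inner_left]; exact h n
    rw [Submodule.mem_orthogonal]
    intro u hu
    exact Submodule.mem_orthogonal_singleton_iff_inner_left.1 (this hu)

theorem inner_zpow_orthogonal_cyclicSpace {U : E ≃ₗᵢ[ℂ] E} {v p q : E} (hp : p ∈ cyclicSpace U v)
    (hq : q ∈ (cyclicSpace U v)ᗮ) (n : ℤ) : inner ℂ p ((U ^ n) q) = 0 := by
  rw [inner_zpow_right]
  exact (Submodule.mem_orthogonal _ _).1 hq _ (zpow_map_mem_cyclicSpace hp _)

theorem isOrtho_cyclicSpace {U : E ≃ₗᵢ[ℂ] E} {x y : E} (h : ∀ n : ℤ, inner ℂ ((U ^ n) x) y = 0) :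
    cyclicSpace U x ⟂ cyclicSpace U y := by
  rw [Submodule.isOrtho_comm, Submodule.isOrtho_iff_le]
  refine cyclicSpace_le (Submodule.isClosed_orthogonal _) fun n => ?_
  rw [mem_orthogonal_cyclicSpace]
  intro m
  rw [inner_zpow_right, ← zpow_add_apply]
  exact h _

variable [CompleteSpace E]

instance (U : E ≃ₗᵢ[ℂ] E) (v : E) : CompleteSpace (cyclicSpace U v) :=
  (isClosed_cyclicSpace U v).completeSpace_coe

theorem exists_cyclicSpace_decomposition (U : E ≃ₗᵢ[ℂ] E) (v u : E) :
    ∃ p ∈ cyclicSpace U v, ∃ q ∈ (cyclicSpace U v)ᗮ, u = p + q ∧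
      spectralMeasure U u = spectralMeasure U p + spectralMeasure U q := by
  obtain ⟨p, hp, q, hq, h⟩ := (cyclicSpace U v).exists_add_mem_mem_orthogonal u
  refine ⟨p, hp, q, hq, h, ?_⟩
  rw [h]
  exact spectralMeasure_add_of_orthogonal fun n => inner_zpow_orthogonal_cyclicSpace hp hq n

theorem spectralMeasure_zpow (U : E ≃ₗᵢ[ℂ] E) (n : ℤ) (v : E) :
    spectralMeasure U ((U ^ n) v) = spectralMeasure U v :=
  spectralMeasure_isometry (U ^ n).toLinearIsometry (fun x => by
    change (U ^ n * U) x = (U * U ^ n) x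
    rw [← zpow_add_one, ← zpow_one_add, add_comm]) v

theorem cyclicSpace_le_dominatedSubspace (U : E ≃ₗᵢ[ℂ] E) (v : E) :
    cyclicSpace U v ≤ dominatedSubspace U (spectralMeasure U v) :=
  cyclicSpace_le (isClosed_dominatedSubspace _ _) fun n => by
    rw [mem_dominatedSubspace, spectralMeasure_zpow]

theorem spectralMeasure_absolutelyContinuous_of_mem {U : E ≃ₗᵢ[ℂ] E} {v x : E}
    (hx : x ∈ cyclicSpace U v) : spectralMeasure U x ≪ spectralMeasure U v :=
  cyclicSpace_le_dominatedSubspace U v hx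

/-- The projection of `y` to the cyclic space of `x` has a spectral measure that is dominated by
both `σ_x` and `σ_y`, hence zero. -/
theorem inner_zpow_eq_zero_of_mutuallySingular {U : E ≃ₗᵢ[ℂ] E} {x y : E}
    (h : spectralMeasure U x ⟂ₘ spectralMeasure U y) (n : ℤ) : inner ℂ ((U ^ n) x) y = 0 := by
  obtain ⟨p, hp, q, hq, hy, hσ⟩ := exists_cyclicSpace_decomposition U x y
  have hp0 : spectralMeasure U p = 0 :=
    Measure.eq_zero_of_absolutelyContinuous_of_mutuallySingular
      (spectralMeasure_absolutelyContinuous_of_mem hp)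
      (h.mono le_rfl (by rw [hσ]; exact Measure.le_add_right le_rfl)).symm
  rw [hy, spectralMeasure_eq_zero_iff.1 hp0, zero_add]
  exact mem_orthogonal_cyclicSpace.1 hq n

theorem isOrtho_cyclicSpace_of_mutuallySingular {U : E ≃ₗᵢ[ℂ] E} {x y : E}
    (h : spectralMeasure U x ⟂ₘ spectralMeasure U y) : cyclicSpace U x ⟂ cyclicSpace U y :=
  isOrtho_cyclicSpace (inner_zpow_eq_zero_of_mutuallySingular h)

/-- If `x = p + q` along the cyclic space of `x + y` and its complement, then `y = (x + y - p) - q`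
is the corresponding decomposition of `y`. So `σ_q` lies below both `σ_x` and `σ_y`, and `q = 0`. -/
theorem mem_cyclicSpace_add_of_mutuallySingular {U : E ≃ₗᵢ[ℂ] E} {x y : E}
    (h : spectralMeasure U x ⟂ₘ spectralMeasure U y) : x ∈ cyclicSpace U (x + y) := by
  obtain ⟨p, hp, q, hq, hx, hσ⟩ := exists_cyclicSpace_decomposition U (x + y) x
  have hy : y = ((x + y) - p) + (-q) := by
    have : x + y - p + -q = y + (x - (p + q)) := by abel
    rw [this, ← hx]; simp
  have hσy : spectralMeasure U y = spectralMeasure U (x + y - p) + spectralMeasure U (-q) := by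
    conv_lhs => rw [hy]
    exact spectralMeasure_add_of_orthogonal fun n => inner_zpow_orthogonal_cyclicSpace
      (Submodule.sub_mem _ (mem_cyclicSpace_self U _) hp) (Submodule.neg_mem _ hq) n
  have hq0 : spectralMeasure U q = 0 := by
    rw [← Measure.MutuallySingular.self_iff]
    refine h.mono ?_ ?_
    · rw [hσ]; exact Measure.le_add_left le_rfl
    · rw [hσy, spectralMeasure_neg]; exact Measure.le_add_left le_rfl
  have hxp : x = p := by rw [spectralMeasure_eq_zero_iff.1 hq0, add_zero] at hx; exact hx
  rwa [← hxp] at hp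

theorem cyclicSpace_add_of_mutuallySingular {U : E ≃ₗᵢ[ℂ] E} {x y : E}
    (h : spectralMeasure U x ⟂ₘ spectralMeasure U y) :
    cyclicSpace U (x + y) = cyclicSpace U x ⊔ cyclicSpace U y := by
  have hx := mem_cyclicSpace_add_of_mutuallySingular h
  have hy := mem_cyclicSpace_add_of_mutuallySingular h.symm
  rw [add_comm] at hy
  refine le_antisymm ?_ (sup_le (cyclicSpace_mono hx) (cyclicSpace_mono hy))
  intro z hz
  obtain ⟨p, hp, q, hq, hz', -⟩ := exists_cyclicSpace_decomposition U x z
  have hort := (Submodule.isOrtho_iff_le.1 (isOrtho_cyclicSpace_of_mutuallySingular h).symm)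
  obtain ⟨p', hp', q', hq', hz'', -⟩ := exists_cyclicSpace_decomposition U y q
  -- What is left of `z` after projection to both cyclic spaces still lies in that of `x + y`, but
  -- is orthogonal to all translates of `x` and of `y`.
  have hq0 : q' = 0 := by
    have h1 : q' ∈ cyclicSpace U (x + y) := by
      have e : q' = z - p - p' := by rw [hz', hz'']; abel
      rw [e]
      exact Submodule.sub_mem _ (Submodule.sub_mem _ hz (cyclicSpace_mono hx hp))
        (cyclicSpace_mono hy hp')
    have h2 : q' ∈ (cyclicSpace U x)ᗮ := by
      have e : q' = q - p' := by rw [hz'']; abel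
      rw [e]
      exact Submodule.sub_mem _ hq (hort hp')
    have h3 : q' ∈ (cyclicSpace U (x + y))ᗮ := by
      rw [mem_orthogonal_cyclicSpace] at *
      intro n
      rw [map_add, inner_add_left, h2, hq', add_zero]
    exact inner_self_eq_zero.1 ((Submodule.mem_orthogonal _ _).1 h3 _ h1)
  rw [hz', hz'', hq0, add_zero]
  exact Submodule.add_mem_sup hp hp'

end Cyclic

/-! ### The model of a cyclic space as `L²` of a spectral measure -/

section CyclicModel

/-- Density of the characters gives vanishing against continuous functions. Outer approximations of
closed sets and dominated convergence then give vanishing of the integrals over closed sets. -/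
theorem ae_eq_zero_of_fourier_integral_eq_zero {σ : Measure UnitAddCircle} [IsFiniteMeasure σ]
    {ψ : UnitAddCircle → ℂ} (hψ : Integrable ψ σ) (h : ∀ n : ℤ, ∫ t, fourier n t * ψ t ∂σ = 0) :
    ψ =ᵐ[σ] 0 := by
  have hbdd : ∀ g : C(UnitAddCircle, ℂ), Integrable (fun t => g t * ψ t) σ := fun g =>
    hψ.bdd_mul (c := ‖g‖) g.continuous.aestronglyMeasurable (ae_of_all _ fun t => g.norm_coe_le_norm t)
  have hcont : ∀ g : C(UnitAddCircle, ℂ), ∫ t, g t * ψ t ∂σ = 0 := by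
    have key : Continuous fun g : C(UnitAddCircle, ℂ) => ∫ t, g t * ψ t ∂σ := by
      refine continuous_iff_continuousAt.2 fun g => tendsto_iff_norm_sub_tendsto_zero.2 ?_
      refine squeeze_zero (fun _ => norm_nonneg _) (fun g' => ?_)
        (g := fun g' => ‖g' - g‖ * ∫ t, ‖ψ t‖ ∂σ) ?_
      · rw [← integral_sub (hbdd _) (hbdd _), ← integral_const_mul]
        refine norm_integral_le_of_norm_le (hψ.norm.const_mul _) (ae_of_all _ fun t => ?_)
        rw [← sub_mul, norm_mul]
        gcongr
        exact (g' - g).norm_coe_le_norm t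
      · have : Tendsto (fun g' : C(UnitAddCircle, ℂ) => ‖g' - g‖ * ∫ t, ‖ψ t‖ ∂σ) (𝓝 g)
            (𝓝 (‖g - g‖ * ∫ t, ‖ψ t‖ ∂σ)) := by
          apply Continuous.tendsto
          fun_prop
        simpa using this
    intro g
    have hg : g ∈ (Submodule.span ℂ (Set.range (@fourier 1))).topologicalClosure := by
      rw [span_fourier_closure_eq_top]; trivial
    refine closure_minimal
      (s := (Submodule.span ℂ (Set.range (@fourier 1)) : Set C(UnitAddCircle, ℂ)))
      (t := {g | ∫ t, g t * ψ t ∂σ = 0}) ?_ (isClosed_eq key continuous_const) hg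
    intro g hg
    refine Submodule.span_induction ?_ ?_ ?_ ?_ hg
    · rintro _ ⟨n, rfl⟩; exact h n
    · simp
    · intro x y _ _ hx hy
      simp only [Set.mem_ofPred_eq, ContinuousMap.add_apply, add_mul] at *
      rw [integral_add (hbdd _) (hbdd _), hx, hy, add_zero]
    · intro c x _ hx
      simp only [Set.mem_ofPred_eq, ContinuousMap.smul_apply, smul_mul_assoc] at *
      rw [integral_smul, hx, smul_zero]
  refine ae_eq_zero_of_forall_setIntegral_isClosed_eq_zero hψ fun s hs => ?_
  let g : ℕ → UnitAddCircle → ℂ := fun n t => ((hs.apprSeq n t : NNReal) : ℝ)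
  have hg : ∀ n, ∫ t, g n t * ψ t ∂σ = 0 := fun n =>
    hcont ⟨g n, by
      have := (hs.apprSeq n).continuous
      fun_prop⟩
  have hlim : Tendsto (fun n => ∫ t, g n t * ψ t ∂σ) atTop
      (𝓝 (∫ t, s.indicator (fun _ => (1 : ℂ)) t * ψ t ∂σ)) := by
    refine tendsto_integral_of_dominated_convergence (fun t => ‖ψ t‖) ?_ hψ.norm ?_ ?_
    · intro n
      exact (hbdd ⟨g n, by
        have := (hs.apprSeq n).continuous
        fun_prop⟩).aestronglyMeasurable
    · intro n
      refine ae_of_all _ fun t => ?_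
      rw [norm_mul]
      have : ‖g n t‖ ≤ 1 := by
        simp only [g, Complex.norm_real, NNReal.norm_eq]
        exact_mod_cast HasOuterApproxClosed.apprSeq_apply_le_one hs n t
      nlinarith [norm_nonneg (ψ t)]
    · refine ae_of_all _ fun t => ?_
      refine Tendsto.mul_const _ ?_
      have h1 := (tendsto_pi_nhds.1 (HasOuterApproxClosed.tendsto_apprSeq hs)) t
      have h2 : Tendsto (fun n => (((hs.apprSeq n t : NNReal) : ℝ) : ℂ)) atTop
          (𝓝 (((s.indicator (fun _ => (1 : NNReal)) t : NNReal) : ℝ) : ℂ)) :=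
        ((Complex.continuous_ofReal.comp NNReal.continuous_coe).tendsto _).comp h1
      convert h2 using 2
      by_cases ht : t ∈ s <;> simp [ht]
  have h0 := tendsto_nhds_unique hlim (by simp only [hg]; exact tendsto_const_nhds)
  rw [← h0, ← integral_indicator hs.measurableSet]
  congr 1
  ext t
  by_cases ht : t ∈ s <;> simp [ht]

variable {E : Type*} [NormedAddCommGroup E] [InnerProductSpace ℂ E] [CompleteSpace E]

/-- The cyclic space of `v` is modelled by `L²` of the spectral measure. -/
theorem exists_cyclic_model (U : E ≃ₗᵢ[ℂ] E) (v : E) :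
    ∃ J : Lp ℂ 2 (spectralMeasure U v) →ₗᵢ[ℂ] E,
      (∀ g : Lp ℂ 2 (spectralMeasure U v), (g : UnitAddCircle → ℂ) =ᵐ[spectralMeasure U v] 1 →
        J g = v) ∧
      (∀ (n : ℤ) (g h : Lp ℂ 2 (spectralMeasure U v)),
        (h : UnitAddCircle → ℂ) =ᵐ[spectralMeasure U v] (fun t => fourier n t * g t) →
          J h = (U ^ n) (J g)) ∧
      ∀ x, x ∈ cyclicSpace U v ↔ x ∈ Set.range J := by
  obtain ⟨Φ, hΦ⟩ := exists_circle_functionalCalculus U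
  obtain ⟨τ, h1, h2⟩ := exists_measure_of_functionalCalculus Φ v
  have hτ : τ = spectralMeasure U v :=
    IsSpectralMeasure.eq_spectralMeasure ⟨h1, fun n => by rw [h2, hΦ]⟩
  subst hτ
  set σ := spectralMeasure U v
  let e : C(UnitAddCircle, ℂ) →ₗ[ℂ] Lp ℂ 2 σ := (ContinuousMap.toLp 2 σ ℂ).toLinearMap
  have he : DenseRange e := ContinuousMap.toLp_denseRange ℂ σ ℂ (by simp)
  let f : C(UnitAddCircle, ℂ) →ₗ[ℂ] E :=
    { toFun := fun g => Φ g v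
      map_add' := fun g h => by simp
      map_smul' := fun c g => by simp }
  -- Indeed `‖Φ(g) v‖² = ⟨v, Φ(ḡ g) v⟩ = ∫ |g|² dσ`; so `g ↦ Φ(g) v` extends from the dense
  -- continuous functions to an isometry.
  have hinner : ∀ g, ‖f g‖ = ‖e g‖ := by
    intro g
    have ha : inner ℂ (f g) (f g) = inner ℂ (e g) (e g) := by
      change inner ℂ (Φ g v) (Φ g v) = inner ℂ (ContinuousMap.toLp 2 σ ℂ g) (ContinuousMap.toLp 2 σ ℂ g)
      rw [ContinuousMap.inner_toLp, ← ContinuousLinearMap.adjoint_inner_right,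
        ← ContinuousLinearMap.star_eq_adjoint, ← map_star, ← mul_apply_eq_comp, ← map_mul, ← h2]
      congr 1; ext t; simp [mul_comm]
    rw [inner_self_eq_norm_sq_to_K, inner_self_eq_norm_sq_to_K] at ha
    have : ‖f g‖ ^ 2 = ‖e g‖ ^ 2 := by exact_mod_cast ha
    exact (sq_eq_sq₀ (norm_nonneg _) (norm_nonneg _)).1 this
  have hbound : ∃ C, ∀ g, ‖f g‖ ≤ C * ‖e g‖ := ⟨1, fun g => by rw [one_mul, hinner]⟩
  let J₀ : Lp ℂ 2 σ →L[ℂ] E := f.extendOfNorm e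
  have hJ₀ : ∀ g, J₀ (e g) = Φ g v := fun g => LinearMap.extendOfNorm_eq he hbound g
  have hnorm : ∀ x, ‖J₀ x‖ = ‖x‖ := by
    intro x
    refine he.induction_on (p := fun x => ‖J₀ x‖ = ‖x‖) x
      (isClosed_eq J₀.continuous.norm continuous_norm) fun g => ?_
    rw [hJ₀, ← hinner]; rfl
  let J : Lp ℂ 2 σ →ₗᵢ[ℂ] E := ⟨J₀.toLinearMap, hnorm⟩
  have hJ : ∀ g, J (e g) = Φ g v := hJ₀
  have hfour : ∀ n : ℤ, J (e (fourier n)) = (U ^ n) v := fun n => by rw [hJ, hΦ]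
  have he_coe : ∀ g, (e g : UnitAddCircle → ℂ) =ᵐ[σ] g := fun g => ContinuousMap.coeFn_toLp σ g
  have hmul : ∀ (n : ℤ) (g h : Lp ℂ 2 σ),
        (h : UnitAddCircle → ℂ) =ᵐ[σ] (fun t => fourier n t * g t) → J h = (U ^ n) (J g) := by
    intro n
    let b : Lp ℂ ∞ σ := ContinuousMap.toLp ∞ σ ℂ (fourier n)
    let M : Lp ℂ 2 σ →L[ℂ] Lp ℂ 2 σ := (ContinuousLinearMap.mul ℂ ℂ).holderL σ ∞ 2 2 b
    have hM : ∀ g : Lp ℂ 2 σ, (M g : UnitAddCircle → ℂ) =ᵐ[σ] fun t => fourier n t * g t := by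
      intro g
      filter_upwards [(ContinuousLinearMap.mul ℂ ℂ).coeFn_holder (r := 2) b g,
        ContinuousMap.coeFn_toLp (p := ∞) (𝕜 := ℂ) σ (fourier n)] with t ht1 ht2
      change ((ContinuousLinearMap.mul ℂ ℂ).holder 2 b g : UnitAddCircle → ℂ) t = _
      rw [ht1, ContinuousLinearMap.mul_apply', ht2]
    have hJM : ∀ g, J (M g) = (U ^ n) (J g) := by
      intro g
      refine he.induction_on (p := fun g => J (M g) = (U ^ n) (J g)) g
        (isClosed_eq (J.continuous.comp M.continuous) ((U ^ n).continuous.comp J.continuous))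
        fun k => ?_
      have : M (e k) = e (fourier n * k) := by
        apply Lp.ext
        filter_upwards [hM (e k), he_coe k, he_coe (fourier n * k)] with t h1 h2 h3
        rw [h1, h2, h3]; rfl
      rw [this, hJ, hJ, map_mul, mul_apply_eq_comp, hΦ]
    intro g h hh
    have : h = M g := Lp.ext (hh.trans (hM g).symm)
    rw [this, hJM]
  have hrange : IsClosed (Set.range J) := J.isometry.isClosedEmbedding.isClosed_range
  refine ⟨J, ?_, hmul, fun x => ⟨fun hx => ?_, ?_⟩⟩
  · intro g hg
    have : g = e (fourier 0) := Lp.ext (hg.trans ((he_coe _).trans (by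
      refine ae_of_all _ fun t => ?_
      simp)).symm)
    rw [this, hfour]; simp
  · have : cyclicSpace U v ≤ LinearMap.range J.toLinearMap :=
      cyclicSpace_le hrange fun n => ⟨_, hfour n⟩
    exact this hx
  · rintro ⟨g, rfl⟩
    refine he.induction_on (p := fun g => J g ∈ cyclicSpace U v) g
      ((isClosed_cyclicSpace U v).preimage J.continuous) fun k => ?_
    have hk : k ∈ (Submodule.span ℂ (Set.range (@fourier 1))).topologicalClosure := by
      rw [span_fourier_closure_eq_top]; trivial
    have hc : Continuous fun k : C(UnitAddCircle, ℂ) => J (e k) :=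
      J.continuous.comp (ContinuousMap.toLp 2 σ ℂ).continuous
    refine closure_minimal
      (s := (Submodule.span ℂ (Set.range (@fourier 1)) : Set C(UnitAddCircle, ℂ)))
      (t := {k | J (e k) ∈ cyclicSpace U v}) ?_ ((isClosed_cyclicSpace U v).preimage hc) hk
    intro k hk
    refine Submodule.span_induction ?_ ?_ ?_ ?_ hk
    · rintro _ ⟨n, rfl⟩
      change J (e (fourier n)) ∈ cyclicSpace U v
      rw [hfour]; exact zpow_mem_cyclicSpace U v n
    · change J (e 0) ∈ cyclicSpace U v
      simp
    · intro x y _ _ hx hy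
      change J (e (x + y)) ∈ cyclicSpace U v
      rw [map_add, map_add]; exact Submodule.add_mem _ hx hy
    · intro c x _ hx
      change J (e (c • x)) ∈ cyclicSpace U v
      rw [map_smul, map_smul]; exact Submodule.smul_mem _ _ hx

end CyclicModel

/-! ### Consequences of the model: generators, densities, singularity -/

section CyclicModelApplications

/-- The trigonometric polynomial with given coefficients. -/
def trigPoly (p : ℤ →₀ ℂ) : C(UnitAddCircle, ℂ) :=
  Finsupp.linearCombination ℂ (fun n : ℤ => (fourier n : C(UnitAddCircle, ℂ))) p

variable {E : Type*} [NormedAddCommGroup E] [InnerProductSpace ℂ E]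

/-- The value at `x` of a trigonometric polynomial of a unitary operator. -/
def trigApply (U : E ≃ₗᵢ[ℂ] E) (p : ℤ →₀ ℂ) (x : E) : E :=
  Finsupp.linearCombination ℂ (fun n : ℤ => (U ^ n) x) p

theorem trigApply_mem_cyclicSpace (U : E ≃ₗᵢ[ℂ] E) (p : ℤ →₀ ℂ) (x : E) :
    trigApply U p x ∈ cyclicSpace U x := by
  rw [trigApply, Finsupp.linearCombination_apply]
  exact Submodule.sum_mem _ fun n _ => Submodule.smul_mem _ _ (zpow_mem_cyclicSpace U x n)

variable [CompleteSpace E]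

/-- An isometry `J` of `L²` of the spectral measure of `v` onto the cyclic space of `v` that takes
the constant `1` to `v` and multiplication by characters to powers of `U`. -/
structure IsCyclicModel (U : E ≃ₗᵢ[ℂ] E) (v : E) (J : Lp ℂ 2 (spectralMeasure U v) →ₗᵢ[ℂ] E) :
    Prop where
  one : ∀ g : Lp ℂ 2 (spectralMeasure U v),
    (g : UnitAddCircle → ℂ) =ᵐ[spectralMeasure U v] 1 → J g = v
  mul : ∀ (n : ℤ) (g h : Lp ℂ 2 (spectralMeasure U v)),
    (h : UnitAddCircle → ℂ) =ᵐ[spectralMeasure U v] (fun t => fourier n t * g t) →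
      J h = (U ^ n) (J g)
  range : ∀ x, x ∈ cyclicSpace U v ↔ x ∈ Set.range J

theorem exists_isCyclicModel (U : E ≃ₗᵢ[ℂ] E) (v : E) : ∃ J, IsCyclicModel U v J := by
  obtain ⟨J, h1, h2, h3⟩ := exists_cyclic_model U v
  exact ⟨J, h1, h2, h3⟩

variable {U : E ≃ₗᵢ[ℂ] E} {v : E} {J : Lp ℂ 2 (spectralMeasure U v) →ₗᵢ[ℂ] E}

theorem memLp_continuous_mul {σ : Measure UnitAddCircle} [IsFiniteMeasure σ]
    (k : C(UnitAddCircle, ℂ)) (g : Lp ℂ 2 σ) : MemLp (fun t => k t * g t) 2 σ := by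
  have : MemLp (fun t : UnitAddCircle => k t) ∞ σ := 
    MemLp.of_bound k.continuous.aestronglyMeasurable ‖k‖ (ae_of_all _ fun t => k.norm_coe_le_norm t)
  exact (Lp.memLp g).mul (p := ∞) (q := 2) this

theorem integrable_conj_mul_mul {σ : Measure UnitAddCircle} [IsFiniteMeasure σ]
    (k : C(UnitAddCircle, ℂ)) (g h : Lp ℂ 2 σ) :
    Integrable (fun t => k t * (conj (g t) * h t)) σ := by
  have h1 := L2.integrable_inner (𝕜 := ℂ) g (memLp_continuous_mul k h).toLp
  refine h1.congr ?_
  filter_upwards [(memLp_continuous_mul k h).coeFn_toLp] with t ht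
  rw [ht]; simp; ring

theorem IsCyclicModel.inner_trigApply (hJ : IsCyclicModel U v J) (p : ℤ →₀ ℂ)
    (g h : Lp ℂ 2 (spectralMeasure U v)) :
    inner ℂ (J g) (trigApply U p (J h))
      = ∫ t, trigPoly p t * (conj (g t) * h t) ∂(spectralMeasure U v) := by
  induction p using Finsupp.induction_linear with
  | zero => simp [trigApply, trigPoly]
  | add p q hp hq =>
    simp only [trigApply, trigPoly, map_add, inner_add_right, ContinuousMap.add_apply, add_mul] at *
    rw [hp, hq, integral_add (integrable_conj_mul_mul _ _ _) (integrable_conj_mul_mul _ _ _)]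
  | single n c =>
    simp only [trigApply, trigPoly, Finsupp.linearCombination_single, inner_smul_right,
      ContinuousMap.smul_apply, smul_mul_assoc]
    rw [integral_smul, ← hJ.mul n h (memLp_continuous_mul (fourier n) h).toLp
      (memLp_continuous_mul (fourier n) h).coeFn_toLp, J.inner_map_map, L2.inner_def, smul_eq_mul]
    congr 1
    refine integral_congr_ae ?_
    filter_upwards [(memLp_continuous_mul (fourier n) h).coeFn_toLp] with t ht
    rw [ht]; simp; ring

theorem IsCyclicModel.inner_zpow (hJ : IsCyclicModel U v J) (n : ℤ)
    (g h : Lp ℂ 2 (spectralMeasure U v)) :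
    inner ℂ (J g) ((U ^ n) (J h))
      = ∫ t, fourier n t * (conj (g t) * h t) ∂(spectralMeasure U v) := by
  have := hJ.inner_trigApply (Finsupp.single n 1) g h
  simpa only [trigApply, trigPoly, Finsupp.linearCombination_single, one_smul] using this

theorem integrable_conj_mul {σ : Measure UnitAddCircle} [IsFiniteMeasure σ]
    (g h : Lp ℂ 2 σ) : Integrable (fun t => conj (g t) * h t) σ := by
  simpa using integrable_conj_mul_mul (1 : C(UnitAddCircle, ℂ)) g h

theorem IsCyclicModel.map_trigPoly (hJ : IsCyclicModel U v J) (p : ℤ →₀ ℂ) :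
    J (ContinuousMap.toLp 2 (spectralMeasure U v) ℂ (trigPoly p)) = trigApply U p v := by
  obtain ⟨o, ho⟩ : ∃ o : Lp ℂ 2 (spectralMeasure U v),
      (o : UnitAddCircle → ℂ) =ᵐ[spectralMeasure U v] 1 :=
    ⟨(memLp_const (1 : ℂ)).toLp, (memLp_const (1 : ℂ)).coeFn_toLp⟩
  induction p using Finsupp.induction_linear with
  | zero => simp [trigApply, trigPoly]
  | add p q hp hq =>
    simp only [trigApply, trigPoly, map_add] at *
    rw [hp, hq]
  | single n c =>
    simp only [trigApply, trigPoly, Finsupp.linearCombination_single, map_smul]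
    rw [hJ.mul n o, hJ.one o ho]
    filter_upwards [ho, ContinuousMap.coeFn_toLp (p := 2) (𝕜 := ℂ) (spectralMeasure U v)
      (fourier n)] with t h1 h2
    rw [h2, h1]; simp

theorem IsCyclicModel.spectralMeasure_map (hJ : IsCyclicModel U v J)
    (g : Lp ℂ 2 (spectralMeasure U v)) :
    spectralMeasure U (J g) = (spectralMeasure U v).withDensity fun t => ‖g t‖ₑ ^ 2 := by
  have hfin : ∫⁻ t, ‖g t‖ₑ ^ 2 ∂(spectralMeasure U v) < ∞ := by
    have := (Lp.memLp g).2
    rw [eLpNorm_lt_top_iff_lintegral_rpow_enorm_lt_top (by simp) (by simp)] at this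
    simpa using this
  have : IsFiniteMeasure ((spectralMeasure U v).withDensity fun t => ‖g t‖ₑ ^ 2) :=
    isFiniteMeasure_withDensity hfin.ne
  have hm : AEMeasurable (fun t => ‖g t‖ₑ ^ 2) (spectralMeasure U v) :=
    (Lp.aestronglyMeasurable g).enorm.pow_const 2
  refine measure_circle_ext fun n => ?_
  rw [integral_fourier_spectralMeasure, hJ.inner_zpow,
    integral_withDensity_eq_integral_toReal_smul₀ hm (ae_of_all _ fun t => by simp)]
  refine integral_congr_ae (ae_of_all _ fun t => ?_)
  simp only [ENNReal.toReal_pow, toReal_enorm]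
  rw [← Complex.normSq_eq_conj_mul_self, Complex.normSq_eq_norm_sq, mul_comm, Complex.real_smul]

theorem IsCyclicModel.mul_eq_zero (hJ : IsCyclicModel U v J) {g h : Lp ℂ 2 (spectralMeasure U v)}
    (hgh : ∀ n : ℤ, inner ℂ (J g) ((U ^ n) (J h)) = 0) :
    (fun t => conj (g t) * h t) =ᵐ[spectralMeasure U v] 0 :=
  ae_eq_zero_of_fourier_integral_eq_zero (integrable_conj_mul g h) fun n => by
    rw [← hJ.inner_zpow]; exact hgh n

/-- In the model of `u` the vector `e` is a function `g` with `σ_e = |g|² σ_u`, so the hypothesis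
says that `g` vanishes almost nowhere. The part of `u` orthogonal to the cyclic space of `e` is a
function `k` with `ḡ k = 0`, hence zero. -/
theorem mem_cyclicSpace_of_absolutelyContinuous {u e : E} (he : e ∈ cyclicSpace U u)
    (h : spectralMeasure U u ≪ spectralMeasure U e) : u ∈ cyclicSpace U e := by
  obtain ⟨J, hJ⟩ := exists_isCyclicModel U u
  obtain ⟨p, hp, q, hq, hu, -⟩ := exists_cyclicSpace_decomposition U e u
  have hqu : q ∈ cyclicSpace U u := by
    have : q = u - p := by rw [hu]; abel
    rw [this]
    exact Submodule.sub_mem _ (mem_cyclicSpace_self U u) (cyclicSpace_mono he hp)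
  obtain ⟨g, rfl⟩ := (hJ.range e).1 he
  obtain ⟨k, rfl⟩ := (hJ.range q).1 hqu
  have h0 := hJ.mul_eq_zero (g := g) (h := k) fun n =>
    inner_zpow_orthogonal_cyclicSpace (mem_cyclicSpace_self U _) hq n
  rw [hJ.spectralMeasure_map] at h
  have hg : ∀ᵐ t ∂(spectralMeasure U u), g t ≠ 0 := by
    have hg' : ∀ᵐ t ∂((spectralMeasure U u).withDensity fun t => ‖g t‖ₑ ^ 2), g t ≠ 0 := by
     rw [ae_withDensity_iff_ae_restrict']
     · refine (ae_restrict_iff'₀ ?_).2 (ae_of_all _ fun t ht => ?_)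
       · exact ((Lp.aestronglyMeasurable g).enorm.pow_const 2).nullMeasurableSet_preimage
           (MeasurableSet.singleton 0).compl
       · intro h0
         simp [h0] at ht
     · exact (Lp.aestronglyMeasurable g).enorm.pow_const 2
    exact h.ae_le hg'
  have hk : k = 0 := by
    apply Lp.ext
    filter_upwards [hg, h0, Lp.coeFn_zero ℂ 2 (spectralMeasure U u)] with t h1 h2 h3
    rw [h3]
    simpa [h1] using h2
  rw [hk, map_zero, add_zero] at hu
  exact Set.mem_of_eq_of_mem hu hp

/-- In the model, the square root of the density of `τ` represents the new generator. Thus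
equivalence of spectral types can be improved to equality of spectral measures. -/
theorem exists_spectralMeasure_eq {v : E} {τ : Measure UnitAddCircle} [IsFiniteMeasure τ]
    (h1 : τ ≪ spectralMeasure U v) (h2 : spectralMeasure U v ≪ τ) :
    ∃ v', cyclicSpace U v' = cyclicSpace U v ∧ spectralMeasure U v' = τ := by
  obtain ⟨J, hJ⟩ := exists_isCyclicModel U v
  let g : UnitAddCircle → ℂ := fun t => (Real.sqrt (τ.rnDeriv (spectralMeasure U v) t).toReal : ℂ)
  have hgm : Measurable g := by
    have := Measure.measurable_rnDeriv τ (spectralMeasure U v)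
    fun_prop
  have hg2 : ∀ᵐ t ∂(spectralMeasure U v), ‖g t‖ₑ ^ 2 = τ.rnDeriv (spectralMeasure U v) t := by
    filter_upwards [Measure.rnDeriv_lt_top τ (spectralMeasure U v)] with t ht
    have : ‖g t‖ₑ ^ 2 = ENNReal.ofReal (‖g t‖ ^ 2) := by
      rw [← ofReal_norm, ENNReal.ofReal_pow (norm_nonneg _)]
    rw [this]
    simp only [g, Complex.norm_real, Real.norm_eq_abs, sq_abs, Real.sq_sqrt ENNReal.toReal_nonneg]
    exact ENNReal.ofReal_toReal ht.ne
  have hmem : MemLp g 2 (spectralMeasure U v) := by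
    refine ⟨hgm.aestronglyMeasurable, ?_⟩
    rw [eLpNorm_lt_top_iff_lintegral_rpow_enorm_lt_top (by simp) (by simp)]
    have : ∫⁻ t, ‖g t‖ₑ ^ (2 : ℝ≥0∞).toReal ∂(spectralMeasure U v) =
        ∫⁻ t, τ.rnDeriv (spectralMeasure U v) t ∂(spectralMeasure U v) := by
      refine lintegral_congr_ae ?_
      filter_upwards [hg2] with t ht
      simpa using ht
    rw [this]
    exact Measure.lintegral_rnDeriv_lt_top τ (spectralMeasure U v)
  have hspec : spectralMeasure U (J hmem.toLp) = τ := by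
    rw [hJ.spectralMeasure_map]
    have : (fun t => ‖hmem.toLp g t‖ₑ ^ 2) =ᵐ[spectralMeasure U v]
        τ.rnDeriv (spectralMeasure U v) := by
      filter_upwards [hg2, hmem.coeFn_toLp] with t ht1 ht2
      rw [ht2, ht1]
    have := Measure.haveLebesgueDecomposition_of_sigmaFinite τ (spectralMeasure U v)
    rw [withDensity_congr_ae ‹_›, Measure.withDensity_rnDeriv_eq τ (spectralMeasure U v) h1]
  have hmemc : J hmem.toLp ∈ cyclicSpace U v := (hJ.range _).2 ⟨_, rfl⟩
  refine ⟨J hmem.toLp, le_antisymm (cyclicSpace_mono hmemc) (cyclicSpace_mono ?_), hspec⟩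
  exact mem_cyclicSpace_of_absolutelyContinuous hmemc (by rw [hspec]; exact h2)

/-- In the model the indicator of `{0}` is invariant under multiplication by characters, hence
represents an invariant vector. -/
theorem spectralMeasure_singleton_zero {v : E} (h : ∀ x ∈ cyclicSpace U v, U x = x → x = 0) :
    spectralMeasure U v {0} = 0 := by
  obtain ⟨J, hJ⟩ := exists_isCyclicModel U v
  let g : Lp ℂ 2 (spectralMeasure U v) :=
    indicatorConstLp 2 (MeasurableSet.singleton (0 : UnitAddCircle)) (by finiteness) 1
  have hU : U (J g) = J g := by
    have := hJ.mul 1 g g (by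
      filter_upwards [indicatorConstLp_coeFn (p := 2) (μ := spectralMeasure U v)
        (hs := MeasurableSet.singleton (0 : UnitAddCircle)) (hμs := by finiteness) (c := (1 : ℂ))]
        with t ht
      rw [ht]
      by_cases h0 : t = 0
      · simp [h0]
      · simp [h0])
    rw [zpow_one] at this
    exact this.symm
  have h0 := h _ ((hJ.range _).2 ⟨g, rfl⟩) hU
  have h1 : g = 0 := by
    rw [← norm_eq_zero, ← J.norm_map, h0, norm_zero]
  rw [← norm_eq_zero, norm_indicatorConstLp (by simp) (by simp)] at h1
  simp only [norm_one, ENNReal.toReal_ofNat, one_div, one_mul] at h1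
  rw [Real.rpow_eq_zero measureReal_nonneg (by norm_num)] at h1
  exact (measureReal_eq_zero_iff (by finiteness)).1 h1

/-- The polynomials tend to zero in `L²(σ_u)`, hence along a subsequence at almost every point for
`σ_u`. In the model of `v` they converge weakly to the function `h` that represents `f`. On the set
where they tend to zero pointwise, `h` must vanish, so this set is null for `σ_f = |h|² σ_v`. -/
theorem mutuallySingular_of_trigApply {F : Type*} [NormedAddCommGroup F] [InnerProductSpace ℂ F]
    [CompleteSpace F] {U : E ≃ₗᵢ[ℂ] E} {V : F ≃ₗᵢ[ℂ] F} {v f : E} {u : F} (p : ℕ → ℤ →₀ ℂ)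
    (hf : ∀ y, Tendsto (fun n => inner ℂ y (trigApply U (p n) v)) atTop (𝓝 (inner ℂ y f)))
    (hu : Tendsto (fun n => trigApply V (p n) u) atTop (𝓝 0)) :
    spectralMeasure U f ⟂ₘ spectralMeasure V u := by
  obtain ⟨J, hJ⟩ := exists_isCyclicModel U v
  have hfc : f ∈ cyclicSpace U v := by
    obtain ⟨a, ha, b, hb, hab, -⟩ := exists_cyclicSpace_decomposition U v f
    have h1 : inner ℂ b f = 0 := by
      refine tendsto_nhds_unique (hf b) ?_
      have : ∀ n, inner ℂ b (trigApply U (p n) v) = 0 := fun n =>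
        (Submodule.mem_orthogonal' _ _).1 hb _ (trigApply_mem_cyclicSpace U (p n) v)
      simp only [this]; exact tendsto_const_nhds
    have h2 : b = 0 := by
      rw [hab, inner_add_right, (Submodule.mem_orthogonal' _ _).1 hb _ ha, zero_add] at h1
      exact inner_self_eq_zero.1 h1
    rw [hab, h2, add_zero]; exact ha
  obtain ⟨h, rfl⟩ := (hJ.range f).1 hfc
  obtain ⟨k, hk⟩ := exists_isCyclicModel V u
  let q : ℕ → Lp ℂ 2 (spectralMeasure V u) := fun n =>
    ContinuousMap.toLp 2 (spectralMeasure V u) ℂ (trigPoly (p n))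
  have hq : Tendsto q atTop (𝓝 0) := by
    rw [tendsto_zero_iff_norm_tendsto_zero] at hu ⊢
    refine hu.congr fun n => ?_
    rw [← hk.map_trigPoly, k.norm_map]
  obtain ⟨ns, hns, hae⟩ := (tendstoInMeasure_of_tendsto_Lp hq).exists_seq_tendsto_ae
  let φ : ℕ → UnitAddCircle → ℂ := fun i t => trigPoly (p (ns i)) t
  have hφc : ∀ i, Continuous (φ i) := fun i => (trigPoly (p (ns i))).continuous
  let B : Set UnitAddCircle := {t | Tendsto (fun i => φ i t) atTop (𝓝 0)}
  have hB : MeasurableSet B :=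
    measurableSet_tendsto_fun (fun i => (hφc i).measurable) measurable_const
  have hBu : spectralMeasure V u Bᶜ = 0 := by
    have : ∀ᵐ t ∂(spectralMeasure V u), t ∈ B := by
      have h1 : ∀ᵐ t ∂(spectralMeasure V u), ∀ i, q (ns i) t = φ i t :=
        ae_all_iff.2 fun i => ContinuousMap.coeFn_toLp _ _
      filter_upwards [hae, h1, Lp.coeFn_zero ℂ 2 (spectralMeasure V u)] with t ht h1 h2
      rw [h2] at ht
      simp only [h1] at ht
      exact ht
    exact this
  refine ⟨B, hB, ?_, hBu⟩
  -- On `D M` the polynomials are bounded by `M`, so dominated convergence applies to their pairing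
  -- with the restriction of `h`. The limit is zero, while the weak limit is the integral of `|h|²`
  -- over `D M`.
  let D : ℕ → Set UnitAddCircle := fun M => B ∩ ⋂ i, {t | ‖φ i t‖ ≤ M}
  have hD : ∀ M, MeasurableSet (D M) := fun M => hB.inter
    (MeasurableSet.iInter fun i => ((isClosed_le (hφc i).norm continuous_const).measurableSet))
  have hBD : B ⊆ ⋃ M, D M := by
    intro t ht
    obtain ⟨C, hC⟩ := (Metric.isBounded_range_of_tendsto _ ht).exists_norm_le
    obtain ⟨M, hM⟩ := exists_nat_ge C
    refine Set.mem_iUnion.2 ⟨M, ht, Set.mem_iInter.2 fun i => ?_⟩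
    exact (hC _ ⟨i, rfl⟩).trans hM
  refine measure_mono_null hBD (measure_iUnion_null fun M => ?_)
  obtain ⟨o, ho⟩ : ∃ o : Lp ℂ 2 (spectralMeasure U v),
      (o : UnitAddCircle → ℂ) =ᵐ[spectralMeasure U v] 1 :=
    ⟨(memLp_const (1 : ℂ)).toLp, (memLp_const (1 : ℂ)).coeFn_toLp⟩
  have hmem : MemLp ((D M).indicator h) 2 (spectralMeasure U v) := (Lp.memLp h).indicator (hD M)
  let g := hmem.toLp
  have hg : (g : UnitAddCircle → ℂ) =ᵐ[spectralMeasure U v] (D M).indicator h := hmem.coeFn_toLp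
  have hint : Integrable h (spectralMeasure U v) := (Lp.memLp h).integrable (by norm_num)
  have hlim0 : Tendsto (fun i => inner ℂ (J g) (trigApply U (p (ns i)) v)) atTop (𝓝 0) := by
    have e : ∀ i, inner ℂ (J g) (trigApply U (p (ns i)) v)
        = ∫ t, φ i t * conj ((D M).indicator h t) ∂(spectralMeasure U v) := by
      intro i
      have := hJ.inner_trigApply (p (ns i)) g o
      rw [hJ.one o ho] at this
      rw [this]
      refine integral_congr_ae ?_
      filter_upwards [ho, hg] with t h1 h2
      rw [h1, h2]; simp [φ]
    simp only [e]
    rw [← integral_zero UnitAddCircle ℂ (μ := spectralMeasure U v)]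
    refine tendsto_integral_of_dominated_convergence (fun t => M * ‖h t‖) (fun i => ?_)
      (hint.norm.const_mul _) (fun i => ae_of_all _ fun t => ?_) (ae_of_all _ fun t => ?_)
    · exact (hφc i).aestronglyMeasurable.mul
        (Complex.continuous_conj.comp_aestronglyMeasurable hmem.aestronglyMeasurable)
    · by_cases ht : t ∈ D M
      · rw [Set.indicator_of_mem ht, norm_mul, RCLike.norm_conj]
        gcongr
        exact Set.mem_iInter.1 ht.2 i
      · rw [Set.indicator_of_notMem ht]
        simp only [map_zero, mul_zero, norm_zero]
        positivity
    · by_cases ht : t ∈ D M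
      · have := (show Tendsto (fun i => φ i t) atTop (𝓝 0) from ht.1).mul_const
          (conj ((D M).indicator h t))
        rwa [zero_mul] at this
      · rw [Set.indicator_of_notMem ht]; simp
  have h0 := tendsto_nhds_unique hlim0 ((hf (J g)).comp hns.tendsto_atTop)
  rw [J.inner_map_map, L2.inner_def] at h0
  have h1 : ∫ t in D M, ‖h t‖ ^ 2 ∂(spectralMeasure U v) = 0 := by
    rw [← integral_indicator (hD M)]
    have : (((∫ t, (D M).indicator (fun t => ‖h t‖ ^ 2) t ∂(spectralMeasure U v)) : ℝ) : ℂ) = 0 := by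
      rw [← integral_complex_ofReal, h0]
      refine integral_congr_ae ?_
      filter_upwards [hg] with t ht
      rw [ht]
      by_cases htD : t ∈ D M
      · simp only [Set.indicator_of_mem htD]
        rw [inner_self_eq_norm_sq_to_K]; simp
      · simp [Set.indicator_of_notMem htD]
    exact_mod_cast this
  rw [hJ.spectralMeasure_map, withDensity_apply _ (hD M)]
  have hsq : Integrable (fun t => ‖h t‖ ^ 2) (spectralMeasure U v) :=
    (memLp_two_iff_integrable_sq_norm (Lp.aestronglyMeasurable h)).1 (Lp.memLp h)
  have h2 := ofReal_integral_eq_lintegral_ofReal hsq.integrableOn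
    (ae_of_all ((spectralMeasure U v).restrict (D M)) fun t => sq_nonneg ‖h t‖)
  rw [h1, ENNReal.ofReal_zero] at h2
  rw [h2]
  refine lintegral_congr fun t => ?_
  rw [← ofReal_norm, ENNReal.ofReal_pow (norm_nonneg _)]

end CyclicModelApplications

/-! ### Generators of increasing unions of cyclic spaces -/

section CyclicVectors

variable {E : Type*} [NormedAddCommGroup E] [InnerProductSpace ℂ E]

theorem mem_span_zpow_iff {U : E ≃ₗᵢ[ℂ] E} {v y : E} :
    y ∈ Submodule.span ℂ (Set.range fun n : ℤ => (U ^ n) v) ↔ ∃ p, trigApply U p v = y :=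
  Finsupp.mem_span_range_iff_exists_finsupp

theorem exists_trigApply_near {U : E ≃ₗᵢ[ℂ] E} {v x : E} (hx : x ∈ cyclicSpace U v) {ε : ℝ}
    (hε : 0 < ε) : ∃ p, ‖trigApply U p v - x‖ < ε := by
  obtain ⟨y, hy, hxy⟩ := Metric.mem_closure_iff.1 hx ε hε
  obtain ⟨p, rfl⟩ := mem_span_zpow_iff.1 hy
  exact ⟨p, by rwa [dist_comm, dist_eq_norm] at hxy⟩

theorem continuous_trigApply (U : E ≃ₗᵢ[ℂ] E) (p : ℤ →₀ ℂ) : Continuous (trigApply U p) := by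
  unfold trigApply
  simp only [Finsupp.linearCombination_apply, Finsupp.sum]
  exact continuous_finsetSum _ fun n _ => ((U ^ n).continuous).const_smul _

variable [CompleteSpace E]

/-- In the model, adding a small constant on the zero set of a function makes it nonzero almost
everywhere, that is, a generator. -/
theorem exists_generator_near {U : E ≃ₗᵢ[ℂ] E} {x u : E} (hu : u ∈ cyclicSpace U x) {ε : ℝ}
    (hε : 0 < ε) : ∃ u' ∈ cyclicSpace U x, ‖u' - u‖ < ε ∧ x ∈ cyclicSpace U u' := by
  obtain ⟨J, hJ⟩ := exists_isCyclicModel U x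
  obtain ⟨g, rfl⟩ := (hJ.range u).1 hu
  let Z : Set UnitAddCircle := g ⁻¹' {0}
  have hZ : MeasurableSet Z := (Lp.stronglyMeasurable g).measurable (MeasurableSet.singleton 0)
  have hZf : spectralMeasure U x Z ≠ ∞ := by finiteness
  let s : ℝ := (spectralMeasure U x).real Z ^ (1 / (2 : ℝ≥0∞).toReal)
  have hs : 0 ≤ s := Real.rpow_nonneg measureReal_nonneg _
  let δ : ℝ := ε / (2 * (1 + s))
  have hδ : 0 < δ := by positivity
  let k : Lp ℂ 2 (spectralMeasure U x) := indicatorConstLp 2 hZ hZf (δ : ℂ)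
  have hk : ‖k‖ < ε := by
    rw [norm_indicatorConstLp (by simp) (by simp), Complex.norm_real, Real.norm_of_nonneg hδ.le]
    change ε / (2 * (1 + s)) * s < ε
    rw [div_mul_eq_mul_div, div_lt_iff₀ (by positivity)]
    nlinarith
  have hmem : J (g + k) ∈ cyclicSpace U x := (hJ.range _).2 ⟨_, rfl⟩
  refine ⟨J (g + k), hmem, ?_, mem_cyclicSpace_of_absolutelyContinuous hmem ?_⟩
  · rwa [← map_sub, add_sub_cancel_left, J.norm_map]
  · rw [hJ.spectralMeasure_map]
    refine withDensity_absolutelyContinuous' ((Lp.aestronglyMeasurable _).enorm.pow_const 2) ?_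
    filter_upwards [Lp.coeFn_add g k, indicatorConstLp_coeFn (p := 2) (hs := hZ) (hμs := hZf)
      (c := (δ : ℂ))] with t h1 h2
    have h3 : (k : UnitAddCircle → ℂ) t = Z.indicator (fun _ => (δ : ℂ)) t := h2
    rw [h1, Pi.add_apply, h3]
    by_cases ht : t ∈ Z
    · rw [Set.indicator_of_mem ht, show (g : UnitAddCircle → ℂ) t = 0 from ht]
      simp [hδ.ne']
    · rw [Set.indicator_of_notMem ht, add_zero]
      have : (g : UnitAddCircle → ℂ) t ≠ 0 := ht
      simp [this]

/-- Baire category: generators of arbitrarily late cyclic spaces are dense in `M`, and a vector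
whose cyclic space contains every `x j` generates `M`. -/
theorem exists_cyclicSpace_eq {U : E ≃ₗᵢ[ℂ] E} {M : Submodule ℂ E} (hM : IsClosed (M : Set E))
    (x : ℕ → E) (hx : ∀ j, x j ∈ cyclicSpace U (x (j + 1))) (hle : ∀ j, cyclicSpace U (x j) ≤ M)
    (hd : ∀ v ∈ M, ∀ ε > 0, ∃ j, ∃ u ∈ cyclicSpace U (x j), ‖u - v‖ < ε) :
    ∃ v ∈ M, cyclicSpace U v = M := by
  have hmono : Monotone fun j => cyclicSpace U (x j) :=
    monotone_nat_of_le_succ fun j => cyclicSpace_mono (hx j)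
  have : CompleteSpace M := hM.completeSpace_coe
  -- A vector in all these open sets has every `x j` in its cyclic space, up to arbitrarily small
  -- errors and hence exactly.
  let G : ℕ × ℕ → Set M := fun i => {v | ∃ p, ‖trigApply U p (v : E) - x i.1‖ < 1 / (i.2 + 1)}
  have hopen : ∀ i, IsOpen (G i) := by
    intro i
    have : G i = ⋃ p, {v : M | ‖trigApply U p (v : E) - x i.1‖ < 1 / (i.2 + 1)} := by
      ext v; simp [G]
    rw [this]
    refine isOpen_iUnion fun p => isOpen_lt ?_ continuous_const
    exact (((continuous_trigApply U p).comp continuous_subtype_val).sub continuous_const).norm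
  have hdense : ∀ i, Dense (G i) := by
    intro i
    rw [Metric.dense_iff]
    intro v ε hε
    obtain ⟨j, u, hu, huv⟩ := hd v v.2 (ε / 2) (by positivity)
    let m := max i.1 j
    obtain ⟨u', hu', huu', hgen⟩ := exists_generator_near (hmono (le_max_right i.1 j) hu)
      (show 0 < ε / 2 by positivity)
    refine ⟨⟨u', hle m hu'⟩, ?_, ?_⟩
    · rw [Metric.mem_ball, Subtype.dist_eq, dist_eq_norm]
      have : u' - v = (u' - u) + (u - v) := by abel
      change ‖u' - v‖ < ε
      rw [this]
      exact (norm_add_le _ _).trans_lt (by linarith)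
    · have h1 : x i.1 ∈ cyclicSpace U u' := cyclicSpace_mono hgen
        (hmono (le_max_left i.1 j) (mem_cyclicSpace_self U _))
      exact exists_trigApply_near h1 (by positivity)
  obtain ⟨v, hv⟩ := (dense_iInter_of_isOpen hopen hdense).nonempty
  refine ⟨v, v.2, le_antisymm (cyclicSpace_le hM fun n => ?_) ?_⟩
  · rw [← SetLike.mem_coe, ← hM.closure_eq, Metric.mem_closure_iff]
    intro ε hε
    obtain ⟨j, u, hu, huv⟩ := hd v v.2 ε hε
    refine ⟨(U ^ n) u, hle j (zpow_map_mem_cyclicSpace hu n), ?_⟩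
    rw [dist_comm, dist_eq_norm, ← map_sub, LinearIsometryEquiv.norm_map]
    exact huv
  · have hxj : ∀ j, x j ∈ cyclicSpace U (v : E) := by
      intro j
      rw [← SetLike.mem_coe, ← (isClosed_cyclicSpace U (v : E)).closure_eq, Metric.mem_closure_iff]
      intro ε hε
      obtain ⟨m, hm⟩ := exists_nat_one_div_lt hε
      obtain ⟨p, hp⟩ := Set.mem_iInter.1 hv (j, m)
      refine ⟨_, trigApply_mem_cyclicSpace U p v, ?_⟩
      rw [dist_comm, dist_eq_norm]
      exact hp.trans hm
    intro y hy
    rw [← SetLike.mem_coe, ← (isClosed_cyclicSpace U (v : E)).closure_eq, Metric.mem_closure_iff]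
    intro ε hε
    obtain ⟨j, u, hu, huv⟩ := hd y hy ε hε
    exact ⟨u, cyclicSpace_mono (hxj j) hu, by rwa [dist_comm, dist_eq_norm]⟩

end CyclicVectors

/-! ### Hilbert tensor squares and the cyclic space of `f ⊗ f` -/

/-- A Hilbert tensor square `F` of `E`, with the operators `a = U ⊗ 1`, `b = 1 ⊗ U`, `V = U ⊗ U`
and the flip `s`. -/
structure TensorSquare {E : Type*} [NormedAddCommGroup E] [InnerProductSpace ℂ E]
    (U : E ≃ₗᵢ[ℂ] E) (F : Type*) [NormedAddCommGroup F] [InnerProductSpace ℂ F] where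
  t : E →ₗ[ℂ] E →ₗ[ℂ] F
  a : F ≃ₗᵢ[ℂ] F
  b : F ≃ₗᵢ[ℂ] F
  V : F ≃ₗᵢ[ℂ] F
  s : F ≃ₗᵢ[ℂ] F
  inner_t : ∀ x y x' y', inner ℂ (t x y) (t x' y') = inner ℂ x x' * inner ℂ y y'
  dense : (Submodule.span ℂ (Set.range fun p : E × E => t p.1 p.2)).topologicalClosure = ⊤
  a_t : ∀ x y, a (t x y) = t (U x) y
  b_t : ∀ x y, b (t x y) = t x (U y)
  V_t : ∀ x y, V (t x y) = t (U x) (U y)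
  s_t : ∀ x y, s (t x y) = t y x

namespace TensorSquare

variable {E : Type*} [NormedAddCommGroup E] [InnerProductSpace ℂ E] {U : E ≃ₗᵢ[ℂ] E}
  {F : Type*} [NormedAddCommGroup F] [InnerProductSpace ℂ F] (S : TensorSquare U F)

theorem norm_t (x y : E) : ‖S.t x y‖ = ‖x‖ * ‖y‖ := by
  have h := S.inner_t x y x y
  rw [inner_self_eq_norm_sq_to_K, inner_self_eq_norm_sq_to_K, inner_self_eq_norm_sq_to_K] at h
  have h2 : ‖S.t x y‖ ^ 2 = (‖x‖ * ‖y‖) ^ 2 := by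
    rw [mul_pow]; exact_mod_cast h
  exact (sq_eq_sq₀ (norm_nonneg _) (by positivity)).1 h2

/-- The tensor product as a continuous bilinear map. -/
def T : E →L[ℂ] E →L[ℂ] F :=
  S.t.mkContinuous₂ 1 fun x y => by rw [S.norm_t, one_mul]

theorem ext_of_t {G : Type*} [NormedAddCommGroup G] [NormedSpace ℂ G] {A B : F →L[ℂ] G}
    (h : ∀ x y, A (S.t x y) = B (S.t x y)) : A = B := by
  refine ContinuousLinearMap.ext_on (s := Set.range fun p : E × E => S.t p.1 p.2) ?_ ?_
  · exact Submodule.dense_iff_topologicalClosure_eq_top.2 S.dense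
  · rintro _ ⟨p, rfl⟩; exact h p.1 p.2

theorem eq_zero_of_inner_t {z : F} (h : ∀ x y, inner ℂ (S.t x y) z = 0) : z = 0 := by
  have : (innerSL ℂ z : F →L[ℂ] ℂ) = 0 := S.ext_of_t fun x y => by
    rw [innerSL_apply_apply, ← inner_conj_symm, h]; simp
  have h2 := congrArg (fun A => A z) this
  simpa using h2

theorem V_eq (z : F) : S.V z = S.a (S.b z) := by
  have := S.ext_of_t (A := (S.V.toContinuousLinearEquiv : F →L[ℂ] F))
    (B := ((S.b.trans S.a).toContinuousLinearEquiv : F →L[ℂ] F)) fun x y => by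
      change S.V (S.t x y) = S.a (S.b (S.t x y))
      rw [S.V_t, S.b_t, S.a_t]
  exact congrArg (fun A => A z) this

theorem ab_comm (z : F) : S.a (S.b z) = S.b (S.a z) := by
  have := S.ext_of_t (A := ((S.b.trans S.a).toContinuousLinearEquiv : F →L[ℂ] F))
    (B := ((S.a.trans S.b).toContinuousLinearEquiv : F →L[ℂ] F)) fun x y => by
      change S.a (S.b (S.t x y)) = S.b (S.a (S.t x y))
      rw [S.b_t, S.a_t, S.a_t, S.b_t]
  exact congrArg (fun A => A z) this

theorem aV_comm (z : F) : S.a (S.V z) = S.V (S.a z) := by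
  rw [V_eq, V_eq, ab_comm, ab_comm]

theorem bV_comm (z : F) : S.b (S.V z) = S.V (S.b z) := by
  rw [V_eq, V_eq]
  exact (S.ab_comm (S.b z)).symm

theorem sV_comm (z : F) : S.s (S.V z) = S.V (S.s z) := by
  have := S.ext_of_t (A := ((S.V.trans S.s).toContinuousLinearEquiv : F →L[ℂ] F))
    (B := ((S.s.trans S.V).toContinuousLinearEquiv : F →L[ℂ] F)) fun x y => by
      change S.s (S.V (S.t x y)) = S.V (S.s (S.t x y))
      rw [S.V_t, S.s_t, S.s_t, S.V_t]
  exact congrArg (fun A => A z) this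

theorem a_zpow_t (n : ℤ) (x y : E) : (S.a ^ n) (S.t x y) = S.t ((U ^ n) x) y :=
  (zpow_intertwine (S := fun x => S.t x y) (fun x => (S.a_t x y).symm) n x).symm

theorem b_zpow_t (n : ℤ) (x y : E) : (S.b ^ n) (S.t x y) = S.t x ((U ^ n) y) :=
  (zpow_intertwine (S := fun y => S.t x y) (fun y => (S.b_t x y).symm) n y).symm

theorem V_zpow_t (n : ℤ) (x y : E) : (S.V ^ n) (S.t x y) = S.t ((U ^ n) x) ((U ^ n) y) := by
  induction n generalizing x y with
  | zero => simp
  | succ n ih => rw [add_comm, unitary_zpow_one_add, ih, S.V_t, ← unitary_zpow_one_add,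
      ← unitary_zpow_one_add]
  | pred n ih =>
    have h1 : ∀ x, (U ^ (-n : ℤ)) x = U ((U ^ (-n - 1 : ℤ)) x) := fun x => by
      rw [← unitary_zpow_one_add]; congr 2; ring
    have h2 : (S.V ^ (-n : ℤ)) (S.t x y) = S.V ((S.V ^ (-n - 1 : ℤ)) (S.t x y)) := by
      rw [← unitary_zpow_one_add]; congr 2; ring
    have := ih x y
    rw [h1, h1, ← S.V_t, h2] at this
    exact S.V.injective this

/-- The operator `(U - 1) ⊗ (U - 1)`. -/
def K (z : F) : F := S.a (S.b z) - S.a z - S.b z + z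

theorem K_t (x y : E) : S.K (S.t x y) = S.t (U x - x) (U y - y) := by
  rw [K, S.b_t, S.a_t, S.a_t]
  simp only [map_sub, LinearMap.sub_apply]
  abel

variable [CompleteSpace F]

theorem spectralMeasure_a (z : F) : spectralMeasure S.V (S.a z) = spectralMeasure S.V z :=
  spectralMeasure_isometry S.a.toLinearIsometry S.aV_comm z

theorem spectralMeasure_b (z : F) : spectralMeasure S.V (S.b z) = spectralMeasure S.V z :=
  spectralMeasure_isometry S.b.toLinearIsometry S.bV_comm z

theorem spectralMeasure_s (z : F) : spectralMeasure S.V (S.s z) = spectralMeasure S.V z :=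
  spectralMeasure_isometry S.s.toLinearIsometry S.sV_comm z

theorem a_mem_dominatedSubspace {z : F} {σ : Measure UnitAddCircle}
    (h : z ∈ dominatedSubspace S.V σ) : S.a z ∈ dominatedSubspace S.V σ := by
  rw [mem_dominatedSubspace] at *
  rwa [spectralMeasure_a]

theorem b_mem_dominatedSubspace {z : F} {σ : Measure UnitAddCircle}
    (h : z ∈ dominatedSubspace S.V σ) : S.b z ∈ dominatedSubspace S.V σ := by
  rw [mem_dominatedSubspace] at *
  rwa [spectralMeasure_b]

/-- `K` is a combination of `ab`, `a`, `b` and `1`, and the isometries `a`, `b` commute with `V`, so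
they preserve spectral measures. -/
theorem spectralMeasure_K (z : F) : spectralMeasure S.V (S.K z) ≪ spectralMeasure S.V z := by
  have h : z ∈ dominatedSubspace S.V (spectralMeasure S.V z) :=
    Measure.AbsolutelyContinuous.refl _
  exact Submodule.add_mem _ (Submodule.sub_mem _ (Submodule.sub_mem _
    (S.a_mem_dominatedSubspace (S.b_mem_dominatedSubspace h)) (S.a_mem_dominatedSubspace h))
    (S.b_mem_dominatedSubspace h)) h

theorem K_mem_cyclicSpace {z : F} (h : z ∈ cyclicSpace S.V (S.K z)) :
    S.K z ∈ cyclicSpace S.V z :=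
  mem_cyclicSpace_of_absolutelyContinuous h (S.spectralMeasure_K z)

theorem spectralMeasure_absolutelyContinuous_K {z : F} (h : z ∈ cyclicSpace S.V (S.K z)) :
    spectralMeasure S.V z ≪ spectralMeasure S.V (S.K z) :=
  spectralMeasure_absolutelyContinuous_of_mem h

/-- On the generator `z` this is the identity `a + b = V + 1 - K`, since `K z` and `z` generate the
same cyclic space. Commutation with `V` and closedness extend it to all `y`. -/
theorem a_add_b_mem {z : F} (h : z ∈ cyclicSpace S.V (S.K z)) {y : F}
    (hy : y ∈ cyclicSpace S.V z) : S.a y + S.b y ∈ cyclicSpace S.V z := by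
  have h1 : S.a z + S.b z ∈ cyclicSpace S.V z := by
    have e : S.a z + S.b z = S.V z + z - S.K z := by rw [K, V_eq]; abel
    rw [e]
    refine Submodule.sub_mem _ (Submodule.add_mem _ ?_ (mem_cyclicSpace_self _ _))
      (S.K_mem_cyclicSpace h)
    simpa using zpow_mem_cyclicSpace S.V z 1
  let L : F →L[ℂ] F := (S.a.toContinuousLinearEquiv : F →L[ℂ] F)
    + (S.b.toContinuousLinearEquiv : F →L[ℂ] F)
  refine cyclicSpace_le (isClosed_comap_isometry (isClosed_cyclicSpace S.V z) L) (fun n => ?_) hy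
  change S.a ((S.V ^ n) z) + S.b ((S.V ^ n) z) ∈ cyclicSpace S.V z
  rw [zpow_intertwine (S := S.a) S.aV_comm, zpow_intertwine (S := S.b) S.bV_comm, ← map_add]
  exact zpow_map_mem_cyclicSpace h1 n

theorem a_pow_add_b_pow_mem {z : F} (h : z ∈ cyclicSpace S.V (S.K z)) (n : ℕ) :
    (S.a ^ n) z + (S.b ^ n) z ∈ cyclicSpace S.V z := by
  have hz := mem_cyclicSpace_self S.V z
  induction n using Nat.twoStepInduction with
  | zero => simpa using Submodule.add_mem _ hz hz
  | one => simpa using S.a_add_b_mem h hz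
  | more n h0 h1 =>
    have h2 := S.a_add_b_mem h h1
    have h3 := zpow_map_mem_cyclicSpace h0 1
    have hp : ∀ (A : F ≃ₗᵢ[ℂ] F) (n : ℕ), (A ^ (n + 1)) z = A ((A ^ n) z) := fun A n => by
      rw [pow_succ']; rfl
    -- The recurrence for power sums: `a^(n+2) + b^(n+2) = (a + b)(a^(n+1) + b^(n+1)) - ab (a^n +
    -- b^n)`, with `ab = V`.
    have e : (S.a ^ (n + 2)) z + (S.b ^ (n + 2)) z
        = (S.a ((S.a ^ (n + 1)) z + (S.b ^ (n + 1)) z) + S.b ((S.a ^ (n + 1)) z + (S.b ^ (n + 1)) z))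
          - (S.V ^ (1 : ℤ)) ((S.a ^ n) z + (S.b ^ n) z) := by
      rw [zpow_one, V_eq, hp, hp]
      simp only [hp, map_add, S.ab_comm]
      abel
    rw [e]
    exact Submodule.sub_mem _ h2 h3

/-- For `n = m + k` the vector is `V^m (a^k + b^k)` applied to `f ⊗ f`, up to the order of the
terms. -/
theorem symm_t_zpow_mem {f : E} (h : S.t f f ∈ cyclicSpace S.V (S.K (S.t f f))) (m n : ℤ) :
    S.t ((U ^ m) f) ((U ^ n) f) + S.t ((U ^ n) f) ((U ^ m) f) ∈ cyclicSpace S.V (S.t f f) := by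
  wlog hmn : m ≤ n generalizing m n
  · rw [add_comm]; exact this n m (by omega)
  obtain ⟨k, rfl⟩ := Int.le.dest hmn
  have h1 := zpow_map_mem_cyclicSpace (S.a_pow_add_b_pow_mem h k) m
  rw [← zpow_natCast, ← zpow_natCast, a_zpow_t, b_zpow_t, map_add, V_zpow_t, V_zpow_t,
    ← zpow_add_apply, add_comm] at h1
  exact h1

/-- By bilinearity and continuity, applied to one factor at a time. Thus the symmetric square of the
cyclic space of `f` lies in the cyclic space of the single vector `f ⊗ f`. -/
theorem symm_t_mem {f : E} (h : S.t f f ∈ cyclicSpace S.V (S.K (S.t f f))) {x y : E}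
    (hx : x ∈ cyclicSpace U f) (hy : y ∈ cyclicSpace U f) :
    S.t x y + S.t y x ∈ cyclicSpace S.V (S.t f f) := by
  have key : ∀ n : ℤ, S.t x ((U ^ n) f) + S.t ((U ^ n) f) x ∈ cyclicSpace S.V (S.t f f) := by
    intro n
    exact cyclicSpace_le (isClosed_comap_isometry (isClosed_cyclicSpace S.V (S.t f f))
      (S.T.flip ((U ^ n) f) + S.T ((U ^ n) f))) (fun m => S.symm_t_zpow_mem h m n) hx
  exact cyclicSpace_le (isClosed_comap_isometry (isClosed_cyclicSpace S.V (S.t f f))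
      (S.T x + S.T.flip x)) (fun m => key m) hy

end TensorSquare

/-! ### Symmetric and exterior squares -/

namespace TensorSquare

variable {E : Type*} [NormedAddCommGroup E] [InnerProductSpace ℂ E] {U : E ≃ₗᵢ[ℂ] E}
  {F : Type*} [NormedAddCommGroup F] [InnerProductSpace ℂ F] (S : TensorSquare U F)

/-- The closed span of the tensors `x ⊗ y`, `x, y ∈ H`. -/
def tensors (H : Submodule ℂ E) : Submodule ℂ F :=
  (Submodule.span ℂ {z | ∃ x ∈ H, ∃ y ∈ H, z = S.t x y}).topologicalClosure

/-- The symmetric square of `H`. -/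
def symm (H : Submodule ℂ E) : Submodule ℂ F :=
  (Submodule.span ℂ {z | ∃ x ∈ H, ∃ y ∈ H, z = S.t x y + S.t y x}).topologicalClosure

/-- The exterior square of `H`. -/
def alt (H : Submodule ℂ E) : Submodule ℂ F :=
  (Submodule.span ℂ {z | ∃ x ∈ H, ∃ y ∈ H, z = S.t x y - S.t y x}).topologicalClosure

variable {S} {H : Submodule ℂ E}

theorem t_mem_tensors {x y : E} (hx : x ∈ H) (hy : y ∈ H) : S.t x y ∈ S.tensors H :=
  Submodule.le_topologicalClosure _ (Submodule.subset_span ⟨x, hx, y, hy, rfl⟩)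

theorem t_mem_symm {x y : E} (hx : x ∈ H) (hy : y ∈ H) : S.t x y + S.t y x ∈ S.symm H :=
  Submodule.le_topologicalClosure _ (Submodule.subset_span ⟨x, hx, y, hy, rfl⟩)

theorem t_mem_alt {x y : E} (hx : x ∈ H) (hy : y ∈ H) : S.t x y - S.t y x ∈ S.alt H :=
  Submodule.le_topologicalClosure _ (Submodule.subset_span ⟨x, hx, y, hy, rfl⟩)

theorem t_self_mem_symm {x : E} (hx : x ∈ H) : S.t x x ∈ S.symm H := by
  have h := Submodule.smul_mem _ (2⁻¹ : ℂ) (t_mem_symm (S := S) hx hx)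
  rw [← two_smul ℂ (S.t x x), smul_smul] at h
  norm_num at h
  exact h

theorem isClosed_symm : IsClosed (S.symm H : Set F) := Submodule.isClosed_topologicalClosure _

theorem isClosed_alt : IsClosed (S.alt H : Set F) := Submodule.isClosed_topologicalClosure _

theorem symm_le {M : Submodule ℂ F} (hM : IsClosed (M : Set F))
    (h : ∀ x ∈ H, ∀ y ∈ H, S.t x y + S.t y x ∈ M) : S.symm H ≤ M := by
  refine Submodule.topologicalClosure_minimal _ (Submodule.span_le.2 ?_) hM
  rintro _ ⟨x, hx, y, hy, rfl⟩
  exact h x hx y hy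

theorem alt_le {M : Submodule ℂ F} (hM : IsClosed (M : Set F))
    (h : ∀ x ∈ H, ∀ y ∈ H, S.t x y - S.t y x ∈ M) : S.alt H ≤ M := by
  refine Submodule.topologicalClosure_minimal _ (Submodule.span_le.2 ?_) hM
  rintro _ ⟨x, hx, y, hy, rfl⟩
  exact h x hx y hy

theorem symm_le_tensors : S.symm H ≤ S.tensors H :=
  symm_le (Submodule.isClosed_topologicalClosure _) fun _ hx _ hy =>
    Submodule.add_mem _ (t_mem_tensors hx hy) (t_mem_tensors hy hx)

theorem alt_le_tensors : S.alt H ≤ S.tensors H :=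
  alt_le (Submodule.isClosed_topologicalClosure _) fun _ hx _ hy =>
    Submodule.sub_mem _ (t_mem_tensors hx hy) (t_mem_tensors hy hx)

theorem s_of_mem_symm {z : F} (hz : z ∈ S.symm H) : S.s z = z := by
  let M : Submodule ℂ F := LinearMap.eqLocus (S.s.toLinearEquiv : F →ₗ[ℂ] F) LinearMap.id
  have hM : IsClosed (M : Set F) := isClosed_eq S.s.continuous continuous_id
  exact symm_le (M := M) hM (fun x _ y _ => by
    change S.s (S.t x y + S.t y x) = S.t x y + S.t y x
    rw [map_add, S.s_t, S.s_t, add_comm]) hz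

theorem s_of_mem_alt {z : F} (hz : z ∈ S.alt H) : S.s z = -z := by
  let M : Submodule ℂ F := LinearMap.eqLocus (S.s.toLinearEquiv : F →ₗ[ℂ] F) (-LinearMap.id)
  have hM : IsClosed (M : Set F) := isClosed_eq S.s.continuous continuous_neg
  exact alt_le (M := M) hM (fun x _ y _ => by
    change S.s (S.t x y - S.t y x) = -(S.t x y - S.t y x)
    rw [map_sub, S.s_t, S.s_t]; abel) hz

/-- The flip is unitary and acts as `1` on one space and as `-1` on the other. -/
theorem inner_symm_alt {z w : F} (hz : z ∈ S.symm H) (hw : w ∈ S.alt H) : inner ℂ z w = 0 := by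
  have h := S.s.inner_map_map z w
  rw [s_of_mem_symm hz, s_of_mem_alt hw, inner_neg_right] at h
  have h2 : (2 : ℂ) * inner ℂ z w = 0 := by linear_combination -h
  simpa using h2

theorem zpow_mem_symm (hH : ∀ x ∈ H, ∀ n : ℤ, (U ^ n) x ∈ H) {z : F} (hz : z ∈ S.symm H) (n : ℤ) :
    (S.V ^ n) z ∈ S.symm H := by
  refine symm_le (isClosed_comap_isometry isClosed_symm
    ((S.V ^ n).toContinuousLinearEquiv : F →L[ℂ] F)) (fun x hx y hy => ?_) hz
  change (S.V ^ n) (S.t x y + S.t y x) ∈ S.symm H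
  rw [map_add, V_zpow_t, V_zpow_t]
  exact t_mem_symm (hH x hx n) (hH y hy n)

theorem zpow_mem_alt (hH : ∀ x ∈ H, ∀ n : ℤ, (U ^ n) x ∈ H) {z : F} (hz : z ∈ S.alt H) (n : ℤ) :
    (S.V ^ n) z ∈ S.alt H := by
  refine alt_le (isClosed_comap_isometry isClosed_alt
    ((S.V ^ n).toContinuousLinearEquiv : F →L[ℂ] F)) (fun x hx y hy => ?_) hz
  change (S.V ^ n) (S.t x y - S.t y x) ∈ S.alt H
  rw [map_sub, V_zpow_t, V_zpow_t]
  exact t_mem_alt (hH x hx n) (hH y hy n)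

/-- `a^k - b^k` exchanges the symmetric and the exterior square. -/
theorem sub_mem_alt (hH : ∀ x ∈ H, ∀ n : ℤ, (U ^ n) x ∈ H) {z : F} (hz : z ∈ S.symm H) (k : ℤ) :
    (S.a ^ k) z - (S.b ^ k) z ∈ S.alt H := by
  refine symm_le (isClosed_comap_isometry isClosed_alt
    (((S.a ^ k).toContinuousLinearEquiv : F →L[ℂ] F) - ((S.b ^ k).toContinuousLinearEquiv : F →L[ℂ] F)))
    (fun x hx y hy => ?_) hz
  change (S.a ^ k) (S.t x y + S.t y x) - (S.b ^ k) (S.t x y + S.t y x) ∈ S.alt H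
  rw [map_add, map_add, a_zpow_t, a_zpow_t, b_zpow_t, b_zpow_t]
  have e : S.t ((U ^ k) x) y + S.t ((U ^ k) y) x - (S.t x ((U ^ k) y) + S.t y ((U ^ k) x))
    = (S.t ((U ^ k) x) y - S.t y ((U ^ k) x)) + (S.t ((U ^ k) y) x - S.t x ((U ^ k) y)) := by abel
  rw [e]
  exact Submodule.add_mem _ (t_mem_alt (hH x hx k) hy) (t_mem_alt (hH y hy k) hx)

theorem sub_mem_symm (hH : ∀ x ∈ H, ∀ n : ℤ, (U ^ n) x ∈ H) {z : F} (hz : z ∈ S.alt H) (k : ℤ) :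
    (S.a ^ k) z - (S.b ^ k) z ∈ S.symm H := by
  refine alt_le (isClosed_comap_isometry isClosed_symm
    (((S.a ^ k).toContinuousLinearEquiv : F →L[ℂ] F) - ((S.b ^ k).toContinuousLinearEquiv : F →L[ℂ] F)))
    (fun x hx y hy => ?_) hz
  change (S.a ^ k) (S.t x y - S.t y x) - (S.b ^ k) (S.t x y - S.t y x) ∈ S.symm H
  rw [map_sub, map_sub, a_zpow_t, a_zpow_t, b_zpow_t, b_zpow_t]
  have e : S.t ((U ^ k) x) y - S.t ((U ^ k) y) x - (S.t x ((U ^ k) y) - S.t y ((U ^ k) x))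
    = (S.t ((U ^ k) x) y + S.t y ((U ^ k) x)) - (S.t ((U ^ k) y) x + S.t x ((U ^ k) y)) := by abel
  rw [e]
  exact Submodule.sub_mem _ (t_mem_symm (hH x hx k) hy) (t_mem_symm (hH y hy k) hx)

/-- A unitary operator with powers tending weakly to zero on tensors has no invariant vectors. -/
theorem eq_zero_of_map_eq {A : F ≃ₗᵢ[ℂ] F} {n : ℕ → ℤ}
    (h : ∀ x ∈ H, ∀ y ∈ H, ∀ x' ∈ H, ∀ y' ∈ H,
      Tendsto (fun k => inner ℂ ((A ^ n k) (S.t x y)) (S.t x' y')) atTop (𝓝 0))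
    {z : F} (hz : z ∈ S.tensors H) (hA : A z = z) : z = 0 := by
  have hAn := zpow_apply_of_map_eq hA
  have h1 : ∀ w ∈ Submodule.span ℂ {z | ∃ x ∈ H, ∃ y ∈ H, z = S.t x y},
      ∀ w' ∈ Submodule.span ℂ {z | ∃ x ∈ H, ∃ y ∈ H, z = S.t x y},
      Tendsto (fun k => inner ℂ ((A ^ n k) w) w') atTop (𝓝 0) := by
    intro w hw w' hw'
    induction hw using Submodule.span_induction with
    | zero => simp
    | add u v _ _ hu hv =>
      simp only [map_add, inner_add_left]
      simpa using hu.add hv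
    | smul c u _ hu =>
      simp only [map_smul, inner_smul_left]
      simpa using hu.const_mul ((starRingEnd ℂ) c)
    | mem u hu =>
      obtain ⟨x, hx, y, hy, rfl⟩ := hu
      induction hw' using Submodule.span_induction with
      | zero => simp
      | add u v _ _ hu hv =>
        simp only [inner_add_right]
        simpa using hu.add hv
      | smul c u _ hu =>
        simp only [inner_smul_right]
        simpa using hu.const_mul c
      | mem u hu =>
        obtain ⟨x', hx', y', hy', rfl⟩ := hu
        exact h x hx y hy x' hx' y' hy'
  by_contra hne
  have hz0 : 0 < ‖z‖ := norm_pos_iff.2 hne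
  obtain ⟨w, hw, hzw⟩ := Metric.mem_closure_iff.1 hz (‖z‖ / 4) (by positivity)
  rw [dist_eq_norm] at hzw
  have hlim := (h1 w hw w hw).norm
  rw [norm_zero] at hlim
  obtain ⟨k, hk⟩ := (hlim.eventually (gt_mem_nhds (show (0 : ℝ) < ‖z‖ ^ 2 / 4 by positivity))).exists
  -- With `‖z - w‖ < ‖z‖ / 4` and `k` large, the three terms are at most `1/4`, `5/16` and `1/4` of
  -- `‖z‖²`, which is impossible for `z ≠ 0`.
  have e : inner ℂ z z = inner ℂ ((A ^ n k) (z - w)) z + inner ℂ ((A ^ n k) w) (z - w)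
      + inner ℂ ((A ^ n k) w) w := by
    rw [map_sub, hAn]
    simp only [inner_sub_left, inner_sub_right]; ring
  have hw' : ‖w‖ ≤ ‖z‖ + ‖z‖ / 4 := by
    have := norm_le_norm_add_norm_sub' w z
    rw [norm_sub_rev] at this
    linarith
  have h2 : ‖z‖ ^ 2 = ‖inner ℂ z z‖ := by rw [inner_self_eq_norm_sq_to_K]; simp
  have h3 : ‖inner ℂ ((A ^ n k) (z - w)) z‖ ≤ ‖z‖ / 4 * ‖z‖ :=
    (norm_inner_le_norm _ _).trans (by
      rw [LinearIsometryEquiv.norm_map]; gcongr)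
  have h4 : ‖inner ℂ ((A ^ n k) w) (z - w)‖ ≤ (‖z‖ + ‖z‖ / 4) * (‖z‖ / 4) :=
    (norm_inner_le_norm _ _).trans (by
      rw [LinearIsometryEquiv.norm_map]; gcongr)
  have h5 : ‖inner ℂ z z‖ ≤ ‖inner ℂ ((A ^ n k) (z - w)) z‖ + ‖inner ℂ ((A ^ n k) w) (z - w)‖
      + ‖inner ℂ ((A ^ n k) w) w‖ := by rw [e]; exact norm_add₃_le
  nlinarith

end TensorSquare

/-! ### Generators of the complement of the constants and of its symmetric square -/

namespace TensorSquare

variable {E : Type*} [NormedAddCommGroup E] [InnerProductSpace ℂ E] [CompleteSpace E]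
  {U : E ≃ₗᵢ[ℂ] E}
  {F : Type*} [NormedAddCommGroup F] [InnerProductSpace ℂ F] [CompleteSpace F]

/-- The properties of a unitary operator `U` with invariant vector `one` from which the spectral
properties of its tensor square are derived. -/
structure IsHomogeneous (S : TensorSquare U F) (one : E) (f : ℕ → E) (n : ℕ → ℤ) : Prop where
  one_ne : one ≠ 0
  map_one : U one = one
  mem : ∀ j, f j ∈ (ℂ ∙ one)ᗮ
  succ : ∀ j, f j ∈ cyclicSpace U (f (j + 1))
  dense : ∀ v ∈ (ℂ ∙ one)ᗮ, ∀ ε > 0, ∃ j, ∃ u ∈ cyclicSpace U (f j), ‖u - v‖ < ε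
  weak : ∀ x ∈ (ℂ ∙ one)ᗮ, ∀ y, Tendsto (fun k => inner ℂ ((U ^ n k) x) y) atTop (𝓝 0)
  kernel : ∀ j, S.t (f j) (f j) ∈ cyclicSpace S.V (S.K (S.t (f j) (f j)))
  singular : ∀ j, spectralMeasure U (f j) ⟂ₘ spectralMeasure S.V (S.K (S.t (f j) (f j)))
  ne_zero : ∃ j, f j ≠ 0

namespace IsHomogeneous

variable {S : TensorSquare U F} {one : E} {f : ℕ → E} {n : ℕ → ℤ}

theorem zpow_one (h : S.IsHomogeneous one f n) (m : ℤ) : (U ^ m) one = one :=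
  zpow_apply_of_map_eq h.map_one m

theorem zpow_mem (h : S.IsHomogeneous one f n) {x : E} (hx : x ∈ (ℂ ∙ one)ᗮ) (m : ℤ) :
    (U ^ m) x ∈ (ℂ ∙ one)ᗮ := by
  rw [Submodule.mem_orthogonal_singleton_iff_inner_right] at *
  rw [inner_zpow_right, h.zpow_one, hx]

theorem cyclicSpace_le_orthogonal (h : S.IsHomogeneous one f n) {x : E} (hx : x ∈ (ℂ ∙ one)ᗮ) :
    cyclicSpace U x ≤ (ℂ ∙ one)ᗮ :=
  cyclicSpace_le (Submodule.isClosed_orthogonal _) (h.zpow_mem hx)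

theorem exists_generator (h : S.IsHomogeneous one f n) :
    ∃ v ∈ (ℂ ∙ one)ᗮ, cyclicSpace U v = (ℂ ∙ one)ᗮ :=
  exists_cyclicSpace_eq (Submodule.isClosed_orthogonal _) f h.succ
    (fun j => h.cyclicSpace_le_orthogonal (h.mem j)) h.dense

theorem symm_cyclicSpace_le (h : S.IsHomogeneous one f n) (j : ℕ) :
    S.symm (cyclicSpace U (f j)) ≤ cyclicSpace S.V (S.t (f j) (f j)) :=
  symm_le (isClosed_cyclicSpace _ _) fun _ hx _ hy => S.symm_t_mem (h.kernel j) hx hy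

theorem monotone_cyclicSpace (h : S.IsHomogeneous one f n) :
    Monotone fun j => cyclicSpace U (f j) :=
  monotone_nat_of_le_succ fun j => cyclicSpace_mono (h.succ j)

/-- Since `f j` lies in the cyclic space of `f (j + 1)`, its tensor square lies in the symmetric
square of that space. This is how the cyclic spaces of the tensor squares become increasing. -/
theorem tensor_succ (h : S.IsHomogeneous one f n) (j : ℕ) :
    S.t (f j) (f j) ∈ cyclicSpace S.V (S.t (f (j + 1)) (f (j + 1))) :=
  h.symm_cyclicSpace_le (j + 1) (t_self_mem_symm (h.succ j))

theorem monotone_cyclicSpace_tensor (h : S.IsHomogeneous one f n) :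
    Monotone fun j => cyclicSpace S.V (S.t (f j) (f j)) :=
  monotone_nat_of_le_succ fun j => cyclicSpace_mono (h.tensor_succ j)

theorem tensor_cyclicSpace_le (h : S.IsHomogeneous one f n) (j : ℕ) :
    cyclicSpace S.V (S.t (f j) (f j)) ≤ S.symm (ℂ ∙ one)ᗮ :=
  cyclicSpace_le isClosed_symm fun m =>
    zpow_mem_symm (fun _ hx m => h.zpow_mem hx m) (t_self_mem_symm (h.mem j)) m

theorem symm_dense (h : S.IsHomogeneous one f n) : ∀ v ∈ S.symm (ℂ ∙ one)ᗮ, ∀ ε > 0,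
    ∃ j, ∃ u ∈ cyclicSpace S.V (S.t (f j) (f j)), ‖u - v‖ < ε := by
  let M : Submodule ℂ F := (⨆ j, cyclicSpace S.V (S.t (f j) (f j))).topologicalClosure
  have hcyc : ∀ j, cyclicSpace S.V (S.t (f j) (f j)) ≤ M := fun j =>
    (le_iSup (fun j => cyclicSpace S.V (S.t (f j) (f j))) j).trans
      (Submodule.le_topologicalClosure _)
  have hM : IsClosed (M : Set F) := Submodule.isClosed_topologicalClosure _
  -- The two factors are approximated one after the other: here `x` is already in some cyclic space
  -- and only `y` is approximated.
  have h1 : ∀ j, ∀ x ∈ cyclicSpace U (f j), ∀ y ∈ (ℂ ∙ one)ᗮ, S.t x y + S.t y x ∈ M := by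
    intro j x hx y hy
    rw [← SetLike.mem_coe, ← hM.closure_eq, Metric.mem_closure_iff]
    intro ε hε
    obtain ⟨i, u, hu, huy⟩ := h.dense y hy (ε / (2 * (‖x‖ + 1))) (by positivity)
    refine ⟨S.t x u + S.t u x, hcyc (max i j) (S.symm_t_mem (h.kernel _)
      (h.monotone_cyclicSpace (le_max_right i j) hx)
      (h.monotone_cyclicSpace (le_max_left i j) hu)), ?_⟩
    rw [dist_comm, dist_eq_norm]
    have e : S.t x u + S.t u x - (S.t x y + S.t y x) = S.t x (u - y) + S.t (u - y) x := by
      simp only [map_sub, LinearMap.sub_apply]; abel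
    rw [e]
    refine (norm_add_le _ _).trans_lt ?_
    rw [S.norm_t, S.norm_t]
    have h3 : ‖u - y‖ * (2 * (‖x‖ + 1)) < ε := (lt_div_iff₀ (by positivity)).1 huy
    nlinarith [norm_nonneg x, norm_nonneg (u - y)]
  have h2 : S.symm (ℂ ∙ one)ᗮ ≤ M := by
    refine symm_le hM fun x hx y hy => ?_
    rw [← SetLike.mem_coe, ← hM.closure_eq, Metric.mem_closure_iff]
    intro ε hε
    obtain ⟨i, u, hu, hux⟩ := h.dense x hx (ε / (2 * (‖y‖ + 1))) (by positivity)
    refine ⟨S.t u y + S.t y u, h1 i u hu y hy, ?_⟩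
    rw [dist_comm, dist_eq_norm]
    have e : S.t u y + S.t y u - (S.t x y + S.t y x) = S.t (u - x) y + S.t y (u - x) := by
      simp only [map_sub, LinearMap.sub_apply]; abel
    rw [e]
    refine (norm_add_le _ _).trans_lt ?_
    rw [S.norm_t, S.norm_t]
    have h3 : ‖u - x‖ * (2 * (‖y‖ + 1)) < ε := (lt_div_iff₀ (by positivity)).1 hux
    nlinarith [norm_nonneg y, norm_nonneg (u - x)]
  intro v hv ε hε
  obtain ⟨u, hu, huv⟩ := Metric.mem_closure_iff.1 (h2 hv) ε hε
  obtain ⟨j, hj⟩ := (Submodule.mem_iSup_of_directed _ h.monotone_cyclicSpace_tensor.directed_le).1 hu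
  exact ⟨j, u, hj, by rwa [dist_comm, dist_eq_norm] at huv⟩

theorem exists_symm_generator (h : S.IsHomogeneous one f n) :
    ∃ z ∈ S.symm (ℂ ∙ one)ᗮ, cyclicSpace S.V z = S.symm (ℂ ∙ one)ᗮ :=
  exists_cyclicSpace_eq isClosed_symm (fun j => S.t (f j) (f j)) h.tensor_succ
    h.tensor_cyclicSpace_le h.symm_dense

theorem tendsto_bounded_mul {c d : ℕ → ℂ} {C : ℝ} (hc : ∀ k, ‖c k‖ ≤ C)
    (hd : Tendsto d atTop (𝓝 0)) : Tendsto (fun k => d k * c k) atTop (𝓝 0) := by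
  refine hd.zero_mul_isBoundedUnder_le ⟨C, ?_⟩
  simp only [eventually_map, Function.comp]
  exact Eventually.of_forall hc

/-- `U ⊗ U⁻¹` has no invariant vectors. -/
theorem eq_zero_of_a_eq_b (h : S.IsHomogeneous one f n) {z : F} (hz : z ∈ S.tensors (ℂ ∙ one)ᗮ)
    (hab : S.a z = S.b z) : z = 0 := by
  let A : F ≃ₗᵢ[ℂ] F := S.a.trans S.b.symm
  refine eq_zero_of_map_eq (A := A) (n := n) ?_ hz ?_
  · intro x hx y hy x' hx' y' hy'
    have hA : ∀ (m : ℤ) (x y : E), (A ^ m) (S.t x y) = S.t ((U ^ m) x) ((U ^ (-m)) y) := by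
      intro m x y
      have hAc : A = S.b⁻¹ * S.a := rfl
      have hcomm : Commute S.b⁻¹ S.a := by
        refine Commute.inv_left ?_
        ext z
        exact (S.ab_comm z).symm
      rw [hAc, hcomm.mul_zpow, inv_zpow']
      change (S.b ^ (-m)) ((S.a ^ m) (S.t x y)) = _
      rw [a_zpow_t, b_zpow_t]
    simp only [hA, S.inner_t]
    -- Weak convergence to zero in the first factor suffices, since the second one stays bounded.
    refine tendsto_bounded_mul (C := ‖y‖ * ‖y'‖) (fun k => ?_) (h.weak x hx x')
    exact (norm_inner_le_norm _ _).trans (by rw [LinearIsometryEquiv.norm_map])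
  · change S.b.symm (S.a z) = z
    rw [hab, LinearIsometryEquiv.symm_apply_apply]

/-- `U ⊗ U` has no invariant vectors. -/
theorem eq_zero_of_V_eq (h : S.IsHomogeneous one f n) {z : F} (hz : z ∈ S.tensors (ℂ ∙ one)ᗮ)
    (hV : S.V z = z) : z = 0 := by
  refine eq_zero_of_map_eq (A := S.V) (n := n) ?_ hz hV
  intro x hx y hy x' hx' y' hy'
  simp only [V_zpow_t, S.inner_t]
  refine tendsto_bounded_mul (C := ‖y‖ * ‖y'‖) (fun k => ?_) (h.weak x hx x')
  exact (norm_inner_le_norm _ _).trans (by rw [LinearIsometryEquiv.norm_map])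

theorem eq_zero_of_U_eq (h : S.IsHomogeneous one f n) {x : E} (hx : x ∈ (ℂ ∙ one)ᗮ)
    (hU : U x = x) : x = 0 := by
  have hn := zpow_apply_of_map_eq hU
  have h1 := h.weak x hx x
  simp only [hn] at h1
  exact inner_self_eq_zero.1 (tendsto_nhds_unique tendsto_const_nhds h1)

end IsHomogeneous

end TensorSquare

/-! ### The exterior square and singularity of the spectral types -/

namespace TensorSquare

namespace IsHomogeneous

variable {E : Type*} [NormedAddCommGroup E] [InnerProductSpace ℂ E]
  {U : E ≃ₗᵢ[ℂ] E}
  {F : Type*} [NormedAddCommGroup F] [InnerProductSpace ℂ F]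
  {S : TensorSquare U F} {one : E} {f : ℕ → E} {n : ℕ → ℤ}

theorem zpow_comm_apply {A B : F ≃ₗᵢ[ℂ] F} (hAB : ∀ x, A (B x) = B (A x)) (k m : ℤ) (z : F) :
    (A ^ k) ((B ^ m) z) = (B ^ m) ((A ^ k) z) :=
  zpow_intertwine (S := fun x => (A ^ k) x)
    (fun x => (zpow_intertwine (S := fun x => B x) (fun x => (hAB x).symm) k x).symm) m z

theorem inner_sub_right_eq (S : TensorSquare U F) (z w : F) :
    inner ℂ (S.a z - S.b z) w
      = inner ℂ z ((S.a ^ (-1 : ℤ)) w - (S.b ^ (-1 : ℤ)) w) := by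
  rw [inner_sub_left, inner_sub_right, inner_zpow_right, inner_zpow_right]
  simp

theorem a_sub_b_zpow_comm (S : TensorSquare U F) (z : F) (m : ℤ) :
    (S.V ^ m) (S.a z - S.b z) = S.a ((S.V ^ m) z) - S.b ((S.V ^ m) z) := by
  rw [map_sub, zpow_intertwine (S := S.a) S.aV_comm, zpow_intertwine (S := S.b) S.bV_comm]

theorem a_eq_b_of_inv (S : TensorSquare U F) {w : F}
    (h : (S.a ^ (-1 : ℤ)) w - (S.b ^ (-1 : ℤ)) w = 0) : S.a w = S.b w := by
  have h1 : S.a.symm w = S.b.symm w := by simpa using sub_eq_zero.1 h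
  have h2 : w = S.b (S.a.symm w) := by rw [h1, LinearIsometryEquiv.apply_symm_apply]
  conv_lhs => rw [h2]
  rw [S.ab_comm, LinearIsometryEquiv.apply_symm_apply]

variable [CompleteSpace E] [CompleteSpace F]

theorem a_sub_b_mem_alt (h : S.IsHomogeneous one f n) {z : F} (hz : z ∈ S.symm (ℂ ∙ one)ᗮ) :
    S.a z - S.b z ∈ S.alt (ℂ ∙ one)ᗮ := by
  simpa using sub_mem_alt (fun _ hx m => h.zpow_mem hx m) hz 1

/-- A generator of the exterior square, with the spectral type of the symmetric square. -/
theorem exists_alt_generator (h : S.IsHomogeneous one f n) {z : F}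
    (hz : z ∈ S.symm (ℂ ∙ one)ᗮ) (hzc : cyclicSpace S.V z = S.symm (ℂ ∙ one)ᗮ) :
    ∃ y ∈ S.alt (ℂ ∙ one)ᗮ, cyclicSpace S.V y = S.alt (ℂ ∙ one)ᗮ ∧
      spectralMeasure S.V y = spectralMeasure S.V z := by
  have hH : ∀ x ∈ (ℂ ∙ one)ᗮ, ∀ m : ℤ, (U ^ m) x ∈ (ℂ ∙ one)ᗮ := fun _ hx m => h.zpow_mem hx m
  let y₀ : F := S.a z - S.b z
  have hy₀ : y₀ ∈ S.alt (ℂ ∙ one)ᗮ := h.a_sub_b_mem_alt hz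
  have hcyc : cyclicSpace S.V y₀ = S.alt (ℂ ∙ one)ᗮ := by
    refine le_antisymm (cyclicSpace_le isClosed_alt (zpow_mem_alt hH hy₀)) fun w hw => ?_
    obtain ⟨p, hp, q, hq, hpq, -⟩ := exists_cyclicSpace_decomposition S.V y₀ w
    have hqalt : q ∈ S.alt (ℂ ∙ one)ᗮ := by
      have e : q = w - p := by rw [hpq]; abel
      rw [e]
      exact Submodule.sub_mem _ hw (cyclicSpace_le isClosed_alt (zpow_mem_alt hH hy₀) hp)
    have h1 : (S.a ^ (-1 : ℤ)) q - (S.b ^ (-1 : ℤ)) q ∈ S.symm (ℂ ∙ one)ᗮ :=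
      sub_mem_symm hH hqalt (-1)
    -- The operator `a⁻¹ - b⁻¹` is the adjoint of `a - b`. Orthogonality of `q` to the translates of
    -- `(a - b) z` becomes orthogonality of its image to the whole symmetric square, to which that
    -- image belongs. So the image is zero, and `a q = b q`.
    have h2 : (S.a ^ (-1 : ℤ)) q - (S.b ^ (-1 : ℤ)) q ∈ (S.symm (ℂ ∙ one)ᗮ)ᗮ := by
      rw [← hzc, mem_orthogonal_cyclicSpace]
      intro m
      rw [← inner_sub_right_eq, ← a_sub_b_zpow_comm]
      exact mem_orthogonal_cyclicSpace.1 hq m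
    have h3 := inner_self_eq_zero.1 ((Submodule.mem_orthogonal _ _).1 h2 _ h1)
    have hq0 : q = 0 := h.eq_zero_of_a_eq_b (alt_le_tensors hqalt) (a_eq_b_of_inv S h3)
    rw [hpq, hq0, add_zero]
    exact hp
  have hac1 : spectralMeasure S.V y₀ ≪ spectralMeasure S.V z := by
    have hz' : z ∈ dominatedSubspace S.V (spectralMeasure S.V z) :=
      Measure.AbsolutelyContinuous.refl _
    exact Submodule.sub_mem _ (S.a_mem_dominatedSubspace hz') (S.b_mem_dominatedSubspace hz')
  -- The same argument backwards: `a⁻¹ - b⁻¹` takes `y₀` to a generator `z₁` of the symmetric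
  -- square.
  have hac2 : spectralMeasure S.V z ≪ spectralMeasure S.V y₀ := by
    let z₁ : F := (S.a ^ (-1 : ℤ)) y₀ - (S.b ^ (-1 : ℤ)) y₀
    have hz₁ : z₁ ∈ S.symm (ℂ ∙ one)ᗮ := sub_mem_symm hH hy₀ (-1)
    have hdom : spectralMeasure S.V z₁ ≪ spectralMeasure S.V y₀ := by
      have ha : ∀ w, spectralMeasure S.V ((S.a ^ (-1 : ℤ)) w) = spectralMeasure S.V w := by
        intro w
        rw [← S.spectralMeasure_a ((S.a ^ (-1 : ℤ)) w)]
        simp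
      have hb : ∀ w, spectralMeasure S.V ((S.b ^ (-1 : ℤ)) w) = spectralMeasure S.V w := by
        intro w
        rw [← S.spectralMeasure_b ((S.b ^ (-1 : ℤ)) w)]
        simp
      refine Submodule.sub_mem (dominatedSubspace S.V (spectralMeasure S.V y₀)) ?_ ?_
      · rw [mem_dominatedSubspace, ha]
      · rw [mem_dominatedSubspace, hb]
    refine Measure.AbsolutelyContinuous.trans ?_ hdom
    refine spectralMeasure_absolutelyContinuous_of_mem ?_
    obtain ⟨p, hp, q, hq, hpq, -⟩ := exists_cyclicSpace_decomposition S.V z₁ z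
    have hqs : q ∈ S.symm (ℂ ∙ one)ᗮ := by
      have e : q = z - p := by rw [hpq]; abel
      rw [e]
      exact Submodule.sub_mem _ hz (cyclicSpace_le isClosed_symm (zpow_mem_symm hH hz₁) hp)
    have h1 : S.a q - S.b q ∈ S.alt (ℂ ∙ one)ᗮ := h.a_sub_b_mem_alt hqs
    have h2 : S.a q - S.b q ∈ (S.alt (ℂ ∙ one)ᗮ)ᗮ := by
      rw [← hcyc, mem_orthogonal_cyclicSpace]
      intro m
      rw [← inner_conj_symm, inner_sub_right_eq, ← inner_conj_symm, Complex.conj_conj]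
      have := mem_orthogonal_cyclicSpace.1 hq m
      rw [map_sub, ← zpow_comm_apply S.aV_comm, ← zpow_comm_apply S.bV_comm] at this
      exact this
    have h3 := inner_self_eq_zero.1 ((Submodule.mem_orthogonal _ _).1 h2 _ h1)
    have hq0 : q = 0 := h.eq_zero_of_a_eq_b (symm_le_tensors hqs) (sub_eq_zero.1 h3)
    rw [hq0, add_zero] at hpq
    exact Set.mem_of_eq_of_mem hpq hp
  -- So far the spectral measures are only equivalent; changing the generator makes them equal.
  obtain ⟨y, hy1, hy2⟩ := exists_spectralMeasure_eq hac2 hac1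
  refine ⟨y, ?_, by rw [hy1, hcyc], hy2⟩
  rw [← hcyc, ← hy1]
  exact mem_cyclicSpace_self _ _

/-- The sum of the spectral measures of the vectors `f j`. -/
def sumMeasure (U : E ≃ₗᵢ[ℂ] E) (f : ℕ → E) : Measure UnitAddCircle :=
  Measure.sum fun j => spectralMeasure U (f j)

theorem singular_tensor (h : S.IsHomogeneous one f n) (j : ℕ) :
    spectralMeasure U (f j) ⟂ₘ spectralMeasure S.V (S.t (f j) (f j)) :=
  (h.singular j).mono_ac (Measure.AbsolutelyContinuous.refl _)
    (S.spectralMeasure_absolutelyContinuous_K (h.kernel j))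

/-- For the indices `i` and `j` both measures are dominated by those with index `max i j`, where
singularity is known. -/
theorem sumMeasure_singular (h : S.IsHomogeneous one f n) :
    sumMeasure U f ⟂ₘ sumMeasure S.V fun j => S.t (f j) (f j) := by
  rw [sumMeasure, sumMeasure, Measure.MutuallySingular.sum_left]
  intro i
  rw [Measure.MutuallySingular.sum_right]
  intro j
  refine (h.singular_tensor (max i j)).mono_ac ?_ ?_
  · exact spectralMeasure_absolutelyContinuous_of_mem
      (h.monotone_cyclicSpace (le_max_left i j) (mem_cyclicSpace_self _ _))
  · exact spectralMeasure_absolutelyContinuous_of_mem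
      (h.monotone_cyclicSpace_tensor (le_max_right i j) (mem_cyclicSpace_self _ _))

theorem absolutelyContinuous_sumMeasure (U : E ≃ₗᵢ[ℂ] E) {f : ℕ → E} {v : E}
    (hv : ∀ ε > 0, ∃ j, ∃ u ∈ cyclicSpace U (f j), ‖u - v‖ < ε) :
    spectralMeasure U v ≪ sumMeasure U f := by
  rw [← mem_dominatedSubspace, ← SetLike.mem_coe, ← (isClosed_dominatedSubspace U _).closure_eq,
    Metric.mem_closure_iff]
  intro ε hε
  obtain ⟨j, u, hu, huv⟩ := hv ε hε
  refine ⟨u, ?_, by rwa [dist_comm, dist_eq_norm]⟩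
  exact (spectralMeasure_absolutelyContinuous_of_mem hu).trans
    (Measure.absolutelyContinuous_sum_right j (Measure.AbsolutelyContinuous.refl _))

/-- The sums of the two sequences of spectral measures dominate the two maximal spectral types,
because of the density of the cyclic spaces. -/
theorem singular_of_mem (h : S.IsHomogeneous one f n) {v : E} {z : F} (hv : v ∈ (ℂ ∙ one)ᗮ)
    (hz : z ∈ S.symm (ℂ ∙ one)ᗮ) : spectralMeasure U v ⟂ₘ spectralMeasure S.V z :=
  h.sumMeasure_singular.mono_ac (absolutelyContinuous_sumMeasure U (h.dense v hv))
    (absolutelyContinuous_sumMeasure S.V (h.symm_dense z hz))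

end IsHomogeneous

end TensorSquare

/-! ### The three spectral statements for an abstract tensor square -/

namespace TensorSquare

namespace IsHomogeneous

variable {E : Type*} [NormedAddCommGroup E] [InnerProductSpace ℂ E] [CompleteSpace E]
  {U : E ≃ₗᵢ[ℂ] E}
  {F : Type*} [NormedAddCommGroup F] [InnerProductSpace ℂ F] [CompleteSpace F]
  {S : TensorSquare U F} {one : E} {f : ℕ → E} {n : ℕ → ℤ}

theorem spectralMeasure_add_of_mutuallySingular {U : E ≃ₗᵢ[ℂ] E} {x y : E}
    (h : spectralMeasure U x ⟂ₘ spectralMeasure U y) :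
    spectralMeasure U (x + y) = spectralMeasure U x + spectralMeasure U y :=
  spectralMeasure_add_of_orthogonal fun n => by
    rw [inner_zpow_right]; exact inner_zpow_eq_zero_of_mutuallySingular h _

theorem spectralMeasure_t_one (h : S.IsHomogeneous one f n) (x : E) :
    spectralMeasure S.V (S.t x one) = (‖one‖₊ ^ 2) • spectralMeasure U x := by
  refine measure_circle_ext fun m => ?_
  rw [integral_smul_nnreal_measure, integral_fourier_spectralMeasure,
    integral_fourier_spectralMeasure, V_zpow_t, h.zpow_one, S.inner_t,
    inner_self_eq_norm_sq_to_K, NNReal.smul_def, mul_comm]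
  simp

theorem spectralMeasure_one_t (x : E) :
    spectralMeasure S.V (S.t one x) = spectralMeasure S.V (S.t x one) := by
  rw [← S.spectralMeasure_s, S.s_t]

theorem singular_t_one (h : S.IsHomogeneous one f n) {v : E} {z : F} (hv : v ∈ (ℂ ∙ one)ᗮ)
    (hz : z ∈ S.symm (ℂ ∙ one)ᗮ) :
    spectralMeasure S.V (S.t v one) ⟂ₘ spectralMeasure S.V z := by
  rw [h.spectralMeasure_t_one]
  exact (h.singular_of_mem hv hz).smul_nnreal _

theorem t_one_mem (h : S.IsHomogeneous one f n) {v x : E} (hx : x ∈ cyclicSpace U v) :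
    S.t x one ∈ cyclicSpace S.V (S.t v one) := by
  refine cyclicSpace_le (isClosed_comap_isometry (isClosed_cyclicSpace S.V (S.t v one))
    (S.T.flip one)) (fun m => ?_) hx
  change S.t ((U ^ m) v) one ∈ cyclicSpace S.V (S.t v one)
  have := zpow_mem_cyclicSpace S.V (S.t v one) m
  rwa [V_zpow_t, h.zpow_one] at this

theorem one_t_mem (h : S.IsHomogeneous one f n) {v x : E} (hx : x ∈ cyclicSpace U v) :
    S.t one x ∈ cyclicSpace S.V (S.t one v) := by
  refine cyclicSpace_le (isClosed_comap_isometry (isClosed_cyclicSpace S.V (S.t one v))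
    (S.T one)) (fun m => ?_) hx
  change S.t one ((U ^ m) v) ∈ cyclicSpace S.V (S.t one v)
  have := zpow_mem_cyclicSpace S.V (S.t one v) m
  rwa [V_zpow_t, h.zpow_one] at this

theorem sum_t_mem (h : S.IsHomogeneous one f n) {v x : E} (hx : x ∈ cyclicSpace U v) :
    S.t x one + S.t one x ∈ cyclicSpace S.V (S.t v one + S.t one v) := by
  refine cyclicSpace_le (isClosed_comap_isometry
    (isClosed_cyclicSpace S.V (S.t v one + S.t one v))
    (S.T.flip one + S.T one)) (fun m => ?_) hx
  change S.t ((U ^ m) v) one + S.t one ((U ^ m) v) ∈ cyclicSpace S.V (S.t v one + S.t one v)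
  have := zpow_mem_cyclicSpace S.V (S.t v one + S.t one v) m
  rwa [map_add, V_zpow_t, V_zpow_t, h.zpow_one] at this

theorem exists_eq_smul_one_add (one x : E) : ∃ c : ℂ, ∃ y ∈ (ℂ ∙ one)ᗮ, x = c • one + y := by
  obtain ⟨p, hp, q, hq, hx⟩ := (ℂ ∙ one).exists_add_mem_mem_orthogonal x
  obtain ⟨c, rfl⟩ := Submodule.mem_span_singleton.1 hp
  exact ⟨c, q, hq, hx⟩

theorem exists_mem_ne_zero (h : S.IsHomogeneous one f n) : ∃ v ∈ (ℂ ∙ one)ᗮ, v ≠ 0 := by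
  obtain ⟨j, hj⟩ := h.ne_zero
  exact ⟨f j, h.mem j, hj⟩

/-- Let `H` be the complement of the constants. The space is the sum of `H ⊗ 1`, `1 ⊗ H`, the
symmetric and the exterior square of `H`. The first two are cyclic with the type `σ` of `H`, the
last two with a type `τ` singular to `σ`. One space from each pair gives a cyclic space of type `σ +
τ`; there are two of these. -/
theorem hasHomogeneousSpectrum_two (h : S.IsHomogeneous one f n) :
    HasHomogeneousSpectrum S.V (ℂ ∙ S.t one one)ᗮ 2 := by
  obtain ⟨v, hv, hvc⟩ := h.exists_generator
  obtain ⟨z, hz, hzc⟩ := h.exists_symm_generator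
  obtain ⟨y, hy, hyc, hyz⟩ := h.exists_alt_generator hz hzc
  have hs1 := h.singular_t_one hv hz
  have hs2 : spectralMeasure S.V (S.t one v) ⟂ₘ spectralMeasure S.V y := by
    rw [spectralMeasure_one_t, hyz]; exact hs1
  have hc1 := cyclicSpace_add_of_mutuallySingular hs1
  have hc2 := cyclicSpace_add_of_mutuallySingular hs2
  have hσ : spectralMeasure S.V (S.t one v + y) = spectralMeasure S.V (S.t v one + z) := by
    rw [spectralMeasure_add_of_mutuallySingular hs1, spectralMeasure_add_of_mutuallySingular hs2,
      spectralMeasure_one_t, hyz]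
  have hH0 : ∀ x ∈ (ℂ ∙ one)ᗮ, inner ℂ one x = 0 := fun x hx =>
    Submodule.mem_orthogonal_singleton_iff_inner_right.1 hx
  have hH0' : ∀ x ∈ (ℂ ∙ one)ᗮ, inner ℂ x one = 0 := fun x hx =>
    Submodule.mem_orthogonal_singleton_iff_inner_left.1 hx
  have hort : cyclicSpace S.V (S.t v one + z) ⟂ cyclicSpace S.V (S.t one v + y) := by
    rw [hc1, hc2, Submodule.isOrtho_sup_left, Submodule.isOrtho_sup_right,
      Submodule.isOrtho_sup_right]
    refine ⟨⟨?_, ?_⟩, ?_, ?_⟩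
    · refine isOrtho_cyclicSpace fun m => ?_
      rw [V_zpow_t, S.inner_t, hH0' _ (h.zpow_mem hv m), zero_mul]
    · refine isOrtho_cyclicSpace_of_mutuallySingular ?_
      rw [hyz]; exact hs1
    · refine isOrtho_cyclicSpace_of_mutuallySingular ?_
      rw [spectralMeasure_one_t]; exact hs1.symm
    · rw [hzc, hyc, Submodule.isOrtho_iff_inner_eq]
      exact fun u hu w hw => inner_symm_alt hu hw
  have hle1 : cyclicSpace S.V (S.t v one + z) ≤ (ℂ ∙ S.t one one)ᗮ := by
    rw [hc1, hzc]
    refine sup_le (cyclicSpace_le (Submodule.isClosed_orthogonal _) fun m => ?_)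
      (symm_le (Submodule.isClosed_orthogonal _) fun x hx y hy => ?_)
    · rw [Submodule.mem_orthogonal_singleton_iff_inner_right, V_zpow_t, S.inner_t,
        hH0 _ (h.zpow_mem hv m), zero_mul]
    · rw [Submodule.mem_orthogonal_singleton_iff_inner_right, inner_add_right, S.inner_t, S.inner_t,
        hH0 _ hx, hH0 _ hy, zero_mul, add_zero]
  have hle2 : cyclicSpace S.V (S.t one v + y) ≤ (ℂ ∙ S.t one one)ᗮ := by
    rw [hc2, hyc]
    refine sup_le (cyclicSpace_le (Submodule.isClosed_orthogonal _) fun m => ?_)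
      (alt_le (Submodule.isClosed_orthogonal _) fun x hx y hy => ?_)
    · rw [Submodule.mem_orthogonal_singleton_iff_inner_right, V_zpow_t, S.inner_t,
        hH0 _ (h.zpow_mem hv m), mul_zero]
    · rw [Submodule.mem_orthogonal_singleton_iff_inner_right, inner_sub_right, S.inner_t, S.inner_t,
        hH0 _ hx, hH0 _ hy, zero_mul, sub_zero]
  refine ⟨spectralMeasure S.V (S.t v one + z), ![S.t v one + z, S.t one v + y], ?_, ?_, ?_, ?_⟩
  · rw [spectralMeasure_add_of_mutuallySingular hs1]
    intro h0
    have h1 : spectralMeasure S.V (S.t v one) = 0 := 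
      le_antisymm (h0 ▸ Measure.le_add_right le_rfl) (Measure.zero_le _)
    rw [spectralMeasure_eq_zero_iff, ← norm_eq_zero, S.norm_t, mul_eq_zero, norm_eq_zero,
      norm_eq_zero] at h1
    rcases h1 with h1 | h1
    · obtain ⟨w, hw, hw0⟩ := h.exists_mem_ne_zero
      rw [← hvc, h1] at hw
      have hw' : cyclicSpace U (0 : E) ≤ ⊥ := cyclicSpace_le isClosed_singleton fun m => by simp
      exact hw0 (by simpa using hw' hw)
    · exact h.one_ne h1
  · rw [Fin.forall_fin_two]
    refine ⟨isSpectralMeasure_spectralMeasure _ _, ?_⟩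
    rw [← hσ]
    exact isSpectralMeasure_spectralMeasure _ _
  · intro i j hij
    fin_cases i <;> fin_cases j
    · exact absurd rfl hij
    · exact hort
    · exact hort.symm
    · exact absurd rfl hij
  · refine le_antisymm (iSup_le (Fin.forall_fin_two.2 ⟨hle1, hle2⟩)) fun w hw => ?_
    obtain ⟨p, hp, q, hq, hpq, -⟩ := exists_cyclicSpace_decomposition S.V (S.t v one + z) w
    obtain ⟨p', hp', q', hq', hpq', -⟩ := exists_cyclicSpace_decomposition S.V (S.t one v + y) q
    have hq1 : q' ∈ (cyclicSpace S.V (S.t v one + z))ᗮ := by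
      have e : q' = q - p' := by rw [hpq']; abel
      rw [e]
      exact Submodule.sub_mem _ hq (Submodule.isOrtho_iff_le.1 hort.symm hp')
    have hq2 : q' ∈ (ℂ ∙ S.t one one)ᗮ := by
      have e : q' = w - p - p' := by rw [hpq, hpq']; abel
      rw [e]
      exact Submodule.sub_mem _ (Submodule.sub_mem _ hw (hle1 hp)) (hle2 hp')
    rw [hc1] at hq1
    rw [hc2] at hq'
    -- A vector orthogonal to the constant and to the four pieces is orthogonal to every tensor,
    -- after both factors are split into a constant and a vector of `H`.
    have hq0 : q' = 0 := by
      have k1 : ∀ u ∈ cyclicSpace S.V (S.t v one), inner ℂ u q' = 0 := fun u hu =>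
        (Submodule.mem_orthogonal _ _).1 hq1 _ (Submodule.mem_sup_left hu)
      have k2 : ∀ u ∈ S.symm (ℂ ∙ one)ᗮ, inner ℂ u q' = 0 := fun u hu =>
        (Submodule.mem_orthogonal _ _).1 hq1 _ (Submodule.mem_sup_right (by rwa [hzc]))
      have k3 : ∀ u ∈ cyclicSpace S.V (S.t one v), inner ℂ u q' = 0 := fun u hu =>
        (Submodule.mem_orthogonal _ _).1 hq' _ (Submodule.mem_sup_left hu)
      have k4 : ∀ u ∈ S.alt (ℂ ∙ one)ᗮ, inner ℂ u q' = 0 := fun u hu =>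
        (Submodule.mem_orthogonal _ _).1 hq' _ (Submodule.mem_sup_right (by rwa [hyc]))
      have k5 : inner ℂ (S.t one one) q' = 0 :=
        Submodule.mem_orthogonal_singleton_iff_inner_right.1 hq2
      refine S.eq_zero_of_inner_t fun x x' => ?_
      obtain ⟨c, x₀, hx₀, rfl⟩ := exists_eq_smul_one_add one x
      obtain ⟨c', x₁, hx₁, rfl⟩ := exists_eq_smul_one_add one x'
      have e1 := k1 _ (h.t_one_mem (hvc.symm ▸ hx₀))
      have e2 := k3 _ (h.one_t_mem (hvc.symm ▸ hx₁))
      have e3 := k2 _ (t_mem_symm (S := S) hx₀ hx₁)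
      have e4 := k4 _ (t_mem_alt (S := S) hx₀ hx₁)
      rw [inner_add_left] at e3
      rw [inner_sub_left] at e4
      have e5 : inner ℂ (S.t x₀ x₁) q' = 0 := by linear_combination (e3 + e4) / 2
      simp only [map_add, map_smul, LinearMap.add_apply, LinearMap.smul_apply, inner_add_left,
        inner_smul_left, e1, e2, e5, k5, mul_zero, add_zero]
    rw [hpq, hpq', hq0, add_zero]
    exact Submodule.add_mem _ (le_iSup (fun i => cyclicSpace S.V (![S.t v one + z, S.t one v + y] i))
      0 hp) (le_iSup (fun i => cyclicSpace S.V (![S.t v one + z, S.t one v + y] i)) 1 hp')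

theorem spectralMeasure_compl_zero {U : E ≃ₗᵢ[ℂ] E} {x : E} (hx : U x = x) :
    spectralMeasure U x {0}ᶜ = 0 := by
  have : spectralMeasure U x = (‖x‖₊ ^ 2) • Measure.dirac 0 := by
    refine measure_circle_ext fun m => ?_
    rw [integral_smul_nnreal_measure, integral_fourier_spectralMeasure, zpow_apply_of_map_eq hx,
      integral_dirac, inner_self_eq_norm_sq_to_K, NNReal.smul_def]
    simp
  rw [this]
  simp

/-- The symmetric vectors are the sum of the constants, the vectors `x ⊗ 1 + 1 ⊗ x` and the
symmetric square. The types are a point mass at zero, the type of `U` and that of the symmetric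
square. They are mutually singular, the last two having no atom at zero as there are no invariant
vectors, so the sum of the generators is a generator. -/
theorem hasHomogeneousSpectrum_one (h : S.IsHomogeneous one f n) {M : Submodule ℂ F}
    (hM : ∀ w, w ∈ M ↔ S.s w = w) : HasHomogeneousSpectrum S.V M 1 := by
  obtain ⟨v, hv, hvc⟩ := h.exists_generator
  obtain ⟨z, hz, hzc⟩ := h.exists_symm_generator
  have hMc : IsClosed (M : Set F) := by
    have : (M : Set F) = {w | S.s w = w} := Set.ext hM
    rw [this]
    exact isClosed_eq S.s.continuous continuous_id
  let p := S.t v one + S.t one v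
  have hp : spectralMeasure S.V p ≪ spectralMeasure S.V (S.t v one) := by
    refine spectralMeasure_add_absolutelyContinuous (Measure.AbsolutelyContinuous.refl _) ?_
    rw [spectralMeasure_one_t]
  have hs1 : spectralMeasure S.V p ⟂ₘ spectralMeasure S.V z :=
    (h.singular_t_one hv hz).mono_ac hp (Measure.AbsolutelyContinuous.refl _)
  have hc1 := cyclicSpace_add_of_mutuallySingular hs1
  have hV1 : S.V (S.t one one) = S.t one one := by rw [S.V_t, h.map_one]
  have hs2 : spectralMeasure S.V (S.t one one) ⟂ₘ spectralMeasure S.V (p + z) := by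
    refine Measure.MutuallySingular.symm ⟨{0}, MeasurableSet.singleton 0, ?_,
      spectralMeasure_compl_zero hV1⟩
    rw [spectralMeasure_add_of_mutuallySingular hs1]
    have h1 : spectralMeasure S.V p {0} = 0 := by
      refine hp ?_
      rw [h.spectralMeasure_t_one]
      simp only [Measure.smul_apply]
      rw [spectralMeasure_singleton_zero, smul_zero]
      exact fun x hx => h.eq_zero_of_U_eq (hvc ▸ hx)
    have h2 : spectralMeasure S.V z {0} = 0 :=
      spectralMeasure_singleton_zero fun x hx =>
        h.eq_zero_of_V_eq (symm_le_tensors (hzc ▸ hx))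
    simp [h1, h2]
  have hc2 := cyclicSpace_add_of_mutuallySingular hs2
  let w := S.t one one + (p + z)
  refine ⟨spectralMeasure S.V w, fun _ => w, ?_, fun _ => isSpectralMeasure_spectralMeasure _ _,
    fun i j hij => absurd (Subsingleton.elim i j) hij, ?_⟩
  · rw [spectralMeasure_add_of_mutuallySingular hs2]
    intro h0
    have h1 : spectralMeasure S.V (S.t one one) = 0 := 
      le_antisymm (h0 ▸ Measure.le_add_right le_rfl) (Measure.zero_le _)
    rw [spectralMeasure_eq_zero_iff, ← norm_eq_zero, S.norm_t, mul_eq_zero, norm_eq_zero] at h1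
    exact h.one_ne (by tauto)
  · rw [iSup_const]
    have hwM : cyclicSpace S.V w ≤ M := by
      refine cyclicSpace_le hMc fun m => ?_
      rw [hM, zpow_intertwine (S := S.s) S.sV_comm]
      congr 1
      simp only [w, p, map_add, S.s_t, s_of_mem_symm hz]
      abel
    refine le_antisymm hwM fun u hu => ?_
    obtain ⟨u₁, hu₁, q, hq, huq, -⟩ := exists_cyclicSpace_decomposition S.V w u
    have hqM : S.s q = q := by
      rw [← hM]
      have e : q = u - u₁ := by rw [huq]; abel
      rw [e]
      exact Submodule.sub_mem _ hu (hwM hu₁)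
    rw [hc2, hc1] at hq
    have k0 : inner ℂ (S.t one one) q = 0 := (Submodule.mem_orthogonal _ _).1 hq _
      (Submodule.mem_sup_left (mem_cyclicSpace_self _ _))
    have k1 : ∀ x ∈ (ℂ ∙ one)ᗮ, inner ℂ (S.t x one + S.t one x) q = 0 := fun x hx =>
      (Submodule.mem_orthogonal _ _).1 hq _ (Submodule.mem_sup_right (Submodule.mem_sup_left
        (h.sum_t_mem (hvc.symm ▸ hx))))
    have k2 : ∀ x ∈ (ℂ ∙ one)ᗮ, ∀ y ∈ (ℂ ∙ one)ᗮ, inner ℂ (S.t x y + S.t y x) q = 0 :=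
      fun x hx y hy => (Submodule.mem_orthogonal _ _).1 hq _ (Submodule.mem_sup_right
        (Submodule.mem_sup_right (by rw [hzc]; exact t_mem_symm hx hy)))
    have hsw : ∀ x y, inner ℂ (S.t y x) q = inner ℂ (S.t x y) q := fun x y => by
      rw [← S.s.inner_map_map, S.s_t, hqM]
    have hq0 : q = 0 := by
      refine S.eq_zero_of_inner_t fun x x' => ?_
      obtain ⟨c, x₀, hx₀, rfl⟩ := exists_eq_smul_one_add one x
      obtain ⟨c', x₁, hx₁, rfl⟩ := exists_eq_smul_one_add one x'
      have e1 := k1 _ hx₀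
      have e2 := k1 _ hx₁
      have e3 := k2 _ hx₀ _ hx₁
      rw [inner_add_left, hsw x₀ one] at e1
      rw [inner_add_left, hsw x₁ one, hsw one x₁] at e2
      rw [inner_add_left, hsw x₀ x₁] at e3
      have e1' : inner ℂ (S.t x₀ one) q = 0 := by linear_combination e1 / 2
      have e2' : inner ℂ (S.t one x₁) q = 0 := by linear_combination e2 / 2
      have e3' : inner ℂ (S.t x₀ x₁) q = 0 := by linear_combination e3 / 2
      simp only [map_add, map_smul, LinearMap.add_apply, LinearMap.smul_apply, inner_add_left,
        inner_smul_left, e1', e2', e3', k0, mul_zero, add_zero]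
    rw [huq, hq0, add_zero]
    exact hu₁

theorem exists_isMaximalSpectralType (h : S.IsHomogeneous one f n) :
    ∃ σ, IsMaximalSpectralType U (ℂ ∙ one)ᗮ σ := by
  obtain ⟨v, hv, hvc⟩ := h.exists_generator
  refine ⟨spectralMeasure U v, ⟨v, hv, isSpectralMeasure_spectralMeasure _ _⟩, fun x hx τ hτ => ?_⟩
  rw [hτ.eq_spectralMeasure]
  exact spectralMeasure_absolutelyContinuous_of_mem (hvc.symm ▸ hx)

/-- The Fourier coefficients of a convolution square are squares, and so are the values `⟨v ⊗ v, Vᵐ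
(v ⊗ v)⟩`. -/
theorem conv_spectralMeasure (S : TensorSquare U F) (v : E) :
    Measure.conv (spectralMeasure U v) (spectralMeasure U v) = spectralMeasure S.V (S.t v v) := by
  refine measure_circle_ext fun m => ?_
  rw [integral_fourier_spectralMeasure, V_zpow_t, S.inner_t, ← integral_fourier_spectralMeasure,
    Measure.conv, integral_map (by fun_prop) (fourier m).continuous.aestronglyMeasurable]
  rw [← integral_prod_mul]
  congr 1
  ext x
  simp [AddCircle.toCircle_add]

theorem mutuallySingular_conv (h : S.IsHomogeneous one f n) {σ : Measure UnitAddCircle}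
    (hσ : IsMaximalSpectralType U (ℂ ∙ one)ᗮ σ) :
    ¬ HasGroupProperty σ ∧ Measure.MutuallySingular σ (Measure.conv σ σ) := by
  obtain ⟨⟨v, hv, hvσ⟩, hmax⟩ := hσ
  obtain rfl := hvσ.eq_spectralMeasure
  have hsing : spectralMeasure U v ⟂ₘ
      Measure.conv (spectralMeasure U v) (spectralMeasure U v) := by
    rw [conv_spectralMeasure S]
    exact h.singular_of_mem hv (t_self_mem_symm hv)
  refine ⟨fun hg => ?_, hsing⟩
  have h0 := Measure.eq_zero_of_absolutelyContinuous_of_mutuallySingular hg hsing.symm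
  rw [conv_spectralMeasure S, spectralMeasure_eq_zero_iff, ← norm_eq_zero, S.norm_t, mul_eq_zero,
    or_self, norm_eq_zero] at h0
  obtain ⟨w, hw, hw0⟩ := h.exists_mem_ne_zero
  have h1 := hmax w hw _ (isSpectralMeasure_spectralMeasure _ _)
  rw [h0, spectralMeasure_eq_zero_iff.2 rfl, Measure.absolutelyContinuous_zero_iff,
    spectralMeasure_eq_zero_iff] at h1
  exact hw0 h1

end IsHomogeneous

end TensorSquare

/-! ### Staircase towers in a Hilbert space and the telescoping identity -/

/-- The unitary operator `W` moves the vectors `e j k`, `k < h j`, as a staircase construction moves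
the indicators of its floors. -/
structure IsStaircaseModel {E : Type*} [NormedAddCommGroup E] [InnerProductSpace ℂ E]
    (W : E ≃ₗᵢ[ℂ] E) (one : E) (e : ℕ → ℕ → E) (r h : ℕ → ℕ) (B : ℕ → ℕ → ℕ) (w : ℕ → ℝ) :
    Prop where
  two_le : ∀ j, 2 ≤ r j
  succ_le : ∀ j, r (j + 1) ≤ 2 * r j
  le_succ : ∀ j, r j ≤ 2 * r (j + 1)
  two_le_height : 2 ≤ h 0
  base_zero : ∀ j, B j 0 = 0
  base_succ : ∀ j c, c + 1 < r j → B j (c + 1) = B j c + h j + (c + 1)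
  height_succ : ∀ j, h (j + 1) = B j (r j - 1) + h j
  width_pos : ∀ j, 0 < w j
  width_succ : ∀ j, w j = r j * w (j + 1)
  move : ∀ j k, k + 1 < h j → W (e j k) = e j (k + 1)
  cut : ∀ j k, k < h j → e j k = ∑ c ∈ Finset.range (r j), e (j + 1) (B j c + k)
  inner_floor : ∀ j k l, k < h j → l < h j → inner ℂ (e j k) (e j l) = if k = l then (w j : ℂ) else 0
  one_ne : one ≠ 0
  map_one : W one = one
  inner_one : ∀ j k, k < h j → inner ℂ one (e j k) = (w j : ℂ)
  overlap : ∀ (n : ℤ) i k j, k < h i →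
    ∑ l ∈ Finset.range (h j), ‖inner ℂ ((W ^ n) (e i k)) (e j l)‖ ≤ w i
  dense : (Submodule.span ℂ {x | ∃ j k, k < h j ∧ x = e j k}).topologicalClosure = ⊤

namespace IsStaircaseModel

variable {E : Type*} [NormedAddCommGroup E] [InnerProductSpace ℂ E]
  {W : E ≃ₗᵢ[ℂ] E} {one : E} {e : ℕ → ℕ → E} {r h : ℕ → ℕ} {B : ℕ → ℕ → ℕ} {w : ℕ → ℝ}

/-- The span of the floors of the tower `j`. -/
def tower (e : ℕ → ℕ → E) (h : ℕ → ℕ) (j : ℕ) : Submodule ℂ E :=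
  Submodule.span ℂ (e j '' Set.Iio (h j))

/-- The indicator of a set of floors of the tower `j`. -/
def floors (e : ℕ → ℕ → E) (j : ℕ) (D : Finset ℕ) : E := ∑ k ∈ D, e j k

/-- The Hilbert space substitute for `|g| ≤ M`. -/
def BoundedBy (W : E ≃ₗᵢ[ℂ] E) (e : ℕ → ℕ → E) (h : ℕ → ℕ) (w : ℕ → ℝ) (M : ℝ) (g : E) : Prop :=
  ∀ (n : ℤ) i k, k < h i → ‖inner ℂ ((W ^ n) (e i k)) g‖ ≤ M * w i

theorem floor_mem_tower {j k : ℕ} (hk : k < h j) : e j k ∈ tower e h j :=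
  Submodule.subset_span ⟨k, hk, rfl⟩

theorem two_le_height' (S : IsStaircaseModel W one e r h B w) (j : ℕ) : 2 ≤ h j := by
  induction j with
  | zero => exact S.two_le_height
  | succ j ih => rw [S.height_succ]; omega

theorem base_add_le (S : IsStaircaseModel W one e r h B w) (j : ℕ) :
    ∀ n c, c < n → n < r j → B j c + h j ≤ B j n := by
  intro n
  induction n with
  | zero => intro c hc; omega
  | succ n ih =>
    intro c hc hn
    rw [S.base_succ j n hn]
    rcases Nat.lt_succ_iff_lt_or_eq.1 hc with h1 | rfl
    · have := ih c h1 (by omega); omega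
    · omega

theorem base_add_height_le (S : IsStaircaseModel W one e r h B w) (j c : ℕ) (hc : c < r j) :
    B j c + h j ≤ h (j + 1) := by
  rw [S.height_succ]
  rcases lt_or_eq_of_le (Nat.le_sub_one_of_lt hc) with h1 | rfl
  · have := S.base_add_le j (r j - 1) c h1 (by omega); omega
  · rfl

theorem base_add_inj (S : IsStaircaseModel W one e r h B w) {j c c' k l : ℕ} (hc : c < r j)
    (hc' : c' < r j) (hk : k < h j) (hl : l < h j) (heq : B j c + k = B j c' + l) :
    c = c' ∧ k = l := by
  rcases lt_trichotomy c c' with h1 | rfl | h1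
  · have := S.base_add_le j c' c h1 hc'; omega
  · omega
  · have := S.base_add_le j c c' h1 hc; omega

theorem r_pos (S : IsStaircaseModel W one e r h B w) (j : ℕ) : (0 : ℝ) < r j := by
  have := S.two_le j; exact_mod_cast (by omega : 0 < r j)

theorem one_le_r (S : IsStaircaseModel W one e r h B w) (j : ℕ) : (1 : ℝ) ≤ r j := by
  have := S.two_le j; exact_mod_cast (by omega : 1 ≤ r j)

theorem zpow_natCast_floor (S : IsStaircaseModel W one e r h B w) {j k : ℕ} (m : ℕ)
    (hk : k + m < h j) : (W ^ (m : ℤ)) (e j k) = e j (k + m) := by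
  induction m with
  | zero => simp
  | succ m ih =>
    rw [Nat.cast_succ, add_comm, zpow_add_apply, zpow_one, ih (by omega), S.move _ _ (by omega)]
    rfl

theorem width_succ_le (S : IsStaircaseModel W one e r h B w) (j : ℕ) : 2 * w (j + 1) ≤ w j := by
  rw [S.width_succ j]
  have : (2 : ℝ) ≤ r j := by exact_mod_cast S.two_le j
  have := (S.width_pos (j + 1)).le
  gcongr

theorem antitone_width (S : IsStaircaseModel W one e r h B w) : Antitone w :=
  antitone_nat_of_succ_le fun j => by
    have := S.width_succ_le j; have := S.width_pos (j + 1); linarith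

theorem tower_le_succ (S : IsStaircaseModel W one e r h B w) (j : ℕ) :
    tower e h j ≤ tower e h (j + 1) := by
  rw [tower, Submodule.span_le]
  rintro _ ⟨k, hk, rfl⟩
  rw [Set.mem_Iio] at hk
  rw [SetLike.mem_coe, S.cut j k hk]
  refine Submodule.sum_mem _ fun c hc => floor_mem_tower ?_
  have := S.base_add_height_le j c (Finset.mem_range.1 hc)
  omega

theorem monotone_tower (S : IsStaircaseModel W one e r h B w) : Monotone (tower e h) :=
  monotone_nat_of_le_succ S.tower_le_succ

theorem eq_sum_of_mem_tower (S : IsStaircaseModel W one e r h B w) {j : ℕ} {g : E}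
    (hg : g ∈ tower e h j) :
    g = ∑ l ∈ Finset.range (h j), (inner ℂ (e j l) g / w j) • e j l := by
  have hw : (w j : ℂ) ≠ 0 := by exact_mod_cast (S.width_pos j).ne'
  refine Submodule.span_induction ?_ ?_ ?_ ?_ hg
  · rintro _ ⟨k, hk, rfl⟩
    rw [Finset.sum_eq_single_of_mem k (Finset.mem_range.2 hk)]
    · rw [S.inner_floor j k k hk hk, if_pos rfl, div_self hw, one_smul]
    · intro l hl hlk
      rw [S.inner_floor j l k (Finset.mem_range.1 hl) hk, if_neg hlk, zero_div, zero_smul]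
  · simp
  · intro x y _ _ hx hy
    simp only [inner_add_right, add_div, add_smul, Finset.sum_add_distrib]
    rw [← hx, ← hy]
  · intro a x _ hx
    simp only [inner_smul_right, mul_div_assoc, mul_smul]
    rw [← Finset.smul_sum, ← hx]

namespace BoundedBy

theorem sub {M N : ℝ} {x y : E} (hx : BoundedBy W e h w M x) (hy : BoundedBy W e h w N y) :
    BoundedBy W e h w (M + N) (x - y) := fun n i k hk => by
  rw [inner_sub_right, add_mul]
  exact (norm_sub_le _ _).trans (add_le_add (hx n i k hk) (hy n i k hk))

theorem smul {M : ℝ} {x : E} (hx : BoundedBy W e h w M x) (c : ℂ) :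
    BoundedBy W e h w (‖c‖ * M) (c • x) := fun n i k hk => by
  rw [inner_smul_right, norm_mul, mul_assoc]
  exact mul_le_mul_of_nonneg_left (hx n i k hk) (norm_nonneg _)

theorem zpow {M : ℝ} {x : E} (hx : BoundedBy W e h w M x) (m : ℤ) :
    BoundedBy W e h w M ((W ^ m) x) := fun n i k hk => by
  have := hx (-m + n) i k hk
  rwa [zpow_add_apply, ← LinearIsometryEquiv.inner_map_map (W ^ m), ← zpow_add_apply, add_neg_cancel,
    zpow_zero] at this

theorem norm_inner_floors_le {M : ℝ} {g : E} (hg : BoundedBy W e h w M g) (n : ℤ) {j : ℕ}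
    {D : Finset ℕ} (hD : D ⊆ Finset.range (h j)) :
    ‖inner ℂ ((W ^ n) (floors e j D)) g‖ ≤ D.card * (M * w j) := by
  rw [floors, map_sum, sum_inner, ← nsmul_eq_mul]
  exact norm_sum_le_of_le _ (fun k hk => hg n j k (Finset.mem_range.1 (hD hk))) |>.trans_eq
    (by rw [Finset.sum_const])

end BoundedBy

/-- The parts of a moved floor inside the disjoint floors of one tower have total measure at most
that of the floor; this is the property `overlap`. -/
theorem boundedBy_sum (S : IsStaircaseModel W one e r h B w) {M : ℝ} {j : ℕ} {γ : ℕ → ℂ}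
    {L : Finset ℕ} (hL : L ⊆ Finset.range (h j)) (hγ : ∀ l ∈ L, ‖γ l‖ ≤ M) (hM : 0 ≤ M) :
    BoundedBy W e h w M (∑ l ∈ L, γ l • e j l) := fun n i k hk => by
  rw [inner_sum]
  calc ‖∑ l ∈ L, inner ℂ ((W ^ n) (e i k)) (γ l • e j l)‖
      ≤ ∑ l ∈ L, M * ‖inner ℂ ((W ^ n) (e i k)) (e j l)‖ := by
        refine norm_sum_le_of_le _ fun l hl => ?_
        rw [inner_smul_right, norm_mul]
        exact mul_le_mul_of_nonneg_right (hγ l hl) (norm_nonneg _)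
    _ ≤ ∑ l ∈ Finset.range (h j), M * ‖inner ℂ ((W ^ n) (e i k)) (e j l)‖ :=
        Finset.sum_le_sum_of_subset_of_nonneg hL fun _ _ _ => by positivity
    _ ≤ M * w i := by
        rw [← Finset.mul_sum]
        exact mul_le_mul_of_nonneg_left (S.overlap n i k j hk) hM

theorem boundedBy_floors (S : IsStaircaseModel W one e r h B w) {j : ℕ} {D : Finset ℕ}
    (hD : D ⊆ Finset.range (h j)) : BoundedBy W e h w 1 (floors e j D) := by
  have := S.boundedBy_sum (M := 1) (γ := fun _ => 1) hD (by simp) zero_le_one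
  simpa [floors] using this

theorem boundedBy_floor (S : IsStaircaseModel W one e r h B w) {j k : ℕ} (hk : k < h j) :
    BoundedBy W e h w 1 (e j k) := by
  have := S.boundedBy_floors (j := j) (D := {k}) (by simpa using hk)
  simpa [floors] using this

theorem norm_coeff_le (S : IsStaircaseModel W one e r h B w) {M : ℝ} {g : E}
    (hg : BoundedBy W e h w M g) {j l : ℕ} (hl : l < h j) :
    ‖inner ℂ (e j l) g / (w j : ℂ)‖ ≤ M := by
  have h1 := hg 0 j l hl
  have h2 := S.width_pos j
  rw [norm_div, Complex.norm_real, Real.norm_of_nonneg h2.le, div_le_iff₀ h2]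
  simpa using h1

theorem BoundedBy.nonneg (S : IsStaircaseModel W one e r h B w) {M : ℝ} {g : E}
    (hg : BoundedBy W e h w M g) : 0 ≤ M :=
  (norm_nonneg _).trans (S.norm_coeff_le hg (j := 0) (l := 0)
    (by have := S.two_le_height; omega))

/-- Pairing a set of floors, moved by `W`, with the floors near the top of the tower. -/
theorem norm_inner_floors_sum_le (S : IsStaircaseModel W one e r h B w) {M : ℝ} {j : ℕ} {γ : ℕ → ℂ}
    {L D : Finset ℕ} (hL : L ⊆ Finset.range (h j)) (hD : D ⊆ Finset.range (h j))
    (hγ : ∀ l ∈ L, ‖γ l‖ ≤ M) (hM : 0 ≤ M) (n : ℤ) :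
    ‖inner ℂ ((W ^ n) (floors e j D)) (∑ l ∈ L, γ l • e j l)‖ ≤ L.card * (M * w j) := by
  have h1 := S.boundedBy_floors hD
  rw [inner_sum, ← nsmul_eq_mul]
  refine (norm_sum_le_of_le _ fun l hl => ?_).trans_eq (by rw [Finset.sum_const])
  rw [inner_smul_right, norm_mul]
  refine mul_le_mul (hγ l hl) ?_ (norm_nonneg _) hM
  have h2 := h1.zpow n 0 j l (Finset.mem_range.1 (hL hl))
  rw [zpow_zero, one_mul] at h2
  rw [← inner_conj_symm, RCLike.norm_conj]
  exact h2

/-- All columns are equal copies, so the part of a floor in one column carries `1 / r` of any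
pairing with a floor of the same tower. -/
theorem inner_sub_floor (S : IsStaircaseModel W one e r h B w) {j c k l : ℕ} (hc : c < r j)
    (hk : k < h j) (hl : l < h j) :
    inner ℂ (e (j + 1) (B j c + k)) (e j l) = (r j : ℂ)⁻¹ * inner ℂ (e j k) (e j l) := by
  have hr : (r j : ℂ) ≠ 0 := by exact_mod_cast (S.r_pos j).ne'
  have hb : ∀ c < r j, ∀ k < h j, B j c + k < h (j + 1) := fun c hc k hk => by
    have := S.base_add_height_le j c hc; omega
  rw [S.cut j l hl, inner_sum, ← S.cut j l hl, S.inner_floor j k l hk hl,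
    Finset.sum_eq_single_of_mem c (Finset.mem_range.2 hc)]
  · rw [S.inner_floor _ _ _ (hb c hc k hk) (hb c hc l hl), S.width_succ j]
    by_cases hkl : k = l
    · rw [if_pos (by omega), if_pos hkl]; push_cast; field_simp
    · rw [if_neg (by omega), if_neg hkl, mul_zero]
  · intro c' hc' hne
    rw [S.inner_floor _ _ _ (hb c hc k hk) (hb c' (Finset.mem_range.1 hc') l hl), if_neg]
    exact fun heq => hne (S.base_add_inj hc (Finset.mem_range.1 hc') hk hl heq).1.symm

/-- Moving a floor by the height of the tower. -/
theorem inner_zpow_height_floor (S : IsStaircaseModel W one e r h B w) {j k l : ℕ} (hk : k < h j)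
    (hl : l + r j ≤ h j) :
    inner ℂ ((W ^ (h j : ℤ)) (e j k)) (e j l) =
      (r j : ℂ)⁻¹ * ∑ c ∈ Finset.range (r j - 1), inner ℂ ((W ^ (-(c + 1 : ℕ) : ℤ)) (e j k)) (e j l) +
        inner ℂ ((W ^ (h (j + 1) : ℤ)) (e (j + 1) k)) (e j l) := by
  have hr2 := S.two_le j
  obtain ⟨m, hm⟩ : ∃ m, r j = m + 1 := ⟨r j - 1, by omega⟩
  conv_lhs => rw [S.cut j k hk]
  rw [map_sum, sum_inner, hm, Finset.sum_range_succ, Nat.add_sub_cancel]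
  congr 1
  · rw [Finset.mul_sum]
    refine Finset.sum_congr rfl fun c hc => ?_
    have hc' : c + 1 < r j := by have := Finset.mem_range.1 hc; omega
    have hb := S.base_add_height_le j (c + 1) hc'
    -- Since `c + 1` spacers lie above column `c`, a move by `h j` ends `c + 1` floors below the
    -- floor `k` of column `c + 1`.
    have e1 : e (j + 1) (B j (c + 1) + k) =
        (W ^ ((c + 1 : ℕ) : ℤ)) ((W ^ (h j : ℤ)) (e (j + 1) (B j c + k))) := by
      rw [← zpow_add_apply, ← Nat.cast_add, S.zpow_natCast_floor]
      · congr 1; rw [S.base_succ j c hc']; ring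
      · have := S.base_succ j c hc'; omega
    have e2 : (W ^ ((c + 1 : ℕ) : ℤ)) (e j l) = e j (l + (c + 1)) :=
      S.zpow_natCast_floor _ (by omega)
    rw [← LinearIsometryEquiv.inner_map_map (W ^ ((c + 1 : ℕ) : ℤ)), ← e1, e2,
      S.inner_sub_floor hc' hk (by omega), ← e2, hm]
    congr 1
    rw [← LinearIsometryEquiv.inner_map_map (W ^ ((c + 1 : ℕ) : ℤ))
      ((W ^ (-(c + 1 : ℕ) : ℤ)) (e j k)), ← zpow_add_apply, add_neg_cancel, zpow_zero]
    rfl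
  -- The last column has no spacers and leaves the tower of stage `j + 1`. As `B j m + h j = h (j +
  -- 1)`, its contribution has the original form one stage later.
  · have e1 : (W ^ (B j m : ℤ)) (e (j + 1) k) = e (j + 1) (B j m + k) := by
      have := S.base_add_height_le j m (by omega)
      rw [S.zpow_natCast_floor _ (by omega), add_comm k]
    rw [← e1, ← zpow_add_apply, S.height_succ, hm, Nat.add_sub_cancel]
    congr 3
    push_cast; ring_nf

/-- The span of the floors of the tower `j` that are not among the `q` top ones. -/
def lowTower (e : ℕ → ℕ → E) (h : ℕ → ℕ) (j q : ℕ) : Submodule ℂ E :=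
  Submodule.span ℂ (e j '' {l | l + q ≤ h j})

theorem inner_zpow_height (S : IsStaircaseModel W one e r h B w) {j k : ℕ} (hk : k < h j) {g : E}
    (hg : g ∈ lowTower e h j (r j)) :
    inner ℂ ((W ^ (h j : ℤ)) (e j k)) g =
      (r j : ℂ)⁻¹ * ∑ c ∈ Finset.range (r j - 1), inner ℂ ((W ^ (-(c + 1 : ℕ) : ℤ)) (e j k)) g +
        inner ℂ ((W ^ (h (j + 1) : ℤ)) (e (j + 1) k)) g := by
  refine Submodule.span_induction ?_ ?_ ?_ ?_ hg
  · rintro _ ⟨l, hl, rfl⟩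
    exact S.inner_zpow_height_floor hk hl
  · simp
  · intro x y _ _ hx hy
    simp only [inner_add_right, Finset.sum_add_distrib, hx, hy]
    ring
  · intro a x _ hx
    simp only [inner_smul_right, ← Finset.mul_sum, hx]
    ring

/-- Makes it possible to use the identity for `W ^ h` at two successive stages with the same test
vector. -/
theorem lowTower_le_succ (S : IsStaircaseModel W one e r h B w) (j : ℕ) :
    lowTower e h j (2 * r j) ≤ lowTower e h (j + 1) (r (j + 1)) := by
  rw [lowTower, Submodule.span_le]
  rintro _ ⟨l, hl, rfl⟩
  rw [Set.mem_ofPred_eq] at hl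
  have h1 := S.succ_le j
  have h2 := S.two_le j
  rw [SetLike.mem_coe, S.cut j l (by omega)]
  refine Submodule.sum_mem _ fun c hc => Submodule.subset_span ⟨_, ?_, rfl⟩
  have := S.base_add_height_le j c (Finset.mem_range.1 hc)
  simp only [Set.mem_ofPred_eq]
  omega

theorem lowTower_anti {j q q' : ℕ} (hq : q ≤ q') : lowTower e h j q' ≤ lowTower e h j q :=
  Submodule.span_mono (Set.image_mono fun l hl => by
    simp only [Set.mem_ofPred_eq] at *; omega)

/-- `(1 - W) x`, moved by `n`. -/
def diff (W : E ≃ₗᵢ[ℂ] E) (n : ℤ) (x : E) : E := (W ^ n) x - (W ^ (n + 1)) x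

/-- The average of the powers `W ^ (-(c + 1))`, applied to `(1 - W) x`, telescopes to its two ends.
-/
theorem inner_diff_height (S : IsStaircaseModel W one e r h B w) {j k : ℕ} (hk : k + 1 < h j) {g : E}
    (hg : g ∈ lowTower e h j (r j)) :
    (r j : ℂ) * inner ℂ (diff W (h j) (e j k)) g =
      inner ℂ ((W ^ (-(r j - 1 : ℕ) : ℤ)) (e j k) - e j k) g +
        r j * inner ℂ (diff W (h (j + 1)) (e (j + 1) k)) g := by
  have hr : (r j : ℂ) ≠ 0 := by exact_mod_cast (S.r_pos j).ne'
  have hh := S.height_succ j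
  have e1 : (W ^ ((h j : ℤ) + 1)) (e j k) = (W ^ (h j : ℤ)) (e j (k + 1)) := by
    rw [zpow_add_apply, zpow_one, S.move j k hk]
  have e2 : (W ^ ((h (j + 1) : ℤ) + 1)) (e (j + 1) k) = (W ^ (h (j + 1) : ℤ)) (e (j + 1) (k + 1)) := by
    rw [zpow_add_apply, zpow_one, S.move (j + 1) k (by omega)]
  have e3 : ∀ c : ℕ, (W ^ (-(c + 1 : ℕ) : ℤ)) (e j (k + 1)) = (W ^ (-(c : ℕ) : ℤ)) (e j k) := by
    intro c
    rw [← S.move j k hk, show W (e j k) = (W ^ (1 : ℤ)) (e j k) by rw [zpow_one],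
      ← zpow_add_apply]
    congr 2; push_cast; ring
  rw [diff, diff, e1, e2, inner_sub_left, inner_sub_left, inner_sub_left,
    S.inner_zpow_height (by omega) hg, S.inner_zpow_height hk hg]
  simp only [e3]
  have tel := Finset.sum_range_sub (fun c : ℕ => inner ℂ ((W ^ (-(c : ℕ) : ℤ)) (e j k)) g) (r j - 1)
  rw [Finset.sum_sub_distrib] at tel
  simp only [Nat.cast_zero, neg_zero, zpow_zero] at tel
  rw [show (1 : E ≃ₗᵢ[ℂ] E) (e j k) = e j k from rfl] at tel
  rw [← tel]
  field_simp
  ring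

theorem norm_inner_diff_le {M : ℝ} {g : E} (hg : BoundedBy W e h w M g) (n : ℤ) {i k : ℕ}
    (hk : k < h i) : ‖inner ℂ (diff W n (e i k)) g‖ ≤ 2 * M * w i := by
  rw [diff, inner_sub_left]
  refine (norm_sub_le _ _).trans ?_
  linarith [hg n i k hk, hg (n + 1) i k hk]

/-- Estimated directly, the term of stage `j + 1` is of order `w j`, with no gain. A second use of
the identity, at stage `j + 1`, gains the factor `1 / r (j + 1)`. -/
theorem norm_inner_diff_height_sub_le (S : IsStaircaseModel W one e r h B w) {M : ℝ} {j k : ℕ}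
    (hk : k + 1 < h j) {g : E} (hg : g ∈ lowTower e h j (2 * r j)) (hM : BoundedBy W e h w M g) :
    ‖(r j : ℂ) * inner ℂ (diff W (h j) (e j k)) g -
      inner ℂ ((W ^ (-(r j - 1 : ℕ) : ℤ)) (e j k) - e j k) g‖ ≤ 4 * M * w j / r (j + 1) := by
  have hh := S.height_succ j
  have hh' := S.height_succ (j + 1)
  have hM0 := BoundedBy.nonneg S hM
  rw [S.inner_diff_height hk (lowTower_anti (by omega) hg), add_sub_cancel_left]
  have key := S.inner_diff_height (j := j + 1) (k := k) (by omega) (S.lowTower_le_succ j hg)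
  have b : ‖(r (j + 1) : ℂ) * inner ℂ (diff W (h (j + 1)) (e (j + 1) k)) g‖ ≤ 4 * M * w (j + 1) := by
    rw [key]
    refine (norm_add_le _ _).trans ?_
    have b1 : ‖inner ℂ ((W ^ (-(r (j + 1) - 1 : ℕ) : ℤ)) (e (j + 1) k) - e (j + 1) k) g‖ ≤
        2 * M * w (j + 1) := by
      rw [inner_sub_left]
      refine (norm_sub_le _ _).trans ?_
      have h1 := hM (-(r (j + 1) - 1 : ℕ) : ℤ) (j + 1) k (by omega)
      have h2 := hM 0 (j + 1) k (by omega)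
      rw [zpow_zero] at h2
      have h2' : ‖inner ℂ (e (j + 1) k) g‖ ≤ M * w (j + 1) := h2
      linarith
    have b2 := norm_inner_diff_le hM (h (j + 1 + 1)) (i := j + 1 + 1) (k := k) (by omega)
    have b3 : ‖(r (j + 1) : ℂ) * inner ℂ (diff W (h (j + 1 + 1)) (e (j + 1 + 1) k)) g‖ ≤
        2 * M * w (j + 1) := by
      rw [norm_mul, Complex.norm_natCast, S.width_succ (j + 1)]
      calc _ ≤ (r (j + 1) : ℝ) * (2 * M * w (j + 1 + 1)) := by gcongr
        _ = _ := by ring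
    linarith
  rw [norm_mul, Complex.norm_natCast] at b ⊢
  have hr := S.r_pos (j + 1)
  rw [le_div_iff₀ hr, S.width_succ j]
  calc _ = (r j : ℝ) * (r (j + 1) * ‖inner ℂ (diff W (h (j + 1)) (e (j + 1) k)) g‖) := by ring
    _ ≤ r j * (4 * M * w (j + 1)) := by gcongr
    _ = _ := by ring

end IsStaircaseModel

/-! ### Error estimates for unions of floors -/

namespace IsStaircaseModel

variable {E : Type*} [NormedAddCommGroup E] [InnerProductSpace ℂ E]
  {W : E ≃ₗᵢ[ℂ] E} {one : E} {e : ℕ → ℕ → E} {r h : ℕ → ℕ} {B : ℕ → ℕ → ℕ} {w : ℕ → ℝ}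

theorem card_filter_lt_add_le {D : Finset ℕ} {n q : ℕ} (hD : D ⊆ Finset.range n) :
    (D.filter fun k => ¬ k + q < n).card ≤ q := by
  calc (D.filter fun k => ¬ k + q < n).card ≤ (Finset.Ico (n - q) n).card := by
        refine Finset.card_le_card fun k hk => ?_
        have h1 := Finset.mem_filter.1 hk
        have h2 := Finset.mem_range.1 (hD h1.1)
        rw [Finset.mem_Ico]
        omega
    _ ≤ q := by rw [Nat.card_Ico]; omega

theorem floors_filter_add (j : ℕ) (D : Finset ℕ) (p : ℕ → Prop) [DecidablePred p] :
    floors e j D = floors e j (D.filter p) + floors e j (D.filter fun k => ¬ p k) :=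
  (Finset.sum_filter_add_sum_filter_not D p _).symm

/-- A bounded function on the tower, split into the parts below and near the top. -/
theorem exists_low_add_high (S : IsStaircaseModel W one e r h B w) {M : ℝ} {j : ℕ} {g : E}
    (hg : g ∈ tower e h j) (hM : BoundedBy W e h w M g) (q : ℕ) :
    ∃ g₁ ∈ lowTower e h j (q + 1), ∃ g₂, g = g₁ + g₂ ∧ BoundedBy W e h w M g₁ ∧
      ∀ D ⊆ Finset.range (h j), ∀ n : ℤ,
        ‖inner ℂ ((W ^ n) (floors e j D)) g₂‖ ≤ q * (M * w j) := by
  have hM0 := BoundedBy.nonneg S hM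
  let γ : ℕ → ℂ := fun l => inner ℂ (e j l) g / w j
  have hγ : ∀ l < h j, ‖γ l‖ ≤ M := fun l hl => S.norm_coeff_le hM hl
  have f1 : (Finset.range (h j)).filter (fun l => l + q < h j) ⊆ Finset.range (h j) :=
    Finset.filter_subset _ _
  have f2 : (Finset.range (h j)).filter (fun l => ¬ l + q < h j) ⊆ Finset.range (h j) :=
    Finset.filter_subset _ _
  refine ⟨∑ l ∈ (Finset.range (h j)).filter (fun l => l + q < h j), γ l • e j l, ?_,
    ∑ l ∈ (Finset.range (h j)).filter (fun l => ¬ l + q < h j), γ l • e j l, ?_, ?_, ?_⟩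
  · refine Submodule.sum_mem _ fun l hl => Submodule.smul_mem _ _ (Submodule.subset_span ⟨l, ?_, rfl⟩)
    have := (Finset.mem_filter.1 hl).2
    simp only [Set.mem_ofPred_eq]; omega
  · rw [Finset.sum_filter_add_sum_filter_not]
    exact S.eq_sum_of_mem_tower hg
  · exact S.boundedBy_sum f1 (fun l hl => hγ l (Finset.mem_range.1 (f1 hl))) hM0
  · intro D hD n
    refine (S.norm_inner_floors_sum_le f2 hD (fun l hl => hγ l (Finset.mem_range.1 (f2 hl))) hM0
      n).trans ?_
    have := S.width_pos j
    gcongr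
    exact card_filter_lt_add_le subset_rfl

/-- The difference between `r ⟨W ^ h (1 - W) x, g⟩` and its main part. -/
def diffError (W : E ≃ₗᵢ[ℂ] E) (r h : ℕ → ℕ) (j : ℕ) (x g : E) : ℂ :=
  (r j : ℂ) * inner ℂ (diff W (h j) x) g - inner ℂ ((W ^ (-(r j - 1 : ℕ) : ℤ)) x - x) g

theorem diff_add (n : ℤ) (x y : E) : diff W n (x + y) = diff W n x + diff W n y := by
  simp only [diff, map_add]; abel

theorem diffError_add_left (j : ℕ) (x y g : E) :
    diffError W r h j (x + y) g = diffError W r h j x g + diffError W r h j y g := by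
  simp only [diffError, diff, map_add, inner_sub_left, inner_add_left]; ring

theorem diffError_add_right (j : ℕ) (x g g' : E) :
    diffError W r h j x (g + g') = diffError W r h j x g + diffError W r h j x g' := by
  simp only [diffError, inner_add_right]; ring

theorem diffError_zero_left (j : ℕ) (g : E) : diffError W r h j 0 g = 0 := by
  simp [diffError, diff]

theorem diffError_sum_left (j : ℕ) (D : Finset ℕ) (x : ℕ → E) (g : E) :
    diffError W r h j (∑ k ∈ D, x k) g = ∑ k ∈ D, diffError W r h j (x k) g := by
  induction D using Finset.cons_induction with
  | empty => simp [diffError_zero_left]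
  | cons a D ha ih => rw [Finset.sum_cons, Finset.sum_cons, diffError_add_left, ih]

theorem norm_diffError_le {b : ℝ} {j : ℕ} {x g : E} (hb : ∀ n : ℤ, ‖inner ℂ ((W ^ n) x) g‖ ≤ b) :
    ‖diffError W r h j x g‖ ≤ (2 * r j + 2) * b := by
  have h1 := hb (h j)
  have h2 := hb (h j + 1)
  have h3 := hb (-(r j - 1 : ℕ))
  have h4 : ‖inner ℂ x g‖ ≤ b := hb 0
  rw [diffError, diff, inner_sub_left, inner_sub_left]
  calc _ ≤ (r j : ℝ) * (b + b) + (b + b) := by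
        refine (norm_sub_le _ _).trans (add_le_add ?_ ((norm_sub_le _ _).trans (add_le_add h3 h4)))
        rw [norm_mul, Complex.norm_natCast]
        gcongr
        exact (norm_sub_le _ _).trans (add_le_add h1 h2)
    _ = _ := by ring

/-- Away from the top the estimate for one floor is summed over `D`. Only `O(r)` floors of `D` or of
`g` lie too close to the top; for these the trivial bound costs `O(r² w)`. The shift by `s` is
needed when the vector `W ^ (-(r - 1)) x` is moved to the other side of a pairing. -/
theorem norm_diffError_floors_le (S : IsStaircaseModel W one e r h B w) {M : ℝ} {j s : ℕ}
    {D : Finset ℕ} (hD : D ⊆ Finset.range (h j)) (hs : s + 1 ≤ r j) {g : E} (hg : g ∈ tower e h j)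
    (hM : BoundedBy W e h w M g) :
    ‖diffError W r h j ((W ^ (s : ℤ)) (floors e j D)) g‖ ≤
      M * (4 * (D.card * w j) / r (j + 1) + 12 * r j ^ 2 * w j) := by
  have hM0 := BoundedBy.nonneg S hM
  have hw := (S.width_pos j).le
  have hr2 := S.two_le j
  have hr1 := S.one_le_r j
  obtain ⟨g₁, hg₁, g₂, rfl, hb₁, hb₂⟩ := S.exists_low_add_high hg hM (2 * r j - 1)
  rw [show 2 * r j - 1 + 1 = 2 * r j by omega] at hg₁
  have d1 : D.filter (fun k => k + (s + 1) < h j) ⊆ Finset.range (h j) :=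
    (Finset.filter_subset _ _).trans hD
  have d2 : D.filter (fun k => ¬ k + (s + 1) < h j) ⊆ Finset.range (h j) :=
    (Finset.filter_subset _ _).trans hD
  rw [floors_filter_add j D fun k => k + (s + 1) < h j, map_add, diffError_add_left,
    diffError_add_right]
  have b1 : ‖diffError W r h j ((W ^ (s : ℤ))
      (floors e j (D.filter fun k => k + (s + 1) < h j))) g₁‖ ≤
      D.card * (4 * M * w j / r (j + 1)) := by
    rw [floors, map_sum, diffError_sum_left]
    calc _ ≤ (D.filter fun k => k + (s + 1) < h j).card * (4 * M * w j / r (j + 1)) := by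
          rw [← nsmul_eq_mul]
          refine (norm_sum_le_of_le _ fun k hk => ?_).trans_eq (by rw [Finset.sum_const])
          have hk' := (Finset.mem_filter.1 hk).2
          rw [S.zpow_natCast_floor s (by omega)]
          exact S.norm_inner_diff_height_sub_le (by omega) hg₁ hb₁
      _ ≤ _ := by
          gcongr
          exact Finset.filter_subset _ _
  have b2 := norm_diffError_le (W := W) (r := r) (h := h) (j := j)
    (x := (W ^ (s : ℤ)) (floors e j (D.filter fun k => k + (s + 1) < h j))) (g := g₂)
    (b := 2 * r j * (M * w j)) (fun n => by
      rw [← zpow_add_apply]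
      refine (hb₂ _ d1 _).trans ?_
      gcongr
      rw [Nat.cast_sub (by omega)]
      push_cast; linarith)
  have b3 := norm_diffError_le (W := W) (r := r) (h := h) (j := j)
    (x := (W ^ (s : ℤ)) (floors e j (D.filter fun k => ¬ k + (s + 1) < h j))) (g := g₁ + g₂)
    (b := r j * (M * w j)) (fun n => by
      rw [← zpow_add_apply]
      refine (hM.norm_inner_floors_le _ d2).trans ?_
      gcongr
      exact_mod_cast (card_filter_lt_add_le hD).trans hs)
  have hMw : 0 ≤ M * w j := mul_nonneg hM0 hw
  calc _ ≤ D.card * (4 * M * w j / r (j + 1)) + (2 * r j + 2) * (2 * r j * (M * w j)) +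
        (2 * r j + 2) * (r j * (M * w j)) :=
        (norm_add_le _ _).trans (add_le_add ((norm_add_le _ _).trans (add_le_add b1 b2)) b3)
    _ = M * (4 * (D.card * w j) / r (j + 1)) + (6 * r j ^ 2 + 6 * r j) * (M * w j) := by ring
    _ ≤ M * (4 * (D.card * w j) / r (j + 1)) + 12 * r j ^ 2 * (M * w j) := by
        gcongr
        nlinarith
    _ = _ := by ring

/-- The difference between `⟨W ^ (h + m) x, g⟩` and an ergodic average. -/
def mixError (W : E ≃ₗᵢ[ℂ] E) (r h : ℕ → ℕ) (j m : ℕ) (x g : E) : ℂ :=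
  inner ℂ ((W ^ (h j + m : ℤ)) x) g - (r j : ℂ)⁻¹ *
    ∑ c ∈ Finset.range (r j - 1), inner ℂ ((W ^ (-(c + 1 : ℕ) + m : ℤ)) x) g

theorem mixError_add_left (j m : ℕ) (x y g : E) :
    mixError W r h j m (x + y) g = mixError W r h j m x g + mixError W r h j m y g := by
  simp only [mixError, map_add, inner_add_left, Finset.sum_add_distrib]; ring

theorem mixError_add_right (j m : ℕ) (x g g' : E) :
    mixError W r h j m x (g + g') = mixError W r h j m x g + mixError W r h j m x g' := by
  simp only [mixError, inner_add_right, Finset.sum_add_distrib]; ring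

theorem mixError_sum_left (j m : ℕ) (D : Finset ℕ) (x : ℕ → E) (g : E) :
    mixError W r h j m (∑ k ∈ D, x k) g = ∑ k ∈ D, mixError W r h j m (x k) g := by
  induction D using Finset.cons_induction with
  | empty => simp [mixError]
  | cons a D ha ih => rw [Finset.sum_cons, Finset.sum_cons, mixError_add_left, ih]

theorem norm_inv_mul_sum_le {n : ℕ} {m : ℕ} (hmn : m ≤ n) (hn : 0 < n) {f : ℕ → ℂ} {b : ℝ}
    (hb : ∀ c, ‖f c‖ ≤ b) :
    ‖(n : ℂ)⁻¹ * ∑ c ∈ Finset.range m, f c‖ ≤ b := by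
  have hb0 : 0 ≤ b := (norm_nonneg _).trans (hb 0)
  have hn' : (0 : ℝ) < n := by exact_mod_cast hn
  rw [norm_mul, norm_inv, Complex.norm_natCast, inv_mul_le_iff₀ hn']
  calc _ ≤ (m : ℝ) * b := by
        rw [← nsmul_eq_mul]
        exact (norm_sum_le_of_le _ fun c _ => hb c).trans_eq (by simp)
    _ ≤ n * b := by gcongr

theorem norm_mixError_le (S : IsStaircaseModel W one e r h B w) {b : ℝ} {j m : ℕ} {x g : E}
    (hb : ∀ n : ℤ, ‖inner ℂ ((W ^ n) x) g‖ ≤ b) :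
    ‖mixError W r h j m x g‖ ≤ 2 * b := by
  have hr2 := S.two_le j
  rw [mixError, two_mul]
  exact (norm_sub_le _ _).trans (add_le_add (hb _)
    (norm_inv_mul_sum_le (by omega) (by omega) fun c => hb _))

theorem norm_mixError_floors_le (S : IsStaircaseModel W one e r h B w) {M : ℝ} {j m : ℕ}
    {D : Finset ℕ} (hD : D ⊆ Finset.range (h j)) {g : E} (hg : g ∈ tower e h j)
    (hM : BoundedBy W e h w M g) :
    ‖mixError W r h j m (floors e j D) g‖ ≤
      M * (D.card * w j / r j + 2 * r j * w j + 2 * m * w j) := by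
  have hM0 := BoundedBy.nonneg S hM
  have hw := (S.width_pos j).le
  have hr2 := S.two_le j
  have hr1 := S.one_le_r j
  have hh := S.height_succ j
  have hw' : w j / r j = w (j + 1) := by
    rw [S.width_succ j]; have := S.r_pos j; field_simp
  obtain ⟨g₁, hg₁, g₂, rfl, hb₁, hb₂⟩ := S.exists_low_add_high hg hM (r j - 1)
  rw [show r j - 1 + 1 = r j by omega] at hg₁
  have d1 : D.filter (fun k => k + m < h j) ⊆ Finset.range (h j) :=
    (Finset.filter_subset _ _).trans hD
  have d2 : D.filter (fun k => ¬ k + m < h j) ⊆ Finset.range (h j) :=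
    (Finset.filter_subset _ _).trans hD
  rw [floors_filter_add j D fun k => k + m < h j, mixError_add_left, mixError_add_right]
  have b1 : ‖mixError W r h j m (floors e j (D.filter fun k => k + m < h j)) g₁‖ ≤
      D.card * (M * (w j / r j)) := by
    rw [floors, mixError_sum_left]
    calc _ ≤ (D.filter fun k => k + m < h j).card * (M * (w j / r j)) := by
          rw [← nsmul_eq_mul]
          refine (norm_sum_le_of_le _ fun k hk => ?_).trans_eq (by rw [Finset.sum_const])
          have hk' := (Finset.mem_filter.1 hk).2
          have key := S.inner_zpow_height (k := k + m) hk' hg₁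
          rw [mixError, zpow_add_apply, S.zpow_natCast_floor m hk', key]
          simp only [zpow_add_apply, S.zpow_natCast_floor m hk']
          rw [add_sub_cancel_left, hw']
          -- Only the last column remains: one floor of stage `j + 1`, of measure `w j / r j`.
          exact hb₁ _ _ _ (by omega)
      _ ≤ _ := by
          gcongr
          exact Finset.filter_subset _ _
  have b2 := S.norm_mixError_le (j := j) (m := m)
    (x := floors e j (D.filter fun k => k + m < h j)) (g := g₂) (b := r j * (M * w j)) (fun n => by
      refine (hb₂ _ d1 _).trans ?_
      gcongr
      omega)
  have b3 := S.norm_mixError_le (j := j) (m := m)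
    (x := floors e j (D.filter fun k => ¬ k + m < h j)) (g := g₁ + g₂) (b := m * (M * w j))
    (fun n => by
      refine (hM.norm_inner_floors_le _ d2).trans ?_
      gcongr
      exact card_filter_lt_add_le hD)
  calc _ ≤ D.card * (M * (w j / r j)) + 2 * (r j * (M * w j)) + 2 * (m * (M * w j)) :=
        (norm_add_le _ _).trans (add_le_add ((norm_add_le _ _).trans (add_le_add b1 b2)) b3)
    _ = _ := by ring

/-- A floor is a union of floors of any later tower. -/
theorem exists_floors_eq (S : IsStaircaseModel W one e r h B w) {i k : ℕ} (hk : k < h i) :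
    ∀ j, i ≤ j → ∃ D ⊆ Finset.range (h j), e i k = floors e j D ∧ D.card * w j = w i := by
  intro j hij
  induction j, hij using Nat.le_induction with
  | base => exact ⟨{k}, by simpa using hk, by simp [floors], by simp⟩
  | succ j hij ih =>
    obtain ⟨D, hD, he, hc⟩ := ih
    have hinj : Set.InjOn (fun p : ℕ × ℕ => B j p.1 + p.2)
        (Finset.range (r j) ×ˢ D : Finset (ℕ × ℕ)) := by
      rintro ⟨c, x⟩ hp ⟨c', x'⟩ hp' heq
      simp only [Finset.coe_product, Set.mem_prod, Finset.mem_coe, Finset.mem_range] at hp hp'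
      obtain ⟨h1, h2⟩ := S.base_add_inj hp.1 hp'.1 (Finset.mem_range.1 (hD hp.2))
        (Finset.mem_range.1 (hD hp'.2)) heq
      rw [h1, h2]
    refine ⟨(Finset.range (r j) ×ˢ D).image fun p => B j p.1 + p.2, ?_, ?_, ?_⟩
    · intro m hm
      obtain ⟨⟨c, x⟩, hp, rfl⟩ := Finset.mem_image.1 hm
      rw [Finset.mem_product] at hp
      have h1 := S.base_add_height_le j c (Finset.mem_range.1 hp.1)
      have h2 := Finset.mem_range.1 (hD hp.2)
      rw [Finset.mem_range]; simp only; omega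
    · rw [floors, Finset.sum_image hinj, Finset.sum_product_right, he, floors]
      exact Finset.sum_congr rfl fun x hx => S.cut j x (Finset.mem_range.1 (hD hx))
    · rw [Finset.card_image_of_injOn hinj, Finset.card_product, Finset.card_range, ← hc,
        S.width_succ j]
      push_cast; ring

end IsStaircaseModel

/-! ### Ergodicity and mixing along times near the heights -/

/-- Weak convergence of a bounded family can be tested on a set that spans a dense subspace. -/
theorem tendsto_inner_of_dense {E ι : Type*} [NormedAddCommGroup E] [InnerProductSpace ℂ E]
    {l : Filter ι} {u : ι → E} {v : E} {C : ℝ} (hC : ∀ᶠ n in l, ‖u n‖ ≤ C) {s : Set E}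
    (hs : (Submodule.span ℂ s).topologicalClosure = ⊤)
    (h : ∀ y ∈ s, Tendsto (fun n => inner ℂ (u n) y) l (𝓝 (inner ℂ v y))) (y : E) :
    Tendsto (fun n => inner ℂ (u n) y) l (𝓝 (inner ℂ v y)) := by
  have h1 : ∀ y ∈ Submodule.span ℂ s, Tendsto (fun n => inner ℂ (u n) y) l (𝓝 (inner ℂ v y)) := by
    intro y hy
    refine Submodule.span_induction h ?_ ?_ ?_ hy
    · simpa using tendsto_const_nhds
    · intro x y _ _ hx hy
      simp only [inner_add_right]
      exact hx.add hy
    · intro a x _ hx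
      simp only [inner_smul_right]
      exact hx.const_mul a
  have hd : Dense (Submodule.span ℂ s : Set E) := Submodule.dense_iff_topologicalClosure_eq_top.2 hs
  rw [Metric.tendsto_nhds]
  intro ε hε
  obtain ⟨y', hy', hyy⟩ := Metric.mem_closure_iff.1 (hd y) (ε / (2 * (|C| + ‖v‖ + 1)))
    (by positivity)
  rw [dist_eq_norm] at hyy
  filter_upwards [hC, Metric.tendsto_nhds.1 (h1 y' hy') (ε / 2) (by positivity)] with n hn1 hn2
  rw [dist_eq_norm] at hn2 ⊢
  have e1 : inner ℂ (u n) y - inner ℂ v y =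
      inner ℂ (u n) (y - y') - inner ℂ v (y - y') + (inner ℂ (u n) y' - inner ℂ v y') := by
    simp only [inner_sub_right]; ring
  rw [e1]
  have b1 : ‖inner ℂ (u n) (y - y')‖ ≤ |C| * ‖y - y'‖ :=
    (norm_inner_le_norm _ _).trans (by gcongr; exact hn1.trans (le_abs_self C))
  have b2 : ‖inner ℂ v (y - y')‖ ≤ ‖v‖ * ‖y - y'‖ := norm_inner_le_norm _ _
  have b3 : (|C| + ‖v‖ + 1) * ‖y - y'‖ < ε / 2 := by
    calc _ < (|C| + ‖v‖ + 1) * (ε / (2 * (|C| + ‖v‖ + 1))) := by gcongr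
      _ = ε / 2 := by field_simp
  calc _ ≤ |C| * ‖y - y'‖ + ‖v‖ * ‖y - y'‖ + ‖inner ℂ (u n) y' - inner ℂ v y'‖ :=
        (norm_add_le _ _).trans (add_le_add_left ((norm_sub_le _ _).trans (add_le_add b1 b2)) _)
    _ < ε := by nlinarith [norm_nonneg (y - y')]

namespace IsStaircaseModel

variable {E : Type*} [NormedAddCommGroup E] [InnerProductSpace ℂ E]
  {W : E ≃ₗᵢ[ℂ] E} {one : E} {e : ℕ → ℕ → E} {r h : ℕ → ℕ} {B : ℕ → ℕ → ℕ} {w : ℕ → ℝ}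

theorem inner_floor_one (S : IsStaircaseModel W one e r h B w) {j k : ℕ} (hk : k < h j) :
    inner ℂ (e j k) one = (w j : ℂ) := by
  rw [← inner_conj_symm, S.inner_one j k hk, Complex.conj_ofReal]

theorem norm_floor_sq (S : IsStaircaseModel W one e r h B w) {j k : ℕ} (hk : k < h j) :
    ‖e j k‖ ^ 2 = w j := by
  have := S.inner_floor j k k hk hk
  rw [if_pos rfl, inner_self_eq_norm_sq_to_K] at this
  exact Complex.ofReal_injective (by push_cast; exact this)

/-- For the indicator `x` of the tower, `⟨one, x⟩ = ‖x‖² = h w`, and Cauchy–Schwarz applies. -/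
theorem height_mul_width_le (S : IsStaircaseModel W one e r h B w) (j : ℕ) :
    h j * w j ≤ ‖one‖ ^ 2 := by
  have hw := S.width_pos j
  have hh : (0 : ℝ) < h j := by
    have := S.two_le_height' j; exact_mod_cast (by omega : 0 < h j)
  let x := floors e j (Finset.range (h j))
  have h1 : inner ℂ one x = (h j * w j : ℂ) := by
    simp only [x, floors]
    rw [inner_sum, Finset.sum_congr rfl fun k hk => S.inner_one j k (Finset.mem_range.1 hk)]
    simp
  have h2 : ‖x‖ ^ 2 = h j * w j := by
    have : inner ℂ x x = (h j * w j : ℂ) := by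
      simp only [x, floors]
      rw [sum_inner, Finset.sum_congr rfl fun k hk => ?_, Finset.sum_const, Finset.card_range,
        nsmul_eq_mul]
      rw [inner_sum, Finset.sum_eq_single_of_mem k hk, S.inner_floor j k k (Finset.mem_range.1 hk)
        (Finset.mem_range.1 hk), if_pos rfl]
      intro l hl hne
      rw [S.inner_floor j k l (Finset.mem_range.1 hk) (Finset.mem_range.1 hl), if_neg hne.symm]
    rw [inner_self_eq_norm_sq_to_K] at this
    exact Complex.ofReal_injective (by push_cast; exact this)
  have h3 := norm_inner_le_norm (𝕜 := ℂ) one x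
  rw [h1] at h3
  have h4 : ‖(h j * w j : ℂ)‖ = h j * w j := by
    rw [norm_mul, Complex.norm_natCast, Complex.norm_real, Real.norm_of_nonneg hw.le]
  rw [h4, ← h2] at h3
  rw [← h2]
  have hx : 0 < ‖x‖ := by
    rcases (norm_nonneg x).eq_or_lt with h0 | h0
    · rw [← h0] at h2; nlinarith [mul_pos hh hw]
    · exact h0
  have : ‖x‖ ≤ ‖one‖ := by nlinarith
  gcongr

theorem two_mul_height_le (S : IsStaircaseModel W one e r h B w) (j : ℕ) :
    2 * h j ≤ h (j + 1) := by
  have h1 := S.two_le j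
  have := S.base_add_le j (r j - 1) 0 (by omega) (by omega)
  rw [S.base_zero] at this
  rw [S.height_succ]; omega

theorem le_height (S : IsStaircaseModel W one e r h B w) (j : ℕ) : j ≤ h j := by
  induction j with
  | zero => omega
  | succ j ih =>
    have := S.two_mul_height_le j
    have := S.two_le_height' j
    omega

theorem dense_floors (S : IsStaircaseModel W one e r h B w) :
    Dense (Submodule.span ℂ {x | ∃ j k, k < h j ∧ x = e j k} : Set E) :=
  Submodule.dense_iff_topologicalClosure_eq_top.2 S.dense

theorem eq_zero_of_inner_floor (S : IsStaircaseModel W one e r h B w) {x : E}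
    (hx : ∀ j k, k < h j → inner ℂ (e j k) x = 0) : x = 0 := by
  have h1 := tendsto_inner_of_dense (l := (⊤ : Filter ℕ)) (u := fun _ => x) (v := 0) (C := ‖x‖)
    (by simp) S.dense (by
      rintro _ ⟨j, k, hk, rfl⟩
      rw [← inner_conj_symm, hx j k hk]
      simp) x
  have h2 : inner ℂ x x = 0 := by
    have := tendsto_nhds_unique h1 tendsto_const_nhds
    simpa using this.symm
  exact inner_self_eq_zero.1 h2

/-- Ergodicity. -/
theorem mem_span_one_of_map_eq (S : IsStaircaseModel W one e r h B w) {x : E} (hx : W x = x) :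
    x ∈ (ℂ ∙ one) := by
  have hx' : ∀ n : ℤ, (W ^ n) x = x := zpow_apply_of_map_eq hx
  -- An invariant vector pairs equally with all floors of a tower. Cutting then makes these values
  -- proportional to the widths, exactly as for a constant.
  have h1 : ∀ j k, k < h j → inner ℂ (e j k) x = inner ℂ (e j 0) x := fun j k hk => by
    have := S.zpow_natCast_floor (j := j) (k := 0) k (by omega)
    rw [zero_add] at this
    rw [← this, ← LinearIsometryEquiv.inner_map_map (W ^ (k : ℤ)) (e j 0), hx']
  have h2 : ∀ j, inner ℂ (e j 0) x = r j * inner ℂ (e (j + 1) 0) x := fun j => by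
    have h3 := S.two_le_height' j
    rw [S.cut j 0 (by omega), sum_inner, Finset.sum_congr rfl fun c hc => h1 (j + 1) _ ?_]
    · simp
    · have := S.base_add_height_le j c (Finset.mem_range.1 hc)
      omega
  have hw : ∀ j, (w j : ℂ) ≠ 0 := fun j => by exact_mod_cast (S.width_pos j).ne'
  have hr : ∀ j, (r j : ℂ) ≠ 0 := fun j => by exact_mod_cast (S.r_pos j).ne'
  have h3 : ∀ j, inner ℂ (e j 0) x = inner ℂ (e 0 0) x / w 0 * w j := by
    intro j
    induction j with
    | zero => field_simp [hw 0]
    | succ j ih =>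
      have h4 : (w j : ℂ) = r j * w (j + 1) := by exact_mod_cast S.width_succ j
      rw [h2 j, h4] at ih
      have := hr j
      refine mul_left_cancel₀ this (ih.trans ?_)
      ring
  rw [Submodule.mem_span_singleton]
  refine ⟨inner ℂ (e 0 0) x / w 0, ?_⟩
  symm
  rw [← sub_eq_zero]
  refine S.eq_zero_of_inner_floor fun j k hk => ?_
  rw [inner_sub_right, inner_smul_right, S.inner_floor_one hk, h1 j k hk, h3 j, sub_self]

/-- The coefficient of the constant part. -/
def mean (one x : E) : ℂ := inner ℂ one x / ‖one‖ ^ 2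

theorem inner_one_sub_mean (S : IsStaircaseModel W one e r h B w) (x : E) :
    inner ℂ one (x - mean one x • one) = 0 := by
  have : (‖one‖ : ℂ) ≠ 0 := by simpa using S.one_ne
  rw [inner_sub_right, inner_smul_right, inner_self_eq_norm_sq_to_K, mean]
  change inner ℂ one x - inner ℂ one x / (‖one‖ : ℂ) ^ 2 * (‖one‖ : ℂ) ^ 2 = 0
  rw [div_mul_cancel₀ _ (pow_ne_zero 2 this), sub_self]

theorem norm_zpow_apply (W : E ≃ₗᵢ[ℂ] E) (n : ℤ) (x : E) : ‖(W ^ n) x‖ = ‖x‖ :=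
  (W ^ n).norm_map x

variable [CompleteSpace E]

theorem tendsto_average (S : IsStaircaseModel W one e r h B w) (x : E) :
    Tendsto (fun n : ℕ => (n : ℂ)⁻¹ • ∑ c ∈ Finset.range n, (W ^ (c : ℤ)) x) atTop
      (𝓝 (mean one x • one)) := by
  let A : E →L[ℂ] E := (W.toContinuousLinearEquiv : E →L[ℂ] E)
  have hA : ∀ x, A x = W x := fun _ => rfl
  have h1 := A.tendsto_birkhoffAverage_orthogonalProjection
    (ContinuousLinearMap.opNorm_le_bound _ zero_le_one fun x => by rw [hA]; simp) x
  have hit : ∀ c : ℕ, A^[c] x = (W ^ (c : ℤ)) x := by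
    intro c
    induction c with
    | zero => simp
    | succ c ih =>
      rw [Function.iterate_succ_apply', ih, Nat.cast_succ, add_comm, zpow_add_apply, zpow_one]
      rfl
  have h2 : (fun n : ℕ => (n : ℂ)⁻¹ • ∑ c ∈ Finset.range n, (W ^ (c : ℤ)) x) =
      fun n => birkhoffAverage ℂ A _root_.id n x := by
    funext n
    simp only [birkhoffAverage, birkhoffSum, hit, id]
  rw [h2]
  let K := A.eqLocus (1 : E →L[ℂ] E)
  let p : E := K.orthogonalProjectionOnto x
  have hpK : p ∈ K := (K.orthogonalProjectionOnto x).2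
  have hp1 : p ∈ (ℂ ∙ one) := S.mem_span_one_of_map_eq hpK
  obtain ⟨c, hc⟩ := Submodule.mem_span_singleton.1 hp1
  have hK1 : one ∈ K := S.map_one
  have hp2 : inner ℂ one (x - p) = 0 :=
    (Submodule.mem_orthogonal _ _).1 (Submodule.sub_starProjection_mem_orthogonal (K := K) x) _ hK1
  have hc' : p = mean one x • one := by
    have h3 := S.inner_one_sub_mean x
    rw [inner_sub_right, sub_eq_zero] at h3 hp2
    have h4 := hp2.symm.trans h3
    rw [← hc, inner_smul_right, inner_smul_right] at h4
    rw [← hc, mul_right_cancel₀ (inner_self_ne_zero.2 S.one_ne) h4]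
  rw [← hc']
  exact h1

/-- Weak mixing along times slightly larger than the heights. -/
theorem tendsto_inner_zpow (S : IsStaircaseModel W one e r h B w)
    (hr : Tendsto (fun j => (r j : ℝ)) atTop atTop)
    (hrw : Tendsto (fun j => (r j : ℝ) * w j) atTop (𝓝 0)) {q m : ℕ → ℕ}
    (hq : Tendsto q atTop atTop) (hm : Tendsto (fun k => (m k : ℝ) * w (q k)) atTop (𝓝 0)) (x y : E) :
    Tendsto (fun k => inner ℂ ((W ^ (h (q k) + m k : ℤ)) x) y) atTop
      (𝓝 (inner ℂ (mean one x • one) y)) := by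
  have hone : ∀ n : ℤ, (W ^ n) one = one := zpow_apply_of_map_eq S.map_one
  have symm : ∀ x y : E, inner ℂ (mean one x • one) y = inner ℂ x (mean one y • one) := by
    intro x y
    rw [inner_smul_left, inner_smul_right, mean, mean, map_div₀, inner_conj_symm, map_pow,
      Complex.conj_ofReal]
    ring
  -- floors against floors
  have key : ∀ i k, k < h i → ∀ i' l, l < h i' →
      Tendsto (fun n => inner ℂ ((W ^ (h (q n) + m n : ℤ)) (e i k)) (e i' l)) atTop
        (𝓝 (inner ℂ (e i k) (mean one (e i' l) • one))) := by
    intro i k hk i' l hl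
    have t1 : Tendsto (fun n => mixError W r h (q n) (m n) (e i k) (e i' l)) atTop (𝓝 0) := by
      have hb : Tendsto (fun n => 1 * (w i / r (q n) + 2 * r (q n) * w (q n) +
          2 * m n * w (q n))) atTop (𝓝 0) := by
        have b1 : Tendsto (fun n => w i / r (q n)) atTop (𝓝 0) :=
          (hr.comp hq).const_div_atTop (w i)
        have b2 := (hrw.comp hq).const_mul 2
        have b3 := hm.const_mul 2
        have := (b1.add b2).add b3
        simp only [mul_zero, add_zero] at this
        refine this.congr fun n => ?_
        simp only [Function.comp]; ring
      refine squeeze_zero_norm' ?_ hb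
      filter_upwards [hq.eventually_ge_atTop (max i i')] with n hn
      obtain ⟨D, hD, he, hc⟩ := S.exists_floors_eq hk (q n) ((le_max_left _ _).trans hn)
      rw [← hc, he]
      exact S.norm_mixError_floors_le hD
        (S.monotone_tower ((le_max_right _ _).trans hn) (floor_mem_tower hl)) (S.boundedBy_floor hl)
    -- The mean ergodic theorem for the test vector. The term `c = 0` is removed because the shifts
    -- run from `1` to `r - 1`. The excess `m` enters only through the isometry `W ^ m` on the other
    -- side.
    have t2 : Tendsto (fun n => (r (q n) : ℂ)⁻¹ • ∑ c ∈ Finset.range (r (q n)), (W ^ (c : ℤ)) (e i' l) -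
        (r (q n) : ℂ)⁻¹ • e i' l - mean one (e i' l) • one) atTop (𝓝 0) := by
      have hrn : Tendsto (fun n => r (q n)) atTop atTop :=
        tendsto_natCast_atTop_iff.1 (hr.comp hq)
      have a1 := (S.tendsto_average (e i' l)).comp hrn
      have a2 : Tendsto (fun n => (r (q n) : ℂ)⁻¹ • e i' l) atTop (𝓝 0) := by
        have := ((tendsto_inv₀_cobounded (α := ℂ)).comp
          (tendsto_natCast_atTop_cobounded.comp hrn)).smul_const (e i' l)
        rw [zero_smul] at this
        exact this
      have := (a1.sub a2).sub_const (mean one (e i' l) • one)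
      simp only [sub_zero, sub_self] at this
      exact this
    have t3 : Tendsto (fun n => inner ℂ ((W ^ (m n : ℤ)) (e i k))
        ((r (q n) : ℂ)⁻¹ • ∑ c ∈ Finset.range (r (q n)), (W ^ (c : ℤ)) (e i' l) -
        (r (q n) : ℂ)⁻¹ • e i' l - mean one (e i' l) • one)) atTop (𝓝 0) := by
      have hb := t2.norm.const_mul ‖e i k‖
      rw [norm_zero, mul_zero] at hb
      refine squeeze_zero_norm (fun n => ?_) hb
      exact (norm_inner_le_norm _ _).trans (by rw [norm_zpow_apply])
    have t4 := (t1.add t3).add_const (inner ℂ (e i k) (mean one (e i' l) • one))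
    rw [add_zero, zero_add] at t4
    refine t4.congr fun n => ?_
    have hr2 := S.two_le (q n)
    obtain ⟨p, hp⟩ : ∃ p, r (q n) = p + 1 := ⟨r (q n) - 1, by omega⟩
    have e1 : ∀ c : ℕ, inner ℂ ((W ^ (-(c + 1 : ℕ) + m n : ℤ)) (e i k)) (e i' l) =
        inner ℂ ((W ^ (m n : ℤ)) (e i k)) ((W ^ ((c + 1 : ℕ) : ℤ)) (e i' l)) := fun c => by
      rw [inner_zpow_right, ← zpow_add_apply]
    have e2 : inner ℂ ((W ^ (m n : ℤ)) (e i k)) one = inner ℂ (e i k) one := by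
      rw [← hone (m n), LinearIsometryEquiv.inner_map_map, hone]
    simp only [mixError, e1]
    rw [hp, Nat.add_sub_cancel, Finset.sum_range_succ', smul_add, inner_sub_right, inner_sub_right,
      inner_add_right, inner_smul_right, inner_smul_right, inner_smul_right, inner_smul_right,
      inner_smul_right, e2, inner_sum, Nat.cast_zero, zpow_zero]
    change _ + ((_ + _ * inner ℂ _ (e i' l) - _) - _) + _ = _
    ring
  -- extension in the second variable, then in the first one
  have key2 : ∀ i k, k < h i → ∀ y,
      Tendsto (fun n => inner ℂ ((W ^ (h (q n) + m n : ℤ)) (e i k)) y) atTop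
        (𝓝 (inner ℂ (mean one (e i k) • one) y)) := by
    intro i k hk
    refine tendsto_inner_of_dense (C := ‖e i k‖)
      (Eventually.of_forall fun n => (norm_zpow_apply _ _ _).le) S.dense ?_
    rintro _ ⟨i', l, hl, rfl⟩
    rw [symm]
    exact key i k hk i' l hl
  have key3 := tendsto_inner_of_dense (l := atTop)
    (u := fun n => (W ^ (-(h (q n) + m n : ℤ))) y) (v := mean one y • one) (C := ‖y‖)
    (Eventually.of_forall fun n => (norm_zpow_apply _ _ _).le) S.dense (by
      rintro _ ⟨i, k, hk, rfl⟩
      have := (Complex.continuous_conj.tendsto _).comp (key2 i k hk y)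
      rw [symm, inner_conj_symm] at this
      refine this.congr fun n => ?_
      rw [← inner_zpow_right, Function.comp, inner_conj_symm]) x
  have := (Complex.continuous_conj.tendsto _).comp key3
  rw [inner_conj_symm, ← symm] at this
  refine this.congr fun n => ?_
  rw [Function.comp, inner_conj_symm, inner_zpow_right, neg_neg]

end IsStaircaseModel

/-! ### Almost orthogonality of the vectors `r W ^ h (1 - W) x` -/

theorem norm_sq_sum_le_of_almost_orthogonal {F : Type*} [NormedAddCommGroup F]
    [InnerProductSpace ℂ F] {b : ℕ → F} {J : Finset ℕ} {A C : ℝ} (hA : ∀ j ∈ J, ‖b j‖ ^ 2 ≤ A)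
    (hC : ∀ i ∈ J, ∀ j ∈ J, i + 2 ≤ j → ‖inner ℂ (b j) (b i)‖ ≤ C) (hC0 : 0 ≤ C) :
    ‖∑ j ∈ J, b j‖ ^ 2 ≤ J.card ^ 2 * C + 3 * J.card * A := by
  -- Pairs at distance at least 2 cost `C`; the at most three remaining partners of each index cost
  -- `A` in addition.
  have hpair : ∀ i ∈ J, ∀ j ∈ J, ‖inner ℂ (b i) (b j)‖ ≤
      C + if j ∈ ({i - 1, i, i + 1} : Finset ℕ) then A else 0 := by
    intro i hi j hj
    have hA0 : 0 ≤ A := (sq_nonneg _).trans (hA i hi)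
    split_ifs with hij
    · have h1 := norm_inner_le_norm (𝕜 := ℂ) (b i) (b j)
      nlinarith [hA i hi, hA j hj, sq_nonneg (‖b i‖ - ‖b j‖)]
    · rw [add_zero]
      simp only [Finset.mem_insert, Finset.mem_singleton, not_or] at hij
      rcases le_or_gt (i + 2) j with h1 | h1
      · rw [← inner_conj_symm, RCLike.norm_conj]; exact hC i hi j hj h1
      · exact hC j hj i hi (by omega)
  have h1 : (‖∑ j ∈ J, b j‖ ^ 2 : ℝ) = ‖inner ℂ (∑ j ∈ J, b j) (∑ j ∈ J, b j)‖ := by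
    rw [inner_self_eq_norm_sq_to_K, norm_pow]
    simp
  rw [h1, sum_inner]
  calc _ ≤ ∑ i ∈ J, (J.card * C + 3 * A) := by
        refine norm_sum_le_of_le _ fun i hi => ?_
        have hA0 : 0 ≤ A := (sq_nonneg _).trans (hA i hi)
        rw [inner_sum]
        refine (norm_sum_le_of_le _ (hpair i hi)).trans ?_
        rw [Finset.sum_add_distrib, Finset.sum_const, nsmul_eq_mul, ← Finset.sum_filter,
          Finset.sum_const, nsmul_eq_mul]
        gcongr
        have : (J.filter fun j => j ∈ ({i - 1, i, i + 1} : Finset ℕ)).card ≤ 3 :=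
          (Finset.card_le_card fun j hj => (Finset.mem_filter.1 hj).2).trans Finset.card_le_three
        exact_mod_cast this
    _ = _ := by rw [Finset.sum_const, nsmul_eq_mul]; ring

namespace IsStaircaseModel

variable {E : Type*} [NormedAddCommGroup E] [InnerProductSpace ℂ E]
  {W : E ≃ₗᵢ[ℂ] E} {one : E} {e : ℕ → ℕ → E} {r h : ℕ → ℕ} {B : ℕ → ℕ → ℕ} {w : ℕ → ℝ}

/-- The vector `r W ^ h (1 - W) x`. -/
def bump (W : E ≃ₗᵢ[ℂ] E) (r h : ℕ → ℕ) (j : ℕ) (x : E) : E := (r j : ℂ) • diff W (h j) x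

theorem BoundedBy.diff {M : ℝ} {x : E} (hx : BoundedBy W e h w M x) (n : ℤ) :
    BoundedBy W e h w (2 * M) (diff W n x) := by
  rw [two_mul]
  exact (hx.zpow n).sub (hx.zpow (n + 1))

theorem BoundedBy.bump {M : ℝ} {x : E} (hx : BoundedBy W e h w M x) (j : ℕ) :
    BoundedBy W e h w (r j * (2 * M)) (bump W r h j x) := by
  have := (hx.diff (h j)).smul (r j : ℂ)
  rwa [Complex.norm_natCast] at this

theorem norm_bump_le (j : ℕ) (x : E) : ‖bump W r h j x‖ ≤ 2 * r j * ‖x‖ := by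
  rw [bump, norm_smul, Complex.norm_natCast, diff]
  have := norm_sub_le ((W ^ (h j : ℤ)) x) ((W ^ ((h j : ℤ) + 1)) x)
  rw [norm_zpow_apply, norm_zpow_apply] at this
  calc _ ≤ (r j : ℝ) * (‖x‖ + ‖x‖) := by gcongr
    _ = _ := by ring

theorem zpow_bump (j : ℕ) (n : ℤ) (x : E) : (W ^ n) (bump W r h j x) = bump W r h j ((W ^ n) x) := by
  rw [bump, bump, map_smul, diff, diff, map_sub]
  simp only [← zpow_add_apply]
  congr 4 <;> ring

theorem inner_bump (j : ℕ) (x g : E) :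
    inner ℂ (bump W r h j x) g =
      inner ℂ ((W ^ (-(r j - 1 : ℕ) : ℤ)) x - x) g + diffError W r h j x g := by
  rw [bump, inner_smul_left, diffError, map_natCast]; ring

/-- Against a test vector of the tower with bound `M` independent of `r`, the large factor `r` of
`bump` disappears: the main term and the error are both bounded. -/
theorem norm_inner_bump_zpow_floors_le (S : IsStaircaseModel W one e r h B w) {M : ℝ} {j s : ℕ}
    {D : Finset ℕ} (hD : D ⊆ Finset.range (h j)) (hs : s + 1 ≤ r j) {g : E} (hg : g ∈ tower e h j)
    (hM : BoundedBy W e h w M g) (hrw : r j ^ 2 * w j ≤ 1) :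
    ‖inner ℂ (bump W r h j ((W ^ (s : ℤ)) (floors e j D))) g‖ ≤ M * (4 * (D.card * w j) + 12) := by
  have hM0 := BoundedBy.nonneg S hM
  have hw := (S.width_pos j).le
  have hr2 : (2 : ℝ) ≤ r (j + 1) := by exact_mod_cast S.two_le (j + 1)
  rw [inner_bump]
  have b1 := S.norm_diffError_floors_le hD hs hg hM
  have b2 : ‖inner ℂ ((W ^ (-(r j - 1 : ℕ) : ℤ)) ((W ^ (s : ℤ)) (floors e j D)) -
      (W ^ (s : ℤ)) (floors e j D)) g‖ ≤ 2 * (D.card * (M * w j)) := by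
    rw [inner_sub_left, ← zpow_add_apply, two_mul]
    exact (norm_sub_le _ _).trans (add_le_add (hM.norm_inner_floors_le _ hD)
      (hM.norm_inner_floors_le _ hD))
  have b3 : 4 * (D.card * w j) / r (j + 1) ≤ 2 * (D.card * w j) := by
    rw [div_le_iff₀ (by linarith)]
    have : 0 ≤ D.card * w j := by positivity
    nlinarith
  calc _ ≤ 2 * (D.card * (M * w j)) + M * (4 * (D.card * w j) / r (j + 1) + 12 * r j ^ 2 * w j) :=
        (norm_add_le _ _).trans (add_le_add b2 b1)
    _ ≤ 2 * (D.card * (M * w j)) + M * (2 * (D.card * w j) + 12) := by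
        gcongr
        linarith
    _ = _ := by ring

/-- Two cuts divide the width by `r i * r (i + 1)`, which is comparable to `r i ^ 2`. This is the
reason for the distance 2 between indices. -/
theorem height_mul_width_add_two_le (S : IsStaircaseModel W one e r h B w) {i j : ℕ}
    (hij : i + 2 ≤ j) : h i * w j ≤ 2 * ‖one‖ ^ 2 / r i ^ 2 := by
  have h1 := S.height_mul_width_le i
  have h2 := S.antitone_width hij
  have hr := S.r_pos i
  have hr' : (r i : ℝ) ≤ 2 * r (i + 1) := by exact_mod_cast S.le_succ i
  have hw := (S.width_pos (i + 2)).le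
  rw [S.width_succ i, S.width_succ (i + 1)] at h1
  rw [le_div_iff₀ (by positivity)]
  calc h i * w j * r i ^ 2 ≤ h i * w (i + 2) * r i ^ 2 := by gcongr
    _ = h i * (r i * (r i * w (i + 2))) := by ring
    _ ≤ h i * (r i * (2 * r (i + 1) * w (i + 2))) := by gcongr
    _ = 2 * (h i * (r i * (r (i + 1) * w (i + 1 + 1)))) := by ring
    _ ≤ _ := by gcongr

/-- The vectors `bump W r h j x` are almost orthogonal. -/
theorem norm_inner_bump_bump_le (S : IsStaircaseModel W one e r h B w) {i₀ k₀ i j : ℕ}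
    (hk₀ : k₀ < h i₀) (hi : i₀ ≤ i) (hij : i + 2 ≤ j) (hr : r i = r j)
    (hwi : r i ^ 2 * w i ≤ 1) (hwj : r j ^ 3 * w j ≤ 1) :
    ‖inner ℂ (bump W r h j (e i₀ k₀)) (bump W r h i (e i₀ k₀))‖ ≤
      32 * ‖one‖ ^ 2 + 24 * w i₀ + 48 := by
  have hr0 := S.r_pos i
  have hr1 := S.one_le_r i
  have hr2 := S.two_le i
  have hj0 := (S.width_pos j).le
  have hw0 := (S.width_pos i₀).le
  set x := e i₀ k₀ with hx
  obtain ⟨Di, hDi, hei, hci⟩ := S.exists_floors_eq hk₀ i hi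
  obtain ⟨D, hD, he, hc⟩ := S.exists_floors_eq hk₀ j (by omega)
  have d1 : D.filter (fun k => k + (h i + 1) < h j) ⊆ Finset.range (h j) :=
    (Finset.filter_subset _ _).trans hD
  have d2 : D.filter (fun k => ¬ k + (h i + 1) < h j) ⊆ Finset.range (h j) :=
    (Finset.filter_subset _ _).trans hD
  -- `W ^ h i (1 - W)` keeps `g` inside the tower `j`, so it can serve as a test vector there. The
  -- remainder `β` comes from the top `h i + 1` floors only.
  set g := bump W r h i (floors e j (D.filter fun k => k + (h i + 1) < h j)) with hg
  set β := bump W r h i (floors e j (D.filter fun k => ¬ k + (h i + 1) < h j)) with hβ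
  have hsum : bump W r h i x = g + β := by
    rw [hx, he, floors_filter_add j D fun k => k + (h i + 1) < h j, bump, diff_add, smul_add]; rfl
  have hgt : g ∈ tower e h j := by
    refine Submodule.smul_mem _ _ ?_
    rw [diff, floors, map_sum, map_sum]
    refine Submodule.sub_mem _ (Submodule.sum_mem _ fun k hk => ?_)
      (Submodule.sum_mem _ fun k hk => ?_)
    · have := (Finset.mem_filter.1 hk).2
      rw [S.zpow_natCast_floor _ (by omega)]
      exact floor_mem_tower (by omega)
    · have := (Finset.mem_filter.1 hk).2
      rw [← Nat.cast_succ, S.zpow_natCast_floor _ this]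
      exact floor_mem_tower this
  have hbg : BoundedBy W e h w (r i * (2 * 1)) g := (S.boundedBy_floors d1).bump i
  have hhi : (h i : ℝ) + 1 ≤ 2 * h i := by
    have := S.two_le_height' i
    have : (2 : ℝ) ≤ h i := by exact_mod_cast this
    linarith
  -- The remainder has mass `O(r i * h i * w j) = O(1 / r i)`, which compensates the bound `2 r j`
  -- for `bump W r h j x`.
  have hbβ : ∀ z N, BoundedBy W e h w N z → ‖inner ℂ z β‖ ≤ 8 * N * ‖one‖ ^ 2 / r i := by
    intro z N hz
    have hN := BoundedBy.nonneg S hz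
    have b := hz.norm_inner_floors_le (h i) d2
    have b' := hz.norm_inner_floors_le (h i + 1) d2
    have hcard : ((D.filter fun k => ¬ k + (h i + 1) < h j).card : ℝ) ≤ h i + 1 := by
      exact_mod_cast card_filter_lt_add_le hD
    have h2 := S.height_mul_width_add_two_le hij
    rw [← inner_conj_symm, RCLike.norm_conj, hβ, bump, inner_smul_left, map_natCast, norm_mul,
      Complex.norm_natCast, diff, inner_sub_left]
    calc _ ≤ r i * ((h i + 1) * (N * w j) + (h i + 1) * (N * w j)) := by
          gcongr
          refine (norm_sub_le _ _).trans (add_le_add (b.trans ?_) (b'.trans ?_)) <;> gcongr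
      _ = (h i + 1) * (r i * N * w j) * 2 := by ring
      _ ≤ 2 * h i * (r i * N * w j) * 2 := by gcongr
      _ = 4 * r i * N * (h i * w j) := by ring
      _ ≤ 4 * r i * N * (2 * ‖one‖ ^ 2 / r i ^ 2) := by gcongr
      _ = _ := by field_simp; ring
  have hbx : BoundedBy W e h w 1 x := S.boundedBy_floor hk₀
  have hxi : x ∈ tower e h i := S.monotone_tower hi (floor_mem_tower hk₀)
  have c1 : ‖inner ℂ (bump W r h j x) β‖ ≤ 16 * ‖one‖ ^ 2 := by
    refine (hbβ _ _ (hbx.bump j)).trans_eq ?_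
    rw [← hr]; field_simp; ring
  have c2 : ‖inner ℂ ((W ^ (-(r j - 1 : ℕ) : ℤ)) x - x) β‖ ≤ 16 * ‖one‖ ^ 2 := by
    refine (hbβ _ _ ((hbx.zpow _).sub hbx)).trans ?_
    rw [div_le_iff₀ hr0]
    nlinarith [sq_nonneg ‖one‖]
  have c3 : ‖inner ℂ ((W ^ (-(r j - 1 : ℕ) : ℤ)) x - x) (bump W r h i x)‖ ≤
      2 * (4 * w i₀ + 12) := by
    have e1 := S.norm_inner_bump_zpow_floors_le hDi (s := 0) (by omega) hxi hbx hwi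
    have e2 := S.norm_inner_bump_zpow_floors_le hDi (s := r j - 1) (by omega) hxi hbx hwi
    rw [← hei, ← hx, hci] at e1 e2
    -- The power of `W` is moved to the other argument, where it becomes the positive shift `s = r j
    -- - 1`.
    rw [← zpow_bump, ← inner_conj_symm, RCLike.norm_conj, inner_zpow_right] at e2
    rw [Nat.cast_zero, zpow_zero, ← inner_conj_symm, RCLike.norm_conj] at e1
    change ‖inner ℂ x (bump W r h i x)‖ ≤ _ at e1
    rw [inner_sub_left]
    refine (norm_sub_le _ _).trans ?_
    linarith
  have c4 : ‖diffError W r h j x g‖ ≤ 16 * w i₀ + 24 := by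
    have e1 := S.norm_diffError_floors_le hD (s := 0) (by omega) hgt hbg
    rw [← he, ← hx, hc] at e1
    change ‖diffError W r h j x g‖ ≤ _ at e1
    refine e1.trans ?_
    have hrj : (r j : ℝ) ≤ 2 * r (j + 1) := by exact_mod_cast S.le_succ j
    have hrj1 := S.r_pos (j + 1)
    -- The test vector `g` has bound `2 r j`. This factor is absorbed by `1 / r (j + 1)` in the
    -- first error term and by `r ^ 3 w ≤ 1` in the second.
    have f1 : 4 * w i₀ / r (j + 1) * r j ≤ 8 * w i₀ := by
      rw [div_mul_eq_mul_div, div_le_iff₀ hrj1]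
      nlinarith
    rw [hr]
    calc _ = 2 * (4 * w i₀ / r (j + 1) * r j) + 24 * (r j ^ 3 * w j) := by ring
      _ ≤ 2 * (8 * w i₀) + 24 * 1 := by gcongr
      _ = _ := by ring
  have hfin : inner ℂ (bump W r h j x) (bump W r h i x) =
      inner ℂ (bump W r h j x) β + inner ℂ ((W ^ (-(r j - 1 : ℕ) : ℤ)) x - x) (bump W r h i x) -
        inner ℂ ((W ^ (-(r j - 1 : ℕ) : ℤ)) x - x) β + diffError W r h j x g := by
    have e1 := inner_bump (W := W) (r := r) (h := h) j x g
    rw [hsum, inner_add_right, inner_add_right, e1]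
    ring
  rw [hfin]
  refine (norm_add_le _ _).trans ?_
  have f1 := norm_sub_le (inner ℂ (bump W r h j x) β + inner ℂ ((W ^ (-(r j - 1 : ℕ) : ℤ)) x - x)
    (bump W r h i x)) (inner ℂ ((W ^ (-(r j - 1 : ℕ) : ℤ)) x - x) β)
  have f2 := norm_add_le (inner ℂ (bump W r h j x) β) (inner ℂ ((W ^ (-(r j - 1 : ℕ) : ℤ)) x - x)
    (bump W r h i x))
  linarith

end IsStaircaseModel

/-! ### Averages over blocks of equal cutting parameters -/

theorem norm_average_le_of_almost_orthogonal {F : Type*} [NormedAddCommGroup F]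
    [InnerProductSpace ℂ F] {b : ℕ → F} {J : Finset ℕ} {A C : ℝ} (hJ : 0 < J.card)
    (hA : ∀ j ∈ J, ‖b j‖ ^ 2 ≤ J.card * A)
    (hC : ∀ i ∈ J, ∀ j ∈ J, i + 2 ≤ j → ‖inner ℂ (b j) (b i)‖ ≤ C) (hC0 : 0 ≤ C) :
    ‖(J.card : ℂ)⁻¹ • ∑ j ∈ J, b j‖ ≤ C + 3 * A + 1 := by
  have hN : (0 : ℝ) < J.card := by exact_mod_cast hJ
  have h1 := norm_sq_sum_le_of_almost_orthogonal hA hC hC0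
  set a := ‖(J.card : ℂ)⁻¹ • ∑ j ∈ J, b j‖ with ha
  have h2 : ‖∑ j ∈ J, b j‖ = J.card * a := by
    rw [ha, norm_smul, norm_inv, Complex.norm_natCast, mul_inv_cancel_left₀ hN.ne']
  rw [h2] at h1
  have h3 : a ^ 2 ≤ C + 3 * A := by
    have : (J.card : ℝ) ^ 2 * a ^ 2 ≤ J.card ^ 2 * (C + 3 * A) := by nlinarith
    exact le_of_mul_le_mul_left this (by positivity)
  nlinarith [sq_nonneg (a - 1)]

/-- The filter of the pairs `(k, j)` with `j ∈ J k` and `k → ∞`. -/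
def blockFilter (J : ℕ → Finset ℕ) : Filter (ℕ × ℕ) :=
  comap Prod.fst atTop ⊓ 𝓟 {p | p.2 ∈ J p.1}

theorem eventually_blockFilter {J : ℕ → Finset ℕ} {p : ℕ × ℕ → Prop} :
    (∀ᶠ x in blockFilter J, p x) ↔ ∀ᶠ k in atTop, ∀ j ∈ J k, p (k, j) := by
  rw [blockFilter, eventually_inf_principal, eventually_comap]
  exact eventually_congr (Eventually.of_forall fun k =>
    ⟨fun H j hj => H (k, j) rfl hj, by rintro H ⟨k', j⟩ rfl hj; exact H j hj⟩)

theorem tendsto_average_of_blockFilter {J : ℕ → Finset ℕ} (hJ : ∀ k, 0 < (J k).card)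
    {a : ℕ × ℕ → ℂ} {L : ℂ} (ha : Tendsto a (blockFilter J) (𝓝 L)) :
    Tendsto (fun k => ((J k).card : ℂ)⁻¹ * ∑ j ∈ J k, a (k, j)) atTop (𝓝 L) := by
  rw [Metric.tendsto_nhds] at ha ⊢
  intro ε hε
  filter_upwards [eventually_blockFilter.1 (ha (ε / 2) (by positivity))] with k hk
  have hN : (0 : ℝ) < (J k).card := by exact_mod_cast hJ k
  have hN' : ((J k).card : ℂ) ≠ 0 := by exact_mod_cast hN.ne'
  have e1 : ((J k).card : ℂ)⁻¹ * ∑ j ∈ J k, a (k, j) - L =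
      ((J k).card : ℂ)⁻¹ * ∑ j ∈ J k, (a (k, j) - L) := by
    rw [Finset.sum_sub_distrib, Finset.sum_const, nsmul_eq_mul, mul_sub, inv_mul_cancel_left₀ hN']
  rw [dist_eq_norm, e1, norm_mul, norm_inv, Complex.norm_natCast]
  calc _ ≤ ((J k).card : ℝ)⁻¹ * ((J k).card * (ε / 2)) := by
        gcongr
        rw [← nsmul_eq_mul]
        refine (norm_sum_le_of_le _ fun j hj => ?_).trans_eq (by rw [Finset.sum_const])
        have := hk j hj
        rw [dist_eq_norm] at this
        exact this.le
    _ = ε / 2 := by field_simp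
    _ < ε := by linarith

/-- Long blocks of equal cutting parameters that are slightly larger than an earlier height. -/
structure IsBlockSystem (r h : ℕ → ℕ) (q ρ : ℕ → ℕ) (J : ℕ → Finset ℕ) : Prop where
  le_index : ∀ k, k ≤ q k
  height_lt : ∀ k, h (q k) + 1 ≤ ρ k
  -- The excess of `ρ - 1` over the height is a vanishing fraction of it, so its product with the
  -- width tends to zero, as mixing requires.
  le_height : ∀ k, (ρ k : ℝ) ≤ 1 + (1 + 1 / (k + 1)) * h (q k)
  mem : ∀ k, ∀ j ∈ J k, k ≤ j ∧ r j = ρ k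
  -- The fourth power is the order of `‖b ⊗ b‖²` for vectors `b` of norm `O(ρ)`.
  card : ∀ k, ρ k ^ 4 ≤ (J k).card

namespace IsBlockSystem

variable {r h : ℕ → ℕ} {q ρ : ℕ → ℕ} {J : ℕ → Finset ℕ}

theorem card_pos (hJ : IsBlockSystem r h q ρ J) (k : ℕ) : 0 < (J k).card :=
  lt_of_lt_of_le (pow_pos (by have := hJ.height_lt k; omega) 4) (hJ.card k)

theorem tendsto_snd (hJ : IsBlockSystem r h q ρ J) :
    Tendsto Prod.snd (blockFilter J) atTop := by
  rw [tendsto_atTop]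
  intro n
  rw [eventually_blockFilter]
  filter_upwards [eventually_ge_atTop n] with k hk j hj
  exact hk.trans (hJ.mem k j hj).1

theorem tendsto_fst : Tendsto Prod.fst (blockFilter J) atTop :=
  tendsto_comap.mono_left inf_le_left

theorem eventually_forall_mem (hJ : IsBlockSystem r h q ρ J) {p : ℕ → Prop}
    (hp : ∀ᶠ j in atTop, p j) : ∀ᶠ k in atTop, ∀ j ∈ J k, p j :=
  eventually_blockFilter.1 (hJ.tendsto_snd.eventually hp)

end IsBlockSystem

/-! ### Weak limits of the block averages -/

namespace IsStaircaseModel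

variable {E : Type*} [NormedAddCommGroup E] [InnerProductSpace ℂ E]
  {W : E ≃ₗᵢ[ℂ] E} {one : E} {e : ℕ → ℕ → E} {r h : ℕ → ℕ} {B : ℕ → ℕ → ℕ} {w : ℕ → ℝ}

/-- The projection to the complement of the constants. -/
def centered (one x : E) : E := x - mean one x • one

theorem inner_mean_symm (one x y : E) :
    inner ℂ (mean one x • one) y = inner ℂ x (mean one y • one) := by
  rw [inner_smul_left, inner_smul_right, mean, mean, map_div₀, inner_conj_symm, map_pow,
    Complex.conj_ofReal]
  ring

theorem tendsto_diffError (S : IsStaircaseModel W one e r h B w)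
    (hr : Tendsto (fun j => (r j : ℝ)) atTop atTop)
    (hrw : Tendsto (fun j => (r j : ℝ) ^ 3 * w j) atTop (𝓝 0)) {i k i' l : ℕ} (hk : k < h i)
    (hl : l < h i') : Tendsto (fun j => diffError W r h j (e i k) (e i' l)) atTop (𝓝 0) := by
  have hb : Tendsto (fun j => 4 * w i / r (j + 1) + 12 * (r j ^ 3 * w j)) atTop (𝓝 0) := by
    have b1 : Tendsto (fun j => 4 * w i / r (j + 1)) atTop (𝓝 0) :=
      (hr.comp (tendsto_add_atTop_nat 1)).const_div_atTop (4 * w i)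
    have := b1.add (hrw.const_mul 12)
    rwa [mul_zero, add_zero] at this
  refine squeeze_zero_norm' ?_ hb
  filter_upwards [eventually_ge_atTop (max i i')] with j hj
  obtain ⟨D, hD, he, hc⟩ := S.exists_floors_eq hk j ((le_max_left _ _).trans hj)
  have h2 := S.two_le j
  have h1 := S.norm_diffError_floors_le hD (s := 0) (by omega)
    (S.monotone_tower ((le_max_right _ _).trans hj) (floor_mem_tower hl)) (S.boundedBy_floor hl)
  rw [← he, hc, one_mul] at h1
  change ‖diffError W r h j (e i k) (e i' l)‖ ≤ _ at h1
  refine h1.trans ?_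
  rw [mul_assoc]
  have := (S.width_pos j).le
  have := S.one_le_r j
  gcongr
  norm_num

theorem tendsto_inner_zpow_neg [CompleteSpace E]
    (S : IsStaircaseModel W one e r h B w)
    (hr : Tendsto (fun j => (r j : ℝ)) atTop atTop)
    (hrw : Tendsto (fun j => (r j : ℝ) * w j) atTop (𝓝 0)) {q m : ℕ → ℕ}
    (hq : Tendsto q atTop atTop) (hm : Tendsto (fun k => (m k : ℝ) * w (q k)) atTop (𝓝 0)) (x y : E) :
    Tendsto (fun k => inner ℂ ((W ^ (-(h (q k) + m k) : ℤ)) x) y) atTop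
      (𝓝 (inner ℂ (mean one x • one) y)) := by
  have := (Complex.continuous_conj.tendsto _).comp (S.tendsto_inner_zpow hr hrw hq hm y x)
  rw [inner_conj_symm, ← inner_mean_symm] at this
  refine this.congr fun n => ?_
  rw [Function.comp, inner_conj_symm, inner_zpow_right]

theorem tendsto_mul_width (S : IsStaircaseModel W one e r h B w)
    (hrw : Tendsto (fun j => (r j : ℝ) ^ 3 * w j) atTop (𝓝 0)) (n : ℕ) (hn : n ≤ 3) :
    Tendsto (fun j => (r j : ℝ) ^ n * w j) atTop (𝓝 0) := by
  refine squeeze_zero (fun j => ?_) (fun j => ?_) hrw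
  · have := (S.width_pos j).le; positivity
  · have := (S.width_pos j).le
    have := S.one_le_r j
    gcongr

/-- `ρ k - 1` is the height of the tower `q k` plus an excess of at most `h / (k + 1)`, and `h w ≤
‖one‖²`. -/
theorem tendsto_inner_block [CompleteSpace E]
    (S : IsStaircaseModel W one e r h B w)
    (hr : Tendsto (fun j => (r j : ℝ)) atTop atTop)
    (hrw : Tendsto (fun j => (r j : ℝ) ^ 3 * w j) atTop (𝓝 0)) {q ρ : ℕ → ℕ} {J : ℕ → Finset ℕ}
    (hJ : IsBlockSystem r h q ρ J) (x y : E) :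
    Tendsto (fun k => inner ℂ ((W ^ (-(ρ k - 1 : ℕ) : ℤ)) x) y) atTop
      (𝓝 (inner ℂ (mean one x • one) y)) := by
  have h1 : Tendsto q atTop atTop := tendsto_atTop_mono hJ.le_index tendsto_id
  have h2 : Tendsto (fun k => ((ρ k - 1 - h (q k) : ℕ) : ℝ) * w (q k)) atTop (𝓝 0) := by
    have hb : Tendsto (fun k : ℕ => ‖one‖ ^ 2 * (1 / ((k : ℝ) + 1))) atTop (𝓝 0) := by
      have := (tendsto_one_div_add_atTop_nhds_zero_nat (𝕜 := ℝ)).const_mul (‖one‖ ^ 2)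
      rwa [mul_zero] at this
    refine squeeze_zero (fun k => ?_) (fun k => ?_) hb
    · have := (S.width_pos (q k)).le; positivity
    · have h3 := S.height_mul_width_le (q k)
      have h4 := hJ.height_lt k
      have h5 := hJ.le_height k
      have hw := (S.width_pos (q k)).le
      have e1 : ((ρ k - 1 - h (q k) : ℕ) : ℝ) = ρ k - 1 - h (q k) := by
        rw [Nat.cast_sub (by omega), Nat.cast_sub (by omega)]; simp
      calc _ ≤ (1 / ((k : ℝ) + 1) * h (q k)) * w (q k) := by
            rw [e1]; gcongr; linarith
        _ = (h (q k) * w (q k)) * (1 / ((k : ℝ) + 1)) := by ring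
        _ ≤ _ := by gcongr
  have h3 := S.tendsto_inner_zpow_neg hr
    (by simpa using S.tendsto_mul_width hrw 1 (by norm_num)) h1 h2 x y
  refine h3.congr fun k => ?_
  congr 4
  have := hJ.height_lt k
  omega

/-- The main term `W ^ (-(ρ - 1)) x - x` tends weakly to the mean part of `x` minus `x`, and the
error tends to zero. -/
theorem tendsto_inner_bump [CompleteSpace E]
    (S : IsStaircaseModel W one e r h B w)
    (hr : Tendsto (fun j => (r j : ℝ)) atTop atTop)
    (hrw : Tendsto (fun j => (r j : ℝ) ^ 3 * w j) atTop (𝓝 0)) {q ρ : ℕ → ℕ} {J : ℕ → Finset ℕ}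
    (hJ : IsBlockSystem r h q ρ J) {i k i' l : ℕ} (hk : k < h i) (hl : l < h i') :
    Tendsto (fun p : ℕ × ℕ => inner ℂ (bump W r h p.2 (e i k)) (e i' l)) (blockFilter J)
      (𝓝 (inner ℂ (-centered one (e i k)) (e i' l))) := by
  have t1 := (S.tendsto_diffError hr hrw hk hl).comp hJ.tendsto_snd
  have t2 := ((S.tendsto_inner_block hr hrw hJ (e i k) (e i' l)).comp
    (IsBlockSystem.tendsto_fst (J := J))).sub_const (inner ℂ (e i k) (e i' l))
  have t3 := t2.add t1
  rw [add_zero, ← inner_sub_left] at t3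
  rw [centered, neg_sub]
  refine t3.congr' ?_
  rw [EventuallyEq, eventually_blockFilter]
  refine Eventually.of_forall fun n j hj => ?_
  rw [inner_bump, (hJ.mem n j hj).2, inner_sub_left]
  rfl

theorem eventually_norm_inner_bump_bump_le (S : IsStaircaseModel W one e r h B w)
    (hrw : Tendsto (fun j => (r j : ℝ) ^ 3 * w j) atTop (𝓝 0)) {q ρ : ℕ → ℕ} {J : ℕ → Finset ℕ}
    (hJ : IsBlockSystem r h q ρ J) {i₀ k₀ : ℕ} (hk₀ : k₀ < h i₀) :
    ∀ᶠ k in atTop, ∀ i ∈ J k, ∀ j ∈ J k, i + 2 ≤ j →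
      ‖inner ℂ (bump W r h j (e i₀ k₀)) (bump W r h i (e i₀ k₀))‖ ≤
      32 * ‖one‖ ^ 2 + 24 * w i₀ + 48 := by
  have h2 := (S.tendsto_mul_width hrw 2 (by norm_num)).eventually (eventually_le_nhds zero_lt_one)
  have h3 := hrw.eventually (eventually_le_nhds zero_lt_one)
  filter_upwards [hJ.eventually_forall_mem ((eventually_ge_atTop i₀).and (h2.and h3))]
    with k hk i hi j hj hij
  exact S.norm_inner_bump_bump_le hk₀ (hk i hi).1 hij
    ((hJ.mem k i hi).2.trans (hJ.mem k j hj).2.symm) (hk i hi).2.1 (hk j hj).2.2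

theorem norm_bump_sq_le (S : IsStaircaseModel W one e r h B w) {q ρ : ℕ → ℕ} {J : ℕ → Finset ℕ}
    (hJ : IsBlockSystem r h q ρ J) {i₀ k₀ : ℕ} (hk₀ : k₀ < h i₀) {k j : ℕ} (hj : j ∈ J k) :
    ‖bump W r h j (e i₀ k₀)‖ ^ 2 ≤ ρ k ^ 2 * (4 * w i₀) := by
  have h1 := norm_bump_le (W := W) (r := r) (h := h) j (e i₀ k₀)
  rw [(hJ.mem k j hj).2] at h1
  calc _ ≤ (2 * ρ k * ‖e i₀ k₀‖) ^ 2 := by gcongr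
    _ = ρ k ^ 2 * (4 * ‖e i₀ k₀‖ ^ 2) := by ring
    _ = _ := by rw [S.norm_floor_sq hk₀]

/-- The averages of the vectors `bump` over the blocks converge weakly. -/
theorem tendsto_inner_average_bump [CompleteSpace E]
    (S : IsStaircaseModel W one e r h B w)
    (hr : Tendsto (fun j => (r j : ℝ)) atTop atTop)
    (hrw : Tendsto (fun j => (r j : ℝ) ^ 3 * w j) atTop (𝓝 0)) {q ρ : ℕ → ℕ} {J : ℕ → Finset ℕ}
    (hJ : IsBlockSystem r h q ρ J) {i₀ k₀ : ℕ} (hk₀ : k₀ < h i₀) (y : E) :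
    Tendsto (fun k => inner ℂ (((J k).card : ℂ)⁻¹ • ∑ j ∈ J k, bump W r h j (e i₀ k₀)) y) atTop
      (𝓝 (inner ℂ (-centered one (e i₀ k₀)) y)) := by
  -- The individual vectors have unbounded norms and converge against floors only. Almost
  -- orthogonality bounds the averages, which then converge against every vector.
  refine tendsto_inner_of_dense (C := (32 * ‖one‖ ^ 2 + 24 * w i₀ + 48) + 3 * (4 * w i₀) + 1) ?_
    S.dense ?_ y
  · have hw := (S.width_pos i₀).le
    filter_upwards [S.eventually_norm_inner_bump_bump_le hrw hJ hk₀] with k hk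
    refine norm_average_le_of_almost_orthogonal (hJ.card_pos k) (fun j hj => ?_) hk (by positivity)
    refine (S.norm_bump_sq_le hJ hk₀ hj).trans ?_
    gcongr
    have h1 := hJ.card k
    have h2 : ρ k ^ 2 ≤ ρ k ^ 4 := Nat.pow_le_pow_right (by have := hJ.height_lt k; omega) (by norm_num)
    exact_mod_cast h2.trans h1
  · rintro _ ⟨i, l, hl, rfl⟩
    refine (tendsto_average_of_blockFilter hJ.card_pos
      (S.tendsto_inner_bump hr hrw hJ hk₀ hl)).congr fun k => ?_
    rw [inner_smul_left, sum_inner, map_inv₀, map_natCast]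

variable {F : Type*} [NormedAddCommGroup F] [InnerProductSpace ℂ F] {U : E ≃ₗᵢ[ℂ] E}

/-- The tensor squares of the vectors inherit almost orthogonality, inner products and norms being
squared. -/
theorem eventually_norm_average_tensor_le (S : IsStaircaseModel W one e r h B w)
    (hrw : Tendsto (fun j => (r j : ℝ) ^ 3 * w j) atTop (𝓝 0)) {q ρ : ℕ → ℕ} {J : ℕ → Finset ℕ}
    (hJ : IsBlockSystem r h q ρ J) (Q : TensorSquare U F) {i₀ k₀ : ℕ} (hk₀ : k₀ < h i₀) :
    ∃ C, ∀ᶠ k in atTop, ‖((J k).card : ℂ)⁻¹ • ∑ j ∈ J k,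
      Q.t (bump W r h j (e i₀ k₀)) (bump W r h j (e i₀ k₀))‖ ≤ C := by
  refine ⟨(32 * ‖one‖ ^ 2 + 24 * w i₀ + 48) ^ 2 + 3 * (4 * w i₀) ^ 2 + 1, ?_⟩
  have hw := (S.width_pos i₀).le
  filter_upwards [S.eventually_norm_inner_bump_bump_le hrw hJ hk₀] with k hk
  refine norm_average_le_of_almost_orthogonal (hJ.card_pos k) (fun j hj => ?_)
    (fun i hi j hj hij => ?_) (by positivity)
  · have h1 : (ρ k : ℝ) ^ 4 ≤ (J k).card := by exact_mod_cast hJ.card k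
    rw [Q.norm_t]
    calc _ = (‖bump W r h j (e i₀ k₀)‖ ^ 2) ^ 2 := by ring
      _ ≤ (ρ k ^ 2 * (4 * w i₀)) ^ 2 := by
          gcongr
          exact S.norm_bump_sq_le hJ hk₀ hj
      _ = (ρ k) ^ 4 * (4 * w i₀) ^ 2 := by ring
      _ ≤ _ := by gcongr
  · rw [Q.inner_t, norm_mul, sq]
    exact mul_le_mul (hk i hi j hj hij) (hk i hi j hj hij) (norm_nonneg _) (by positivity)

theorem dense_tensor_floors (S : IsStaircaseModel W one e r h B w) (Q : TensorSquare U F) :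
    (Submodule.span ℂ {z | ∃ i k j l, k < h i ∧ l < h j ∧ z = Q.t (e i k) (e j l)}).topologicalClosure
      = ⊤ := by
  set M := (Submodule.span ℂ
    {z | ∃ i k j l, k < h i ∧ l < h j ∧ z = Q.t (e i k) (e j l)}).topologicalClosure with hM
  have hMc : IsClosed (M : Set F) := Submodule.isClosed_topologicalClosure _
  have ext : ∀ A : E →L[ℂ] F, (∀ i k, k < h i → A (e i k) ∈ M) → ∀ x, A x ∈ M := by
    intro A hA x
    have h1 : (Submodule.span ℂ {x | ∃ j k, k < h j ∧ x = e j k}).topologicalClosure ≤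
        M.comap (A : E →ₗ[ℂ] F) := by
      refine Submodule.topologicalClosure_minimal _ (Submodule.span_le.2 ?_)
        (hMc.preimage A.continuous)
      rintro _ ⟨j, k, hk, rfl⟩
      exact hA j k hk
    rw [S.dense] at h1
    exact h1 (Submodule.mem_top (x := x))
  have h2 : ∀ x y, Q.t x y ∈ M := fun x y => by
    refine ext (Q.T x) (fun j l hl => ?_) y
    refine ext (Q.T.flip (e j l)) (fun i k hk => ?_) x
    exact Submodule.le_topologicalClosure _ (Submodule.subset_span ⟨i, k, j, l, hk, hl, rfl⟩)
  rw [eq_top_iff, ← Q.dense]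
  refine Submodule.topologicalClosure_minimal _ (Submodule.span_le.2 ?_) hMc
  rintro _ ⟨p, rfl⟩
  exact h2 p.1 p.2

/-- Against tensors of floors the pairing is a product of two pairings with limits, and the two
minus signs cancel. -/
theorem tendsto_inner_average_tensor [CompleteSpace E]
    (S : IsStaircaseModel W one e r h B w)
    (hr : Tendsto (fun j => (r j : ℝ)) atTop atTop)
    (hrw : Tendsto (fun j => (r j : ℝ) ^ 3 * w j) atTop (𝓝 0)) {q ρ : ℕ → ℕ} {J : ℕ → Finset ℕ}
    (hJ : IsBlockSystem r h q ρ J) (Q : TensorSquare U F) {i₀ k₀ : ℕ} (hk₀ : k₀ < h i₀) (z : F) :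
    Tendsto (fun k => inner ℂ (((J k).card : ℂ)⁻¹ • ∑ j ∈ J k,
      Q.t (bump W r h j (e i₀ k₀)) (bump W r h j (e i₀ k₀))) z) atTop
      (𝓝 (inner ℂ (Q.t (centered one (e i₀ k₀)) (centered one (e i₀ k₀))) z)) := by
  obtain ⟨C, hC⟩ := S.eventually_norm_average_tensor_le hrw hJ Q hk₀
  refine tendsto_inner_of_dense hC (S.dense_tensor_floors Q) ?_ z
  rintro _ ⟨i, k, j, l, hk, hl, rfl⟩
  have h1 := tendsto_average_of_blockFilter hJ.card_pos
    ((S.tendsto_inner_bump hr hrw hJ hk₀ hk).mul (S.tendsto_inner_bump hr hrw hJ hk₀ hl))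
  rw [Q.inner_t]
  simp only [inner_neg_left, neg_mul_neg] at h1
  refine h1.congr fun k => ?_
  rw [inner_smul_left, sum_inner, map_inv₀, map_natCast]
  simp only [Q.inner_t]

end IsStaircaseModel

/-! ### From block averages to the homogeneity of the tensor square -/

namespace IsStaircaseModel

variable {E : Type*} [NormedAddCommGroup E] [InnerProductSpace ℂ E]
  {U : E ≃ₗᵢ[ℂ] E} {one : E} {e : ℕ → ℕ → E} {r h : ℕ → ℕ} {B : ℕ → ℕ → ℕ} {w : ℕ → ℝ}
  {F : Type*} [NormedAddCommGroup F] [InnerProductSpace ℂ F]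

/-- The averaging operator over a block, as a function of `U`. -/
def blockPoly (h ρ : ℕ → ℕ) (J : ℕ → Finset ℕ) (k : ℕ) : ℤ →₀ ℂ :=
  ∑ j ∈ J k, Finsupp.single (-(h j + 1 : ℤ)) ((ρ k : ℂ) / (J k).card)

theorem trigApply_blockPoly {G : Type*} [NormedAddCommGroup G] [InnerProductSpace ℂ G]
    (V : G ≃ₗᵢ[ℂ] G) (h ρ : ℕ → ℕ) (J : ℕ → Finset ℕ) (k : ℕ) (z : G) :
    trigApply V (blockPoly h ρ J k) z =
      ∑ j ∈ J k, ((ρ k : ℂ) / (J k).card) • (V ^ (-(h j + 1 : ℤ))) z := by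
  simp only [trigApply, blockPoly, map_sum, Finsupp.linearCombination_single]

theorem map_one_of_inv (S : IsStaircaseModel U⁻¹ one e r h B w) : U one = one := by
  have := zpow_apply_of_map_eq S.map_one (-1)
  rwa [zpow_neg_one, inv_inv] at this

theorem bump_eq (S : IsStaircaseModel U⁻¹ one e r h B w) (j : ℕ) (x : E) :
    bump U⁻¹ r h j x =
      (r j : ℂ) • (U ^ (-(h j + 1 : ℤ))) (U (centered one x) - centered one x) := by
  have e1 : U (centered one x) - centered one x = U x - x := by
    rw [centered, map_sub, map_smul, S.map_one_of_inv]; abel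
  have e2 : (U ^ (-(h j + 1 : ℤ))) (U x) = (U ^ (-(h j : ℤ))) x := by
    rw [show U x = (U ^ (1 : ℤ)) x by rw [zpow_one], ← zpow_add_apply]
    congr 2; ring
  rw [e1, map_sub, e2, bump, diff, inv_zpow', inv_zpow']

theorem trigApply_bump (S : IsStaircaseModel U⁻¹ one e r h B w) {q ρ : ℕ → ℕ} {J : ℕ → Finset ℕ}
    (hJ : IsBlockSystem r h q ρ J) (k : ℕ) (x : E) :
    trigApply U (blockPoly h ρ J k) (U (centered one x) - centered one x) =
      ((J k).card : ℂ)⁻¹ • ∑ j ∈ J k, bump U⁻¹ r h j x := by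
  rw [trigApply_blockPoly, Finset.smul_sum]
  refine Finset.sum_congr rfl fun j hj => ?_
  rw [S.bump_eq, (hJ.mem k j hj).2, smul_smul, div_eq_inv_mul]

/-- The tensor square of `bump` contains `ρ` twice, the polynomial only once. The remaining factor
`ρ⁻¹` distinguishes the action on the tensor square from that on the original space. -/
theorem trigApply_tensor (S : IsStaircaseModel U⁻¹ one e r h B w) {q ρ : ℕ → ℕ} {J : ℕ → Finset ℕ}
    (hJ : IsBlockSystem r h q ρ J) (Q : TensorSquare U F) (k : ℕ) (x : E) :
    trigApply Q.V (blockPoly h ρ J k) (Q.K (Q.t (centered one x) (centered one x))) =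
      (ρ k : ℂ)⁻¹ • ((J k).card : ℂ)⁻¹ • ∑ j ∈ J k,
        Q.t (bump U⁻¹ r h j x) (bump U⁻¹ r h j x) := by
  have hρ : (ρ k : ℂ) ≠ 0 := by
    have := hJ.height_lt k
    exact_mod_cast (by omega : ρ k ≠ 0)
  rw [trigApply_blockPoly, smul_smul, Finset.smul_sum]
  refine Finset.sum_congr rfl fun j hj => ?_
  rw [S.bump_eq, (hJ.mem k j hj).2, Q.K_t, Q.V_zpow_t]
  simp only [map_smul, LinearMap.smul_apply, smul_smul]
  congr 1
  field_simp

theorem tendsto_trigApply_tensor (S : IsStaircaseModel U⁻¹ one e r h B w)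
    (hrw : Tendsto (fun j => (r j : ℝ) ^ 3 * w j) atTop (𝓝 0)) {q ρ : ℕ → ℕ} {J : ℕ → Finset ℕ}
    (hJ : IsBlockSystem r h q ρ J) (Q : TensorSquare U F) {i₀ k₀ : ℕ} (hk₀ : k₀ < h i₀) :
    Tendsto (fun k => trigApply Q.V (blockPoly h ρ J k)
      (Q.K (Q.t (centered one (e i₀ k₀)) (centered one (e i₀ k₀))))) atTop (𝓝 0) := by
  obtain ⟨C, hC⟩ := S.eventually_norm_average_tensor_le hrw hJ Q hk₀
  have hρ : Tendsto ρ atTop atTop := by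
    refine tendsto_atTop_mono (fun k => ?_) tendsto_id
    have := hJ.height_lt k
    have := S.le_height (q k)
    have := hJ.le_index k
    simp only [id]; omega
  have hb : Tendsto (fun k => (ρ k : ℝ)⁻¹ * C) atTop (𝓝 0) := by
    have := (tendsto_inv_atTop_zero.comp (tendsto_natCast_atTop_atTop.comp hρ)).mul_const C (M := ℝ)
    rwa [zero_mul] at this
  refine squeeze_zero_norm' ?_ hb
  filter_upwards [hC] with k hk
  rw [S.trigApply_tensor hJ, norm_smul, norm_inv, Complex.norm_natCast]
  gcongr

/-- Up to the factor `ρ`, the averages of the tensor squares are polynomials in `V` applied to `K (c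
⊗ c)`, and `c ⊗ c` is their weak limit. -/
theorem tensor_mem_cyclicSpace [CompleteSpace E] [CompleteSpace F]
    (S : IsStaircaseModel U⁻¹ one e r h B w)
    (hr : Tendsto (fun j => (r j : ℝ)) atTop atTop)
    (hrw : Tendsto (fun j => (r j : ℝ) ^ 3 * w j) atTop (𝓝 0)) {q ρ : ℕ → ℕ} {J : ℕ → Finset ℕ}
    (hJ : IsBlockSystem r h q ρ J) (Q : TensorSquare U F) {i₀ k₀ : ℕ} (hk₀ : k₀ < h i₀) :
    Q.t (centered one (e i₀ k₀)) (centered one (e i₀ k₀)) ∈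
      cyclicSpace Q.V (Q.K (Q.t (centered one (e i₀ k₀)) (centered one (e i₀ k₀)))) := by
  set z := Q.t (centered one (e i₀ k₀)) (centered one (e i₀ k₀)) with hz
  obtain ⟨a, ha, b, hb, hab, -⟩ := exists_cyclicSpace_decomposition Q.V (Q.K z) z
  have h1 := S.tendsto_inner_average_tensor hr hrw hJ Q hk₀ b
  have h2 : ∀ k, inner ℂ (((J k).card : ℂ)⁻¹ • ∑ j ∈ J k,
      Q.t (bump U⁻¹ r h j (e i₀ k₀)) (bump U⁻¹ r h j (e i₀ k₀))) b = 0 := fun k => by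
    refine (Submodule.mem_orthogonal _ _).1 hb _ ?_
    have h3 := S.trigApply_tensor hJ Q k (e i₀ k₀)
    have hρ : (ρ k : ℂ) ≠ 0 := by
      have := hJ.height_lt k
      exact_mod_cast (by omega : ρ k ≠ 0)
    rw [eq_inv_smul_iff₀ hρ] at h3
    rw [← h3]
    exact Submodule.smul_mem _ _ (trigApply_mem_cyclicSpace _ _ _)
  simp only [h2] at h1
  have h3 : inner ℂ z b = 0 := tendsto_nhds_unique h1 tendsto_const_nhds
  have h4 : b = 0 := by
    rw [hab, inner_add_left, (Submodule.mem_orthogonal _ _).1 hb _ ha, zero_add] at h3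
    exact inner_self_eq_zero.1 h3
  have h5 : a = z := by rw [hab, h4, add_zero]
  rwa [h5] at ha

theorem centered_mem (S : IsStaircaseModel U⁻¹ one e r h B w) (x : E) :
    centered one x ∈ (ℂ ∙ one)ᗮ := by
  rw [Submodule.mem_orthogonal_singleton_iff_inner_right]
  exact S.inner_one_sub_mean x

theorem centered_add (x y : E) : centered one (x + y) = centered one x + centered one y := by
  simp only [centered, mean, inner_add_right, add_div, add_smul]; abel

theorem centered_smul (c : ℂ) (x : E) : centered one (c • x) = c • centered one x := by
  simp only [centered, mean, inner_smul_right, smul_sub, smul_smul, mul_div_assoc]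

theorem centered_eq_self {x : E} (hx : x ∈ (ℂ ∙ one)ᗮ) : centered one x = x := by
  rw [Submodule.mem_orthogonal_singleton_iff_inner_right] at hx
  simp [centered, mean, hx]

theorem norm_centered_le (S : IsStaircaseModel U⁻¹ one e r h B w) (x : E) :
    ‖centered one x‖ ≤ ‖x‖ := by
  have h1 : inner ℂ (mean one x • one) (centered one x) = 0 := by
    rw [inner_smul_left, centered, S.inner_one_sub_mean, mul_zero]
  have h2 := norm_add_sq_eq_norm_sq_add_norm_sq_of_inner_eq_zero _ _ h1
  rw [centered, add_sub_cancel, ← centered] at h2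
  nlinarith [norm_nonneg (centered one x), norm_nonneg x, norm_nonneg (mean one x • one)]

theorem centered_zpow (S : IsStaircaseModel U⁻¹ one e r h B w) (n : ℤ) (x : E) :
    centered one ((U ^ n) x) = (U ^ n) (centered one x) := by
  have h1 : (U ^ n) one = one := zpow_apply_of_map_eq S.map_one_of_inv n
  rw [centered, centered, map_sub, map_smul, h1]
  congr 2
  rw [mean, mean, ← h1, LinearIsometryEquiv.inner_map_map, h1]

theorem floor_eq_zpow (S : IsStaircaseModel U⁻¹ one e r h B w) {j k : ℕ} (hk : k < h j) :
    e j k = (U ^ (-(k : ℤ))) (e j 0) := by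
  have := S.zpow_natCast_floor (j := j) (k := 0) k (by omega)
  rw [zero_add, inv_zpow'] at this
  exact this.symm

theorem centered_floor_mem (S : IsStaircaseModel U⁻¹ one e r h B w) {j k : ℕ} (hk : k < h j) :
    centered one (e j k) ∈ cyclicSpace U (centered one (e j 0)) := by
  rw [S.floor_eq_zpow hk, S.centered_zpow]
  exact zpow_mem_cyclicSpace _ _ _

/-- All floors of a tower are translates of its bottom floor, so each tower contributes one cyclic
space. These spaces increase, since towers refine. -/
theorem centered_mem_cyclicSpace (S : IsStaircaseModel U⁻¹ one e r h B w) {j : ℕ} {x : E}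
    (hx : x ∈ tower e h j) : centered one x ∈ cyclicSpace U (centered one (e j 0)) := by
  refine Submodule.span_induction ?_ ?_ ?_ ?_ hx
  · rintro _ ⟨k, hk, rfl⟩; exact S.centered_floor_mem hk
  · have : centered one (0 : E) = 0 := by simp [centered, mean]
    rw [this]; exact Submodule.zero_mem _
  · intro x y _ _ hx hy
    rw [centered_add]; exact Submodule.add_mem _ hx hy
  · intro a x _ hx
    rw [centered_smul]; exact Submodule.smul_mem _ _ hx

theorem exists_mem_tower_near (S : IsStaircaseModel U⁻¹ one e r h B w) (v : E) {ε : ℝ} (hε : 0 < ε) :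
    ∃ j, ∃ x ∈ tower e h j, ‖x - v‖ < ε := by
  have h1 : Submodule.span ℂ {x | ∃ j k, k < h j ∧ x = e j k} ≤ ⨆ j, tower e h j := by
    rw [Submodule.span_le]
    rintro _ ⟨j, k, hk, rfl⟩
    exact Submodule.mem_iSup_of_mem j (floor_mem_tower hk)
  obtain ⟨x, hx, hxv⟩ := Metric.mem_closure_iff.1 (S.dense_floors v) ε hε
  obtain ⟨j, hj⟩ := (Submodule.mem_iSup_of_directed _ S.monotone_tower.directed_le).1 (h1 hx)
  exact ⟨j, x, hj, by rwa [dist_comm, dist_eq_norm] at hxv⟩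

theorem exists_centered_ne_zero (S : IsStaircaseModel U⁻¹ one e r h B w) :
    ∃ j, centered one (e j 0) ≠ 0 := by
  refine ⟨0, fun h0 => ?_⟩
  have hh := S.two_le_height
  have hw := S.width_pos 0
  have h1 : e 0 0 = mean one (e 0 0) • one := sub_eq_zero.1 h0
  have h2 : inner ℂ (e 0 1) (e 0 0) = (0 : ℂ) := by
    rw [S.inner_floor 0 1 0 (by omega) (by omega), if_neg one_ne_zero]
  have h3 : inner ℂ (e 0 0) (e 0 0) = (w 0 : ℂ) := by
    rw [S.inner_floor 0 0 0 (by omega) (by omega), if_pos rfl]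
  have h4 : mean one (e 0 0) = 0 := by
    rw [h1, inner_smul_right, S.inner_floor_one (by omega), mul_eq_zero] at h2
    exact h2.resolve_right (by exact_mod_cast hw.ne')
  rw [h1, h4, zero_smul, inner_zero_left] at h3
  exact hw.ne' (by exact_mod_cast h3.symm)

/-- A staircase construction with long blocks of equal cutting parameters has a homogeneous tensor
square. -/
theorem isHomogeneous [CompleteSpace E] [CompleteSpace F]
    (S : IsStaircaseModel U⁻¹ one e r h B w)
    (hr : Tendsto (fun j => (r j : ℝ)) atTop atTop)
    (hrw : Tendsto (fun j => (r j : ℝ) ^ 3 * w j) atTop (𝓝 0)) {q ρ : ℕ → ℕ} {J : ℕ → Finset ℕ}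
    (hJ : IsBlockSystem r h q ρ J) (Q : TensorSquare U F) :
    Q.IsHomogeneous one (fun j => centered one (e j 0)) (fun k => (ρ k - 1 : ℕ)) where
  one_ne := S.one_ne
  map_one := S.map_one_of_inv
  mem j := S.centered_mem _
  succ j := by
    refine S.centered_mem_cyclicSpace (S.tower_le_succ j (floor_mem_tower ?_))
    have := S.two_le_height' j; omega
  dense v hv ε hε := by
    obtain ⟨j, x, hx, hxv⟩ := S.exists_mem_tower_near v hε
    refine ⟨j, centered one x, S.centered_mem_cyclicSpace hx, lt_of_le_of_lt ?_ hxv⟩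
    have h1 : centered one x - v = centered one (x - v) := by
      rw [sub_eq_add_neg x v, centered_add, ← neg_one_smul ℂ v, centered_smul, centered_eq_self hv,
        neg_one_smul, sub_eq_add_neg]
    rw [h1]
    exact S.norm_centered_le _
  weak x hx y := by
    have h1 := S.tendsto_inner_block hr hrw hJ x y
    rw [Submodule.mem_orthogonal_singleton_iff_inner_right] at hx
    rw [mean, hx, zero_div, zero_smul, inner_zero_left] at h1
    refine h1.congr fun k => ?_
    rw [inv_zpow', neg_neg]
  kernel j := S.tensor_mem_cyclicSpace hr hrw hJ Q (by have := S.two_le_height' j; omega)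
  singular j := by
    have hk : 0 < h j := by have := S.two_le_height' j; omega
    -- The weak limit is `-c`, which has the same spectral measure as `c`.
    rw [← spectralMeasure_neg]
    refine mutuallySingular_of_trigApply (blockPoly h ρ J)
      (v := U (centered one (e j 0)) - centered one (e j 0)) (fun y => ?_)
      (S.tendsto_trigApply_tensor hrw hJ Q hk)
    have h1 := (Complex.continuous_conj.tendsto _).comp
      (S.tendsto_inner_average_bump hr hrw hJ hk y)
    rw [inner_conj_symm] at h1
    refine h1.congr fun k => ?_
    rw [Function.comp, inner_conj_symm, S.trigApply_bump hJ]
  ne_zero := S.exists_centered_ne_zero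

end IsStaircaseModel

/-! ### Growth of the cutting parameters and existence of blocks -/

theorem natCast_add_rpow_isEquivalent (d : ℝ) (n : ℕ) :
    (fun j : ℕ => ((j + n : ℕ) : ℝ) ^ d) ~[atTop] fun j : ℕ => (j : ℝ) ^ d := by
  refine isEquivalent_of_tendsto_one ?_
  have h1 : Tendsto (fun j : ℕ => 1 + (n : ℝ) / j) atTop (𝓝 1) := by
    have := (tendsto_const_div_atTop_nhds_zero_nat (n : ℝ)).const_add 1
    rwa [add_zero] at this
  have h2 := h1.rpow_const (p := d) (Or.inl one_ne_zero)
  rw [Real.one_rpow] at h2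
  refine h2.congr' ?_
  filter_upwards [eventually_gt_atTop 0] with j hj
  have hj' : (0 : ℝ) < j := by exact_mod_cast hj
  rw [Pi.div_apply, ← Real.div_rpow (by positivity) hj'.le]
  congr 1
  push_cast
  field_simp

theorem isEquivalent_shift {d : ℝ} {r : ℕ → ℕ}
    (hr : (fun j : ℕ => (r j : ℝ)) ~[atTop] fun j : ℕ => (j : ℝ) ^ d) (n : ℕ) :
    (fun j : ℕ => (r (j + n) : ℝ)) ~[atTop] fun j : ℕ => (j : ℝ) ^ d :=
  (hr.comp_tendsto (tendsto_add_atTop_nat n)).trans (natCast_add_rpow_isEquivalent d n)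

theorem tendsto_of_isEquivalent_rpow {d : ℝ} (hd : 0 < d) {r : ℕ → ℕ}
    (hr : (fun j : ℕ => (r j : ℝ)) ~[atTop] fun j : ℕ => (j : ℝ) ^ d) :
    Tendsto (fun j => (r j : ℝ)) atTop atTop :=
  hr.symm.tendsto_atTop ((tendsto_rpow_atTop hd).comp tendsto_natCast_atTop_atTop)

theorem eventually_le_two_mul {d : ℝ} {r : ℕ → ℕ}
    (hr : (fun j : ℕ => (r j : ℝ)) ~[atTop] fun j : ℕ => (j : ℝ) ^ d) :
    ∀ᶠ j in atTop, r (j + 1) ≤ 2 * r j ∧ r j ≤ 2 * r (j + 1) := by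
  have h1 := (isEquivalent_shift hr 1).trans hr.symm
  filter_upwards [h1.isLittleO.def (c := 1 / 2) (by norm_num)] with j hj
  simp only [Pi.sub_apply, Real.norm_eq_abs, Nat.abs_cast] at hj
  rw [abs_le] at hj
  constructor
  · have : (r (j + 1) : ℝ) ≤ 2 * r j := by linarith [Nat.cast_nonneg (α := ℝ) (r j)]
    exact_mod_cast this
  · have : (r j : ℝ) ≤ 2 * r (j + 1) := by linarith
    exact_mod_cast this

/-- The widths decay like `2⁻ʲ`, whereas `r j ≤ 2 j` eventually. -/
theorem tendsto_pow_mul_width {d : ℝ} (hd1 : d ≤ 1) {r : ℕ → ℕ}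
    (hr : (fun j : ℕ => (r j : ℝ)) ~[atTop] fun j : ℕ => (j : ℝ) ^ d) {w : ℕ → ℝ}
    (hw0 : ∀ j, 0 < w j) (hw : ∀ j, 2 * w (j + 1) ≤ w j) :
    Tendsto (fun j => (r j : ℝ) ^ 3 * w j) atTop (𝓝 0) := by
  have hw' : ∀ j, w j ≤ w 0 * (1 / 2) ^ j := by
    intro j
    induction j with
    | zero => simp
    | succ j ih => rw [pow_succ]; linarith [hw j]
  have hb : Tendsto (fun j : ℕ => 8 * w 0 * ((j : ℝ) ^ 3 * (1 / 2) ^ j)) atTop (𝓝 0) := by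
    have := (tendsto_pow_const_mul_const_pow_of_abs_lt_one 3
      (by rw [abs_of_pos] <;> norm_num : |(1 / 2 : ℝ)| < 1)).const_mul (8 * w 0)
    rwa [mul_zero] at this
  refine squeeze_zero' (Eventually.of_forall fun j => by have := (hw0 j).le; positivity) ?_ hb
  filter_upwards [hr.isLittleO.def zero_lt_one, eventually_ge_atTop 1] with j hj hj1
  have hj1' : (1 : ℝ) ≤ j := by exact_mod_cast hj1
  have h1 : (j : ℝ) ^ d ≤ j := by
    calc _ ≤ (j : ℝ) ^ (1 : ℝ) := Real.rpow_le_rpow_of_exponent_le hj1' hd1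
      _ = j := Real.rpow_one _
  simp only [Pi.sub_apply, Real.norm_eq_abs, one_mul,
    abs_of_nonneg (Real.rpow_nonneg (Nat.cast_nonneg j) d)] at hj
  have h2 : (r j : ℝ) ≤ 2 * j := by linarith [(abs_le.1 hj).2]
  calc _ ≤ (2 * (j : ℝ)) ^ 3 * (w 0 * (1 / 2) ^ j) := by
        have := (hw0 j).le
        have := hw' j
        gcongr
    _ = _ := by ring

/-- The values just above a large number `x` are taken often by a sequence growing like `j ^ d`. -/
theorem eventually_exists_block {d : ℝ} (hd0 : 0 < d) (hd1 : d < 1 / 5) {r : ℕ → ℕ}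
    (hr : (fun j : ℕ => (r j : ℝ)) ~[atTop] fun j : ℕ => (j : ℝ) ^ d) (k : ℕ) {ε : ℝ} (hε : 0 < ε)
    (hε1 : ε ≤ 1) :
    ∀ᶠ x : ℕ in atTop, ∃ (ρ : ℕ) (J : Finset ℕ), x + 1 ≤ ρ ∧ (ρ : ℝ) ≤ 1 + (1 + ε) * x ∧
      (∀ j ∈ J, k ≤ j ∧ r j = ρ) ∧ ρ ^ 4 ≤ J.card := by
  -- The relative error `ε / 16` leaves `r j` between `x + 1` and `(1 + ε) x` when `j ^ d` lies
  -- between `(1 + ε / 4) x` and `(1 + ε / 2) x` and `ε x ≥ 8`.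
  obtain ⟨K, hK⟩ := eventually_atTop.1
    ((hr.isLittleO.def (c := ε / 16) (by positivity)).and (eventually_ge_atTop k))
  have hd5 : 5 < 1 / d := by rw [lt_div_iff₀ hd0]; linarith
  set A := (1 + ε / 4) ^ (1 / d) with hA
  set C := (1 + ε / 2) ^ (1 / d) with hC
  have hA1 : 1 ≤ A := Real.one_le_rpow (by linarith) (by linarith)
  have hAC : A < C := Real.rpow_lt_rpow (by linarith) (by linarith) (by linarith)
  -- The only place where `d < 1/5` is essential: the number of suitable indices is about `x ^ (1 /
  -- d)` and must exceed a multiple of `x ^ 5`. The constant 245 below covers `3 x * (3 x) ^ 4 = 243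
  -- x ^ 5` and rounding.
  have ht : Tendsto (fun x : ℕ => (C - A) * (x : ℝ) ^ (1 / d - 5)) atTop atTop :=
    ((tendsto_rpow_atTop (by linarith)).comp tendsto_natCast_atTop_atTop).const_mul_atTop
      (by linarith)
  filter_upwards [ht.eventually_ge_atTop 245, eventually_ge_atTop (max K 1),
    (tendsto_natCast_atTop_atTop (R := ℝ)).eventually_ge_atTop (8 / ε)] with x hx1 hx2 hx3
  have hx1' : (1 : ℝ) ≤ x := by exact_mod_cast (le_max_right _ _).trans hx2
  have hx0 : (0 : ℝ) < x := by linarith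
  rw [div_le_iff₀ hε] at hx3
  set Y := (x : ℝ) ^ (1 / d) with hY
  have hYd : Y ^ d = x := by
    rw [hY, ← Real.rpow_mul hx0.le, one_div_mul_cancel hd0.ne', Real.rpow_one]
  have hAd : A ^ d = 1 + ε / 4 := by
    rw [hA, ← Real.rpow_mul (by linarith), one_div_mul_cancel hd0.ne', Real.rpow_one]
  have hCd : C ^ d = 1 + ε / 2 := by
    rw [hC, ← Real.rpow_mul (by linarith), one_div_mul_cancel hd0.ne', Real.rpow_one]
  have hYx : (x : ℝ) ≤ Y := by
    calc (x : ℝ) = (x : ℝ) ^ (1 : ℝ) := (Real.rpow_one _).symm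
      _ ≤ _ := Real.rpow_le_rpow_of_exponent_le hx1' (by linarith)
  have hY0 : 0 < Y := by linarith
  have hY5 : Y = (x : ℝ) ^ (1 / d - 5) * x ^ 5 := by
    rw [hY, ← Real.rpow_natCast (x : ℝ) 5, ← Real.rpow_add hx0]; norm_num
  let I := Finset.Icc ⌈A * Y⌉₊ ⌊C * Y⌋₊
  have hI : ∀ j ∈ I, A * Y ≤ j ∧ (j : ℝ) ≤ C * Y := fun j hj => by
    obtain ⟨h1, h2⟩ := Finset.mem_Icc.1 hj
    exact ⟨(Nat.le_ceil _).trans (by exact_mod_cast h1),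
      (Nat.le_floor_iff (by positivity)).1 h2⟩
  have hIK : ∀ j ∈ I, K ≤ j := fun j hj => by
    have h1 := (hI j hj).1
    have h2 : (K : ℝ) ≤ x := by exact_mod_cast (le_max_left _ _).trans hx2
    have h3 : (K : ℝ) ≤ j := by nlinarith
    exact_mod_cast h3
  have hbd : ∀ j ∈ I, (x : ℝ) + 1 ≤ r j ∧ (r j : ℝ) ≤ (1 + ε) * x := fun j hj => by
    obtain ⟨h1, h2⟩ := hI j hj
    have h3 := (hK j (hIK j hj)).1
    have h4 : (1 + ε / 4) * x ≤ (j : ℝ) ^ d := by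
      rw [← hAd, ← hYd, ← Real.mul_rpow (by linarith) hY0.le]
      exact Real.rpow_le_rpow (by positivity) h1 hd0.le
    have h5 : (j : ℝ) ^ d ≤ (1 + ε / 2) * x := by
      rw [← hCd, ← hYd, ← Real.mul_rpow (by linarith) hY0.le]
      exact Real.rpow_le_rpow (by positivity) h2 hd0.le
    simp only [Pi.sub_apply, Real.norm_eq_abs,
      abs_of_nonneg (Real.rpow_nonneg (Nat.cast_nonneg j) d)] at h3
    rw [abs_le] at h3
    constructor
    · have h6 : (1 - ε / 16) * ((1 + ε / 4) * x) ≤ r j := by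
        calc _ ≤ (1 - ε / 16) * (j : ℝ) ^ d := by gcongr; linarith
          _ ≤ r j := by linarith [h3.1]
      have h7 : ε * ε * x ≤ ε * x := by nlinarith [mul_pos hε hx0]
      nlinarith
    · have h6 : r j ≤ (1 + ε / 16) * ((1 + ε / 2) * x) := by
        calc (r j : ℝ) ≤ (1 + ε / 16) * (j : ℝ) ^ d := by linarith [h3.2]
          _ ≤ _ := by gcongr
      have h7 : ε * ε * x ≤ ε * x := by nlinarith [mul_pos hε hx0]
      nlinarith
  have hcard : (C - A) * Y - 1 ≤ I.card := by
    have h1 : (⌈A * Y⌉₊ : ℝ) < A * Y + 1 := Nat.ceil_lt_add_one (by positivity)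
    have h2 := Nat.lt_floor_add_one (C * Y)
    have h3 : ((⌊C * Y⌋₊ + 1 : ℕ) : ℝ) - ⌈A * Y⌉₊ ≤ I.card := by
      rw [Nat.card_Icc, sub_le_iff_le_add]
      exact_mod_cast (by omega : ⌊C * Y⌋₊ + 1 ≤ ⌊C * Y⌋₊ + 1 - ⌈A * Y⌉₊ + ⌈A * Y⌉₊)
    push_cast at h3
    linarith
  have hbig : ((Finset.Icc (x + 1) (3 * x)).card * (3 * x) ^ 4 : ℕ) < I.card := by
    have h1 : (Finset.Icc (x + 1) (3 * x)).card ≤ 3 * x := by rw [Nat.card_Icc]; omega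
    have h2 : (1 : ℝ) ≤ (x : ℝ) ^ 5 := one_le_pow₀ hx1'
    have h3 : 245 * (x : ℝ) ^ 5 ≤ (C - A) * Y := by
      rw [hY5]
      calc _ ≤ ((C - A) * (x : ℝ) ^ (1 / d - 5)) * x ^ 5 := by gcongr
        _ = _ := by ring
    have h4 : ((3 * x * (3 * x) ^ 4 : ℕ) : ℝ) < I.card := by
      push_cast
      have : 3 * (x : ℝ) * (3 * x) ^ 4 = 243 * x ^ 5 := by ring
      linarith
    exact (Nat.mul_le_mul_right _ h1).trans_lt (by exact_mod_cast h4)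
  -- Pigeonhole over the at most `3 x` possible values. No monotonicity of `r` is available, so the
  -- indices found need not be consecutive.
  obtain ⟨ρ, hρ, hρc⟩ := Finset.exists_lt_card_fiber_of_mul_lt_card_of_maps_to
    (f := r) (s := I) (t := Finset.Icc (x + 1) (3 * x)) (fun j hj => by
      obtain ⟨h1, h2⟩ := hbd j hj
      rw [Finset.mem_Icc]
      constructor
      · exact_mod_cast h1
      · have : (r j : ℝ) ≤ 3 * x := by nlinarith
        exact_mod_cast this) hbig
  rw [Finset.mem_Icc] at hρ
  obtain ⟨j, hj⟩ : ({j ∈ I | r j = ρ} : Finset ℕ).Nonempty :=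
    Finset.card_pos.1 (lt_of_le_of_lt (Nat.zero_le _) hρc)
  obtain ⟨hjI, hjρ⟩ := Finset.mem_filter.1 hj
  refine ⟨ρ, {j ∈ I | r j = ρ}, hρ.1, ?_, fun j hj => ?_, ?_⟩
  · have := (hbd j hjI).2
    rw [hjρ] at this; linarith
  · obtain ⟨h1, h2⟩ := Finset.mem_filter.1 hj
    exact ⟨(hK j (hIK j h1)).2, h2⟩
  · exact (Nat.pow_le_pow_left hρ.2 4).trans hρc.le

theorem exists_isBlockSystem {d : ℝ} (hd0 : 0 < d) (hd1 : d < 1 / 5) {r : ℕ → ℕ}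
    (hr : (fun j : ℕ => (r j : ℝ)) ~[atTop] fun j : ℕ => (j : ℝ) ^ d) {h : ℕ → ℕ}
    (hh : ∀ j, j ≤ h j) : ∃ q ρ J, IsBlockSystem r h q ρ J := by
  have hh' : Tendsto h atTop atTop := tendsto_atTop_mono hh tendsto_id
  have key : ∀ k : ℕ, ∃ (q ρ : ℕ) (J : Finset ℕ), k ≤ q ∧ h q + 1 ≤ ρ ∧
      (ρ : ℝ) ≤ 1 + (1 + 1 / (k + 1)) * h q ∧ (∀ j ∈ J, k ≤ j ∧ r j = ρ) ∧ ρ ^ 4 ≤ J.card := by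
    intro k
    have hk : 1 / ((k : ℝ) + 1) ≤ 1 := by
      rw [div_le_one (by positivity)]; linarith [Nat.cast_nonneg (α := ℝ) k]
    obtain ⟨q, ⟨ρ, J, h1, h2, h3, h4⟩, hq⟩ := ((hh'.eventually (eventually_exists_block hd0 hd1 hr k
      (ε := 1 / ((k : ℝ) + 1)) (by positivity) hk)).and (eventually_ge_atTop k)).exists
    exact ⟨q, ρ, J, hq, h1, h2, h3, h4⟩
  choose q ρ J h1 h2 h3 h4 h5 using key
  exact ⟨q, ρ, J, h1, h2, h3, h4, h5⟩

/-! ### Koopman operators and indicators in `L²` -/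

section Koopman

variable {α : Type*} [MeasurableSpace α] {μ : Measure α}

/-- The range of an isometry of a complete space is closed. -/
theorem surjective_of_span_dense {E : Type*} [NormedAddCommGroup E] [InnerProductSpace ℂ E]
    [CompleteSpace E] (A : E →ₗᵢ[ℂ] E) {s : Set E}
    (hs : (Submodule.span ℂ s).topologicalClosure = ⊤) (h : ∀ x ∈ s, ∃ y, A y = x) :
    Function.Surjective A := by
  have hc : IsClosed ((LinearMap.range A.toLinearMap : Submodule ℂ E) : Set E) := by
    rw [LinearMap.coe_range]
    exact A.isometry.isClosedEmbedding.isClosed_range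
  have h1 : (Submodule.span ℂ s).topologicalClosure ≤ LinearMap.range A.toLinearMap :=
    Submodule.topologicalClosure_minimal _ (Submodule.span_le.2 fun x hx => h x hx) hc
  intro x
  rw [hs] at h1
  exact h1 (Submodule.mem_top (x := x))

/-- The operator `f ↦ f ∘ T`, for a measure preserving map with dense range. -/
def koopmanEquiv {T : α → α} (hT : MeasurePreserving T μ μ)
    (hs : Function.Surjective (Lp.compMeasurePreservingₗᵢ (p := 2) (E := ℂ) ℂ T hT)) :
    Lp ℂ 2 μ ≃ₗᵢ[ℂ] Lp ℂ 2 μ :=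
  LinearIsometryEquiv.ofSurjective (Lp.compMeasurePreservingₗᵢ ℂ T hT) hs

theorem coeFn_koopmanEquiv {T : α → α} (hT : MeasurePreserving T μ μ)
    (hs : Function.Surjective (Lp.compMeasurePreservingₗᵢ (p := 2) (E := ℂ) ℂ T hT)) (f : Lp ℂ 2 μ) :
    (koopmanEquiv hT hs f : α → ℂ) =ᵐ[μ] (f : α → ℂ) ∘ T :=
  Lp.coeFn_compMeasurePreserving f hT

variable [IsFiniteMeasure μ]

/-- The indicator of a set, in `L²`. -/
def ind (μ : Measure α) [IsFiniteMeasure μ] {s : Set α} (hs : MeasurableSet s) : Lp ℂ 2 μ :=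
  indicatorConstLp 2 hs (measure_ne_top μ s) 1

theorem inner_ind {s : Set α} (hs : MeasurableSet s) (f : Lp ℂ 2 μ) :
    inner ℂ (ind μ hs) f = ∫ x in s, f x ∂μ :=
  L2.inner_indicatorConstLp_one hs (measure_ne_top μ s) f

theorem inner_ind_ind {s t : Set α} (hs : MeasurableSet s) (ht : MeasurableSet t) :
    inner ℂ (ind μ hs) (ind μ ht) = (μ.real (s ∩ t) : ℂ) := by
  rw [ind, ind, L2.inner_indicatorConstLp_indicatorConstLp]
  simp

theorem norm_inner_ind_ind {s t : Set α} (hs : MeasurableSet s) (ht : MeasurableSet t) :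
    ‖inner ℂ (ind μ hs) (ind μ ht)‖ = μ.real (s ∩ t) := by
  rw [inner_ind_ind, Complex.norm_real, Real.norm_of_nonneg measureReal_nonneg]

theorem ind_congr {s t : Set α} (hs : MeasurableSet s) (ht : MeasurableSet t) (hst : s =ᵐ[μ] t) :
    ind μ hs = ind μ ht := by
  refine Lp.ext ?_
  refine indicatorConstLp_coeFn.trans (EventuallyEq.trans ?_ indicatorConstLp_coeFn.symm)
  exact indicator_ae_eq_of_ae_eq_set hst

theorem ind_iUnion {ι : Type*} (D : Finset ι) {s : ι → Set α} (hs : ∀ i, MeasurableSet (s i))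
    {t : Set α} (ht : MeasurableSet t) (hd : ∀ i ∈ D, ∀ j ∈ D, i ≠ j → Disjoint (s i) (s j))
    (hst : t = ⋃ i ∈ D, s i) : ind μ ht = ∑ i ∈ D, ind μ (hs i) := by
  classical
  subst hst
  induction D using Finset.cons_induction with
  | empty =>
    rw [Finset.sum_empty]
    refine (ind_congr _ MeasurableSet.empty (by simp)).trans ?_
    exact indicatorConstLp_empty
  | cons a D ha ih =>
    have hD : MeasurableSet (⋃ i ∈ D, s i) := Finset.measurableSet_biUnion _ fun i _ => hs i
    rw [Finset.sum_cons, ← ih (fun i hi j hj => hd i (Finset.mem_cons_of_mem hi) j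
      (Finset.mem_cons_of_mem hj)) hD]
    have hdis : Disjoint (s a) (⋃ i ∈ D, s i) := by
      simp only [Set.disjoint_iUnion_right]
      exact fun i hi => hd a (Finset.mem_cons_self _ _) i (Finset.mem_cons_of_mem hi)
        (by rintro rfl; exact ha hi)
    rw [ind, ind, ind, ← indicatorConstLp_disjoint_union (hs a) hD (measure_ne_top _ _)
      (measure_ne_top _ _) hdis]
    congr 1
    simp

theorem ind_comp {T : α → α} (hT : MeasurePreserving T μ μ)
    (hs : Function.Surjective (Lp.compMeasurePreservingₗᵢ (p := 2) (E := ℂ) ℂ T hT)) {s : Set α}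
    (h : MeasurableSet s) :
    koopmanEquiv hT hs (ind μ h) = ind μ (hT.measurable h) := rfl

theorem ind_zpow {T : α → α} (hT : MeasurePreserving T μ μ)
    (hs : Function.Surjective (Lp.compMeasurePreservingₗᵢ (p := 2) (E := ℂ) ℂ T hT)) {s : Set α}
    (h : MeasurableSet s) (n : ℕ) :
    (koopmanEquiv hT hs ^ (n : ℤ)) (ind μ h) = ind μ ((hT.iterate n).measurable h) := by
  induction n with
  | zero => rfl
  | succ n ih =>
    rw [Nat.cast_succ, add_comm, unitary_zpow_one_add, ih, ind_comp]
    refine ind_congr _ _ (Eventually.of_forall fun x => ?_)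
    change (T^[n] (T x) ∈ s) = (T^[n + 1] x ∈ s)
    rw [Function.iterate_succ_apply]

/-- Vanishing of an `L²` function is tested on a generating `π`-system. -/
theorem eq_zero_of_forall_setIntegral_eq_zero {C : Set (Set α)}
    (hC : ‹MeasurableSpace α› = MeasurableSpace.generateFrom C) (hpi : IsPiSystem C) (f : Lp ℂ 2 μ)
    (huniv : ∫ x, f x ∂μ = 0) (hf : ∀ s ∈ C, ∫ x in s, f x ∂μ = 0) : f = 0 := by
  have hint : Integrable (f : α → ℂ) μ := (Lp.memLp f).integrable one_le_two
  have key : ∀ s, MeasurableSet s → ∫ x in s, f x ∂μ = 0 := by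
    refine MeasurableSpace.induction_on_inter hC hpi (by simp) hf ?_ ?_
    · intro t ht h0
      have := integral_add_compl ht hint
      rw [h0, zero_add, huniv] at this
      exact this
    · intro g hd hg h0
      rw [integral_iUnion hg hd hint.integrableOn]
      simp [h0]
  refine Lp.ext ?_
  exact (hint.ae_eq_zero_of_forall_setIntegral_eq_zero fun s hs _ => key s hs).trans
    (Lp.coeFn_zero ℂ 2 μ).symm

theorem span_topologicalClosure_eq_top {E : Type*} [NormedAddCommGroup E] [InnerProductSpace ℂ E]
    [CompleteSpace E] {s : Set E} (h : ∀ z, (∀ x ∈ s, inner ℂ x z = 0) → z = 0) :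
    (Submodule.span ℂ s).topologicalClosure = ⊤ := by
  rw [Submodule.topologicalClosure_eq_top_iff, Submodule.eq_bot_iff]
  exact fun z hz => h z fun x hx => (Submodule.mem_orthogonal _ _).1 hz x (Submodule.subset_span hx)

theorem constSubspace_eq_span (μ : Measure α) [IsFiniteMeasure μ] :
    constSubspace μ = ℂ ∙ ind μ MeasurableSet.univ := by
  have h1 : (ind μ MeasurableSet.univ : α → ℂ) =ᵐ[μ] fun _ => 1 :=
    indicatorConstLp_coeFn.trans (Eventually.of_forall fun x => by simp)
  ext f
  rw [Submodule.mem_span_singleton]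
  constructor
  · rintro ⟨c, hc⟩
    refine ⟨c, Lp.ext ?_⟩
    filter_upwards [hc, h1, Lp.coeFn_smul c (ind μ MeasurableSet.univ)] with x hx1 hx2 hx3
    rw [hx3, hx1, Pi.smul_apply, hx2, smul_eq_mul, mul_one]
  · rintro ⟨c, rfl⟩
    refine ⟨c, ?_⟩
    filter_upwards [h1, Lp.coeFn_smul c (ind μ MeasurableSet.univ)] with x hx2 hx3
    rw [hx3, Pi.smul_apply, hx2, smul_eq_mul, mul_one]

end Koopman

/-! ### `L²` of the product as a tensor square -/

section Tensor

variable {α : Type*} [MeasurableSpace α] {μ : Measure α}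

theorem memLp_tensor [SFinite μ] (x y : Lp ℂ 2 μ) :
    MemLp (fun p : α × α => x p.1 * y p.2) 2 (μ.prod μ) := by
  have hm : AEStronglyMeasurable (fun p : α × α => x p.1 * y p.2) (μ.prod μ) :=
    (Lp.aestronglyMeasurable x).comp_fst.mul (Lp.aestronglyMeasurable y).comp_snd
  rw [memLp_two_iff_integrable_sq_norm hm]
  have h1 := ((memLp_two_iff_integrable_sq_norm (Lp.aestronglyMeasurable x)).1 (Lp.memLp x)).mul_prod
    ((memLp_two_iff_integrable_sq_norm (Lp.aestronglyMeasurable y)).1 (Lp.memLp y))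
  refine h1.congr (Eventually.of_forall fun p => ?_)
  simp only [norm_mul]; ring

theorem ae_fst [SFinite μ] {f g : α → ℂ} (h : f =ᵐ[μ] g) : ∀ᵐ p ∂(μ.prod μ), f p.1 = g p.1 :=
  Measure.quasiMeasurePreserving_fst.ae h

theorem ae_snd [SFinite μ] {f g : α → ℂ} (h : f =ᵐ[μ] g) : ∀ᵐ p ∂(μ.prod μ), f p.2 = g p.2 :=
  Measure.quasiMeasurePreserving_snd.ae h

theorem ae_koopman_fst [SFinite μ] {T : α → α} {U : Lp ℂ 2 μ ≃ₗᵢ[ℂ] Lp ℂ 2 μ} (hU : IsKoopman T U)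
    (x : Lp ℂ 2 μ) : ∀ᵐ p ∂(μ.prod μ), x (T p.1) = U x p.1 :=
  (Measure.quasiMeasurePreserving_fst.ae (hU x)).mono fun _ h => h.symm

theorem ae_koopman_snd [SFinite μ] {T : α → α} {U : Lp ℂ 2 μ ≃ₗᵢ[ℂ] Lp ℂ 2 μ} (hU : IsKoopman T U)
    (x : Lp ℂ 2 μ) : ∀ᵐ p ∂(μ.prod μ), x (T p.2) = U x p.2 :=
  (Measure.quasiMeasurePreserving_snd.ae (hU x)).mono fun _ h => h.symm

variable [IsFiniteMeasure μ]

/-- The function `x(p) y(q)` on the product. -/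
def tensor (μ : Measure α) [IsFiniteMeasure μ] :
    Lp ℂ 2 μ →ₗ[ℂ] Lp ℂ 2 μ →ₗ[ℂ] Lp ℂ 2 (μ.prod μ) :=
  LinearMap.mk₂ ℂ (fun x y => (memLp_tensor x y).toLp)
    (fun x x' y => by
      rw [← MemLp.toLp_add, MemLp.toLp_eq_toLp_iff]
      filter_upwards [ae_fst (Lp.coeFn_add x x')] with p hp
      rw [hp, Pi.add_apply, Pi.add_apply, add_mul])
    (fun c x y => by
      rw [← MemLp.toLp_const_smul, MemLp.toLp_eq_toLp_iff]
      filter_upwards [ae_fst (Lp.coeFn_smul c x)] with p hp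
      rw [hp, Pi.smul_apply, Pi.smul_apply, smul_eq_mul, smul_eq_mul, mul_assoc])
    (fun x y y' => by
      rw [← MemLp.toLp_add, MemLp.toLp_eq_toLp_iff]
      filter_upwards [ae_snd (Lp.coeFn_add y y')] with p hp
      rw [hp, Pi.add_apply, Pi.add_apply, mul_add])
    (fun c x y => by
      rw [← MemLp.toLp_const_smul, MemLp.toLp_eq_toLp_iff]
      filter_upwards [ae_snd (Lp.coeFn_smul c y)] with p hp
      rw [hp, Pi.smul_apply, Pi.smul_apply, smul_eq_mul, smul_eq_mul, mul_left_comm])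

theorem coeFn_tensor (x y : Lp ℂ 2 μ) :
    (tensor μ x y : α × α → ℂ) =ᵐ[μ.prod μ] fun p => x p.1 * y p.2 :=
  (memLp_tensor x y).coeFn_toLp

theorem inner_tensor (x y x' y' : Lp ℂ 2 μ) :
    inner ℂ (tensor μ x y) (tensor μ x' y') = inner ℂ x x' * inner ℂ y y' := by
  rw [L2.inner_def, L2.inner_def, L2.inner_def, ← integral_prod_mul]
  refine integral_congr_ae ?_
  filter_upwards [coeFn_tensor x y, coeFn_tensor x' y'] with p h1 h2
  rw [h1, h2]
  simp only [RCLike.inner_apply, map_mul]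
  ring

theorem tensor_ind {s t : Set α} (hs : MeasurableSet s) (ht : MeasurableSet t) :
    tensor μ (ind μ hs) (ind μ ht) = ind (μ.prod μ) (hs.prod ht) := by
  refine Lp.ext ?_
  filter_upwards [coeFn_tensor (ind μ hs) (ind μ ht), ae_fst (indicatorConstLp_coeFn (p := 2)
    (hs := hs) (hμs := measure_ne_top μ s) (c := (1 : ℂ))), ae_snd (indicatorConstLp_coeFn (p := 2)
    (hs := ht) (hμs := measure_ne_top μ t) (c := (1 : ℂ))), indicatorConstLp_coeFn (p := 2)
    (hs := hs.prod ht) (hμs := measure_ne_top (μ.prod μ) _) (c := (1 : ℂ))] with p h1 h2 h3 h4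
  rw [h1, ind, ind, ind, h2, h3, h4]
  by_cases hp1 : p.1 ∈ s <;> by_cases hp2 : p.2 ∈ t <;>
    simp [Set.indicator, Set.mem_prod, hp1, hp2]

/-- Tensors of indicators are indicators of rectangles, a π-system generating the product σ-algebra.
-/
theorem dense_tensor (μ : Measure α) [IsFiniteMeasure μ] :
    (Submodule.span ℂ (Set.range fun p : Lp ℂ 2 μ × Lp ℂ 2 μ =>
      tensor μ p.1 p.2)).topologicalClosure = ⊤ := by
  refine span_topologicalClosure_eq_top fun z hz => ?_
  have h1 : ∀ s t : Set α, MeasurableSet s → MeasurableSet t →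
      ∫ x in s ×ˢ t, z x ∂(μ.prod μ) = 0 := fun s t hs ht => by
    have : inner ℂ (tensor μ (ind μ hs) (ind μ ht)) z = 0 := hz _ ⟨(ind μ hs, ind μ ht), rfl⟩
    rwa [tensor_ind, inner_ind] at this
  refine eq_zero_of_forall_setIntegral_eq_zero generateFrom_prod.symm isPiSystem_prod z ?_ ?_
  · have := h1 Set.univ Set.univ .univ .univ
    rwa [Set.univ_prod_univ, Measure.restrict_univ] at this
  · rintro _ ⟨s, hs, t, ht, rfl⟩
    exact h1 s t hs ht

theorem comp_tensor {R : α × α → α × α} (hR : MeasurePreserving R (μ.prod μ) (μ.prod μ))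
    {x y x' y' : Lp ℂ 2 μ}
    (h : ∀ᵐ p ∂(μ.prod μ), x (R p).1 * y (R p).2 = x' p.1 * y' p.2) :
    Lp.compMeasurePreservingₗᵢ (p := 2) (E := ℂ) ℂ R hR (tensor μ x y) = tensor μ x' y' := by
  refine Lp.ext ?_
  refine (Lp.coeFn_compMeasurePreserving _ hR).trans ?_
  filter_upwards [hR.quasiMeasurePreserving.ae (coeFn_tensor x y), coeFn_tensor x' y', h]
    with p h1 h2 h3
  rw [Function.comp, h1, h2, h3]

theorem surjective_comp_of_tensor {R : α × α → α × α}
    (hR : MeasurePreserving R (μ.prod μ) (μ.prod μ))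
    (h : ∀ x y, ∃ x' y', ∀ᵐ p ∂(μ.prod μ),
      (x' : Lp ℂ 2 μ) (R p).1 * (y' : Lp ℂ 2 μ) (R p).2 = (x : Lp ℂ 2 μ) p.1 * (y : Lp ℂ 2 μ) p.2) :
    Function.Surjective (Lp.compMeasurePreservingₗᵢ (p := 2) (E := ℂ) ℂ R hR) := by
  refine surjective_of_span_dense _ (dense_tensor μ) ?_
  rintro _ ⟨⟨x, y⟩, rfl⟩
  obtain ⟨x', y', h'⟩ := h x y
  exact ⟨tensor μ x' y', comp_tensor hR h'⟩

theorem surjective_comp_fst {T : α → α} (hT : MeasurePreserving T μ μ)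
    {U : Lp ℂ 2 μ ≃ₗᵢ[ℂ] Lp ℂ 2 μ} (hU : IsKoopman T U) :
    Function.Surjective (Lp.compMeasurePreservingₗᵢ (p := 2) (E := ℂ) ℂ (Prod.map T id)
      (hT.prod (MeasurePreserving.id μ))) := by
  refine surjective_comp_of_tensor _ fun x y => ⟨U.symm x, y, ?_⟩
  filter_upwards [ae_koopman_fst hU (U.symm x)] with p hp
  simp only [Prod.map_fst, Prod.map_snd, id, hp, LinearIsometryEquiv.apply_symm_apply]

theorem surjective_comp_snd {T : α → α} (hT : MeasurePreserving T μ μ)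
    {U : Lp ℂ 2 μ ≃ₗᵢ[ℂ] Lp ℂ 2 μ} (hU : IsKoopman T U) :
    Function.Surjective (Lp.compMeasurePreservingₗᵢ (p := 2) (E := ℂ) ℂ (Prod.map id T)
      ((MeasurePreserving.id μ).prod hT)) := by
  refine surjective_comp_of_tensor _ fun x y => ⟨x, U.symm y, ?_⟩
  filter_upwards [ae_koopman_snd hU (U.symm y)] with p hp
  simp only [Prod.map_fst, Prod.map_snd, id, hp, LinearIsometryEquiv.apply_symm_apply]

theorem surjective_comp_prod {T : α → α} (hT : MeasurePreserving T μ μ)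
    {U : Lp ℂ 2 μ ≃ₗᵢ[ℂ] Lp ℂ 2 μ} (hU : IsKoopman T U) :
    Function.Surjective (Lp.compMeasurePreservingₗᵢ (p := 2) (E := ℂ) ℂ (Prod.map T T)
      (hT.prod hT)) := by
  refine surjective_comp_of_tensor _ fun x y => ⟨U.symm x, U.symm y, ?_⟩
  filter_upwards [ae_koopman_fst hU (U.symm x), ae_koopman_snd hU (U.symm y)] with p hp hp'
  simp only [Prod.map_fst, Prod.map_snd, hp, hp', LinearIsometryEquiv.apply_symm_apply]

theorem surjective_comp_swap (μ : Measure α) [IsFiniteMeasure μ] :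
    Function.Surjective (Lp.compMeasurePreservingₗᵢ (p := 2) (E := ℂ) ℂ Prod.swap
      (Measure.measurePreserving_swap (μ := μ) (ν := μ))) :=
  surjective_comp_of_tensor _ fun x y => ⟨y, x, Eventually.of_forall fun _ => mul_comm _ _⟩

/-- The tensor square of the Koopman operator acts on `L²` of the product. -/
def tensorSquare {T : α → α} (hT : MeasurePreserving T μ μ) {U : Lp ℂ 2 μ ≃ₗᵢ[ℂ] Lp ℂ 2 μ}
    (hU : IsKoopman T U) : TensorSquare U (Lp ℂ 2 (μ.prod μ)) where
  t := tensor μ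
  a := koopmanEquiv _ (surjective_comp_fst hT hU)
  b := koopmanEquiv _ (surjective_comp_snd hT hU)
  V := koopmanEquiv _ (surjective_comp_prod hT hU)
  s := koopmanEquiv _ (surjective_comp_swap μ)
  inner_t := inner_tensor
  dense := dense_tensor μ
  a_t x y := comp_tensor _ ((ae_koopman_fst hU x).mono fun p hp => by
    simp only [Prod.map_fst, Prod.map_snd, id, hp])
  b_t x y := comp_tensor _ ((ae_koopman_snd hU y).mono fun p hp => by
    simp only [Prod.map_fst, Prod.map_snd, id, hp])
  V_t x y := comp_tensor _ (((ae_koopman_fst hU x).and (ae_koopman_snd hU y)).mono fun p hp => by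
    simp only [Prod.map_fst, Prod.map_snd, hp.1, hp.2])
  s_t x y := comp_tensor _ (Eventually.of_forall fun _ => mul_comm _ _)

theorem isKoopman_tensorSquare {T : α → α} (hT : MeasurePreserving T μ μ)
    {U : Lp ℂ 2 μ ≃ₗᵢ[ℂ] Lp ℂ 2 μ} (hU : IsKoopman T U) :
    IsKoopman (Prod.map T T) (tensorSquare hT hU).V :=
  coeFn_koopmanEquiv (hT.prod hT) (surjective_comp_prod hT hU)

theorem mem_symmetricSubspace_iff {T : α → α} (hT : MeasurePreserving T μ μ)
    {U : Lp ℂ 2 μ ≃ₗᵢ[ℂ] Lp ℂ 2 μ} (hU : IsKoopman T U) (F : Lp ℂ 2 (μ.prod μ)) :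
    F ∈ symmetricSubspace μ ↔ (tensorSquare hT hU).s F = F := by
  have hs : MeasurePreserving Prod.swap (μ.prod μ) (μ.prod μ) := Measure.measurePreserving_swap
  have h1 : ((tensorSquare hT hU).s F : α × α → ℂ) =ᵐ[μ.prod μ] (F : α × α → ℂ) ∘ Prod.swap :=
    coeFn_koopmanEquiv hs (surjective_comp_swap μ) F
  constructor
  · rintro ⟨G, hG, hFG⟩
    refine Lp.ext (h1.trans ?_)
    filter_upwards [hFG, hs.quasiMeasurePreserving.ae hFG] with p hp hp'
    rw [Function.comp, hp', hp]
    exact hG _ _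
  · intro h
    rw [h] at h1
    -- Symmetrization gives a representative that is symmetric everywhere and not only almost
    -- everywhere.
    refine ⟨fun p => (F p + F p.swap) / 2, fun x y => by simp [add_comm], ?_⟩
    filter_upwards [h1] with p hp
    rw [Function.comp] at hp
    rw [← hp]; ring

theorem constSubspace_prod_eq_span (μ : Measure α) [IsFiniteMeasure μ] :
    constSubspace (μ.prod μ) =
      ℂ ∙ tensor μ (ind μ MeasurableSet.univ) (ind μ MeasurableSet.univ) := by
  rw [tensor_ind, constSubspace_eq_span]
  congr 2
  exact ind_congr _ _ (by rw [Set.univ_prod_univ]; exact EventuallyEq.rfl)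

end Tensor

/-! ### Geometry and measure of cutting and stacking -/

theorem columnBase_succ (h : ℕ → ℕ) (s : ℕ → ℕ → ℕ) (j i : ℕ) :
    columnBase h s j (i + 1) = columnBase h s j i + (h j + s j i) :=
  Finset.sum_range_succ _ _

theorem columnBase_mono (h : ℕ → ℕ) (s : ℕ → ℕ → ℕ) (j : ℕ) : Monotone (columnBase h s j) :=
  monotone_nat_of_le_succ fun i => by rw [columnBase_succ]; omega

namespace IsCuttingAndStacking

variable {r : ℕ → ℕ} {s : ℕ → ℕ → ℕ} {h : ℕ → ℕ} {a : ℕ → ℕ → ℝ} {w : ℕ → ℝ} {X : Set ℝ} {T : X → X}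

theorem columnBase_add_lt (H : IsCuttingAndStacking r s h a w X T) {j i k : ℕ} (hi : i < r j)
    (hk : k < h j) : columnBase h s j i + k < h (j + 1) := by
  have h1 := columnBase_mono h s j (Nat.succ_le_of_lt hi)
  rw [Nat.succ_eq_add_one, columnBase_succ, ← H.height_succ] at h1
  omega

theorem height_pos (H : IsCuttingAndStacking r s h a w X T) (j : ℕ) : 0 < h j := by
  induction j with
  | zero => exact H.height_zero
  | succ j ih => exact lt_of_le_of_lt (Nat.zero_le _) (H.columnBase_add_lt (H.cut_pos j) ih)

theorem width_pos (H : IsCuttingAndStacking r s h a w X T) (j : ℕ) : 0 < w j := by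
  induction j with
  | zero => exact H.width_zero
  | succ j ih =>
    rw [H.width_succ]
    exact div_pos ih (by exact_mod_cast H.cut_pos j)

theorem sub_mem_towerLevel_iff (w : ℕ → ℝ) (a : ℕ → ℕ → ℝ) (j k : ℕ) (c x : ℝ) :
    x - (c - a j k) ∈ towerLevel a w j k ↔ x ∈ Set.Ico c (c + w j) := by
  simp only [towerLevel, Set.mem_Ico]
  constructor <;> rintro ⟨h1, h2⟩ <;> constructor <;> linarith

/-- The cutting of the bottom floor, transported by the translation that takes it to the floor `k`.
-/
theorem level_cut (H : IsCuttingAndStacking r s h a w X T) {j k : ℕ} (hk : k < h j) :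
    towerLevel a w j k = ⋃ i < r j, towerLevel a w (j + 1) (columnBase h s j i + k) := by
  ext x
  rw [show x ∈ towerLevel a w j k ↔ _ from (sub_mem_towerLevel_iff w a j 0 (a j k) x).symm, H.cut j]
  simp only [Set.mem_iUnion, exists_prop]
  refine exists_congr fun i => and_congr_right fun hi => ?_
  rw [show x - (a j k - a j 0) = x - (a (j + 1) (columnBase h s j i) + (a j k - a j 0) -
    a (j + 1) (columnBase h s j i)) by ring, sub_mem_towerLevel_iff, towerLevel, H.column j i hi k hk]

theorem level_subset_space (H : IsCuttingAndStacking r s h a w X T) {j k : ℕ} (hk : k < h j) :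
    towerLevel a w j k ⊆ X := by
  rw [H.space]
  exact fun x hx => Set.mem_iUnion.2 ⟨j, Set.mem_iUnion₂.2 ⟨k, hk, hx⟩⟩

theorem measurableSet_level (a : ℕ → ℕ → ℝ) (w : ℕ → ℝ) (j k : ℕ) :
    MeasurableSet (towerLevel a w j k) := measurableSet_Ico

theorem measurableSet_space (H : IsCuttingAndStacking r s h a w X T) : MeasurableSet X := by
  rw [H.space]
  exact .iUnion fun j => .iUnion fun k => .iUnion fun _ => measurableSet_level a w j k

/-- A floor is a union of floors of any later tower. -/
theorem exists_level_eq_iUnion (H : IsCuttingAndStacking r s h a w X T) {i k : ℕ} (hk : k < h i) :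
    ∀ j, i ≤ j → ∃ D ⊆ Finset.range (h j), towerLevel a w i k = ⋃ l ∈ D, towerLevel a w j l := by
  intro j hij
  induction j, hij using Nat.le_induction with
  | base => exact ⟨{k}, by simpa using hk, by simp⟩
  | succ j hij ih =>
    obtain ⟨D, hD, he⟩ := ih
    refine ⟨(D ×ˢ Finset.range (r j)).image fun p => columnBase h s j p.2 + p.1, ?_, ?_⟩
    · intro m hm
      obtain ⟨⟨l, i⟩, hp, rfl⟩ := Finset.mem_image.1 hm
      rw [Finset.mem_product] at hp
      exact Finset.mem_range.2 (H.columnBase_add_lt (Finset.mem_range.1 hp.2)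
        (Finset.mem_range.1 (hD hp.1)))
    · rw [he]
      ext x
      simp only [Set.mem_iUnion, exists_prop, Finset.mem_image, Finset.mem_product, Finset.mem_range,
        Prod.exists]
      constructor
      · rintro ⟨l, hl, hx⟩
        rw [H.level_cut (Finset.mem_range.1 (hD hl))] at hx
        simp only [Set.mem_iUnion, exists_prop] at hx
        obtain ⟨i, hi, hx⟩ := hx
        exact ⟨_, ⟨l, i, ⟨hl, hi⟩, rfl⟩, hx⟩
      · rintro ⟨_, ⟨l, i, ⟨hl, hi⟩, rfl⟩, hx⟩
        refine ⟨l, hl, ?_⟩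
        rw [H.level_cut (Finset.mem_range.1 (hD hl))]
        simp only [Set.mem_iUnion, exists_prop]
        exact ⟨i, hi, hx⟩

theorem level_subset_or_disjoint (H : IsCuttingAndStacking r s h a w X T) {i k j l : ℕ}
    (hij : i ≤ j) (hk : k < h i) (hl : l < h j) :
    towerLevel a w j l ⊆ towerLevel a w i k ∨ Disjoint (towerLevel a w i k) (towerLevel a w j l) := by
  obtain ⟨D, hD, he⟩ := H.exists_level_eq_iUnion hk j hij
  rw [he]
  by_cases hlD : l ∈ D
  · exact Or.inl (Set.subset_biUnion_of_mem (u := fun l => towerLevel a w j l) hlD)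
  · refine Or.inr (Set.disjoint_iUnion₂_left.2 fun m hm => ?_)
    exact H.disjoint j m l (Finset.mem_range.1 (hD hm)) hl (by rintro rfl; exact hlD hm)

theorem exists_mem_level (H : IsCuttingAndStacking r s h a w X T) {x : ℝ} (hx : x ∈ X) :
    ∃ i, ∀ j, i ≤ j → ∃ k < h j, x ∈ towerLevel a w j k := by
  rw [H.space] at hx
  simp only [Set.mem_iUnion, exists_prop] at hx
  obtain ⟨i, k, hk, hx⟩ := hx
  refine ⟨i, fun j hij => ?_⟩
  obtain ⟨D, hD, he⟩ := H.exists_level_eq_iUnion hk j hij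
  rw [he] at hx
  simp only [Set.mem_iUnion, exists_prop] at hx
  obtain ⟨l, hl, hx⟩ := hx
  exact ⟨l, Finset.mem_range.1 (hD hl), hx⟩

/-- Forgetting the first stages. -/
theorem shift (H : IsCuttingAndStacking r s h a w X T) (n : ℕ) :
    IsCuttingAndStacking (fun j => r (j + n)) (fun j => s (j + n)) (fun j => h (j + n))
      (fun j => a (j + n)) (fun j => w (j + n)) X T where
  cut_pos j := H.cut_pos _
  height_zero := H.height_pos _
  width_zero := H.width_pos _
  height_succ j := by
    rw [show j + 1 + n = j + n + 1 by ring, H.height_succ (j + n)]; rfl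
  width_succ j := by
    rw [show j + 1 + n = j + n + 1 by ring, H.width_succ (j + n)]
  disjoint j k l hk hl hkl := H.disjoint (j + n) k l hk hl hkl
  cut j := by
    have := H.cut (j + n)
    rw [show j + n + 1 = j + 1 + n by ring] at this
    exact this
  column j i hi k hk := by
    have := H.column (j + n) i hi k hk
    rw [show j + n + 1 = j + 1 + n by ring] at this
    exact this
  space := by
    refine Set.Subset.antisymm (fun x hx => ?_) (Set.iUnion_subset fun j => Set.iUnion₂_subset
      fun k hk => H.level_subset_space (j := j + n) hk)
    obtain ⟨i, hi⟩ := H.exists_mem_level hx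
    obtain ⟨k, hk, hx⟩ := hi (i + n) (by omega)
    exact Set.mem_iUnion.2 ⟨i, Set.mem_iUnion₂.2 ⟨k, hk, hx⟩⟩
  move j k hk x hx := H.move (j + n) k hk x hx

/-- A floor as a subset of the space. -/
def floorSet (X : Set ℝ) (a : ℕ → ℕ → ℝ) (w : ℕ → ℝ) (j k : ℕ) : Set X :=
  Subtype.val ⁻¹' towerLevel a w j k

theorem measurableSet_floorSet (X : Set ℝ) (a : ℕ → ℕ → ℝ) (w : ℕ → ℝ) (j k : ℕ) :
    MeasurableSet (floorSet X a w j k) :=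
  measurable_subtype_coe (measurableSet_level a w j k)

theorem disjoint_floorSet (H : IsCuttingAndStacking r s h a w X T) {j k l : ℕ} (hk : k < h j)
    (hl : l < h j) (hkl : k ≠ l) : Disjoint (floorSet X a w j k) (floorSet X a w j l) :=
  (H.disjoint j k l hk hl hkl).preimage _

theorem lebesgueOn_apply (H : IsCuttingAndStacking r s h a w X T) (S : Set X) :
    lebesgueOn X S = volume (Subtype.val '' S) :=
  (MeasurableEmbedding.subtype_coe H.measurableSet_space).comap_apply _ _

theorem lebesgueOn_preimage (H : IsCuttingAndStacking r s h a w X T) {S : Set ℝ} (hS : S ⊆ X) :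
    lebesgueOn X (Subtype.val ⁻¹' S) = volume S := by
  rw [H.lebesgueOn_apply, Subtype.image_preimage_coe, Set.inter_eq_right.2 hS]

theorem lebesgueOn_floorSet (H : IsCuttingAndStacking r s h a w X T) {j k : ℕ} (hk : k < h j) :
    lebesgueOn X (floorSet X a w j k) = ENNReal.ofReal (w j) := by
  rw [floorSet, H.lebesgueOn_preimage (H.level_subset_space hk), towerLevel, Real.volume_Ico]
  congr 1; ring

/-- The part of the space covered by a set of floors of the tower `j`. -/
def floorUnion (X : Set ℝ) (a : ℕ → ℕ → ℝ) (w : ℕ → ℝ) (j : ℕ) (D : Finset ℕ) : Set X :=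
  ⋃ k ∈ D, floorSet X a w j k

theorem measurableSet_floorUnion (X : Set ℝ) (a : ℕ → ℕ → ℝ) (w : ℕ → ℝ) (j : ℕ) (D : Finset ℕ) :
    MeasurableSet (floorUnion X a w j D) :=
  Finset.measurableSet_biUnion _ fun k _ => measurableSet_floorSet X a w j k

theorem lebesgueOn_floorUnion_inter (H : IsCuttingAndStacking r s h a w X T) {j : ℕ} {D : Finset ℕ}
    (hD : D ⊆ Finset.range (h j)) {S : Set X} (hS : MeasurableSet S) :
    lebesgueOn X (floorUnion X a w j D ∩ S) = ∑ k ∈ D, lebesgueOn X (floorSet X a w j k ∩ S) := by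
  rw [floorUnion, Set.iUnion₂_inter, measure_biUnion_finset]
  · intro k hk l hl hkl
    exact (H.disjoint_floorSet (Finset.mem_range.1 (hD hk)) (Finset.mem_range.1 (hD hl)) hkl).mono
      Set.inter_subset_left Set.inter_subset_left
  · exact fun k _ => (measurableSet_floorSet X a w j k).inter hS

theorem lebesgueOn_floorUnion (H : IsCuttingAndStacking r s h a w X T) {j : ℕ} {D : Finset ℕ}
    (hD : D ⊆ Finset.range (h j)) :
    lebesgueOn X (floorUnion X a w j D) = D.card * ENNReal.ofReal (w j) := by
  have h1 := H.lebesgueOn_floorUnion_inter hD MeasurableSet.univ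
  simp only [Set.inter_univ] at h1
  rw [h1, Finset.sum_congr rfl fun k hk => H.lebesgueOn_floorSet (Finset.mem_range.1 (hD hk)),
    Finset.sum_const, nsmul_eq_mul]

theorem floorUnion_range_mono (H : IsCuttingAndStacking r s h a w X T) :
    Monotone fun j => floorUnion X a w j (Finset.range (h j)) := by
  refine monotone_nat_of_le_succ fun j x hx => ?_
  simp only [floorUnion, Set.mem_iUnion, exists_prop, Finset.mem_range, floorSet,
    Set.mem_preimage] at hx ⊢
  obtain ⟨k, hk, hx⟩ := hx
  rw [H.level_cut hk] at hx
  simp only [Set.mem_iUnion, exists_prop] at hx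
  obtain ⟨i, hi, hx⟩ := hx
  exact ⟨_, H.columnBase_add_lt hi hk, hx⟩

theorem iUnion_floorUnion (H : IsCuttingAndStacking r s h a w X T) :
    ⋃ j, floorUnion X a w j (Finset.range (h j)) = Set.univ := by
  refine Set.eq_univ_of_forall fun x => ?_
  obtain ⟨i, hi⟩ := H.exists_mem_level x.2
  obtain ⟨k, hk, hx⟩ := hi i le_rfl
  exact Set.mem_iUnion.2 ⟨i, Set.mem_iUnion₂.2 ⟨k, Finset.mem_range.2 hk, hx⟩⟩

theorem tendsto_lebesgueOn (H : IsCuttingAndStacking r s h a w X T) :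
    Tendsto (fun j => (h j : ℝ≥0∞) * ENNReal.ofReal (w j)) atTop (𝓝 (lebesgueOn X Set.univ)) := by
  have h1 := tendsto_measure_iUnion_atTop (μ := lebesgueOn X) H.floorUnion_range_mono
  rw [H.iUnion_floorUnion] at h1
  refine h1.congr fun j => ?_
  rw [Function.comp, H.lebesgueOn_floorUnion subset_rfl, Finset.card_range]

theorem isFiniteMeasure_of_le (H : IsCuttingAndStacking r s h a w X T) {M : ℝ}
    (hM : ∀ᶠ j in atTop, h j * w j ≤ M) : IsFiniteMeasure (lebesgueOn X) := by
  refine ⟨lt_of_le_of_lt (le_of_tendsto H.tendsto_lebesgueOn ?_) (ENNReal.ofReal_lt_top (r := M))⟩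
  filter_upwards [hM] with j hj
  rw [← ENNReal.ofReal_natCast, ← ENNReal.ofReal_mul (by positivity)]
  exact ENNReal.ofReal_le_ofReal hj

theorem isPiSystem_floorSet (H : IsCuttingAndStacking r s h a w X T) :
    IsPiSystem {S : Set X | ∃ j k, k < h j ∧ S = floorSet X a w j k} := by
  rintro _ ⟨j, k, hk, rfl⟩ _ ⟨j', k', hk', rfl⟩ hne
  have key : ∀ j k, k < h j → ∀ j' k', k' < h j' → j ≤ j' →
      (floorSet X a w j k ∩ floorSet X a w j' k').Nonempty →
      floorSet X a w j k ∩ floorSet X a w j' k' = floorSet X a w j' k' := by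
    intro j k hk j' k' hk' hj hne
    rcases H.level_subset_or_disjoint hj hk hk' with h1 | h1
    · exact Set.inter_eq_right.2 (Set.preimage_mono h1)
    · exact absurd (h1.preimage _) (Set.not_disjoint_iff_nonempty_inter.2 hne)
  rcases le_total j j' with hj | hj
  · exact ⟨j', k', hk', key j k hk j' k' hk' hj hne⟩
  · rw [Set.inter_comm] at hne ⊢
    exact ⟨j, k, hk, key j' k' hk' j k hk hj hne⟩

/-- The widths tend to zero, so every open set is the union, within the space, of the floors it
contains. -/
theorem generateFrom_floorSet (H : IsCuttingAndStacking r s h a w X T)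
    (hw : Tendsto w atTop (𝓝 0)) : (inferInstance : MeasurableSpace X) =
      MeasurableSpace.generateFrom {S : Set X | ∃ j k, k < h j ∧ S = floorSet X a w j k} := by
  refine le_antisymm ?_ (MeasurableSpace.generateFrom_le ?_)
  · have h1 : (inferInstance : MeasurableSpace X) = MeasurableSpace.comap Subtype.val (borel ℝ) := by
      rw [← BorelSpace.measurable_eq (α := ℝ)]; rfl
    rw [h1, borel, MeasurableSpace.comap_generateFrom]
    refine MeasurableSpace.generateFrom_le ?_
    rintro _ ⟨O, hO : IsOpen O, rfl⟩
    have h2 : (Subtype.val ⁻¹' O : Set X) = ⋃ j, ⋃ k, ⋃ (_ : k < h j ∧ towerLevel a w j k ⊆ O),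
        floorSet X a w j k := by
      ext x
      simp only [Set.mem_iUnion, exists_prop, floorSet, Set.mem_preimage]
      constructor
      · intro hx
        obtain ⟨ε, hε, hεO⟩ := Metric.isOpen_iff.1 hO x hx
        obtain ⟨i, hi⟩ := H.exists_mem_level x.2
        obtain ⟨j, hj1, hj2⟩ := ((hw.eventually (gt_mem_nhds hε)).and (eventually_ge_atTop i)).exists
        obtain ⟨k, hk, hxk⟩ := hi j hj2
        refine ⟨j, k, ⟨hk, fun y hy => hεO ?_⟩, hxk⟩
        rw [Metric.mem_ball, Real.dist_eq, abs_lt]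
        simp only [towerLevel, Set.mem_Ico] at hy hxk
        constructor <;> linarith
      · rintro ⟨j, k, ⟨-, hO⟩, hx⟩
        exact hO hx
    rw [h2]
    exact .iUnion fun j => .iUnion fun k => .iUnion fun hk =>
      MeasurableSpace.measurableSet_generateFrom ⟨j, k, hk.1, rfl⟩
  · rintro _ ⟨j, k, -, rfl⟩
    exact measurableSet_floorSet X a w j k

/-- The points that are in the top floors of all late towers. -/
theorem subsingleton_top (H : IsCuttingAndStacking r s h a w X T) (hw : Tendsto w atTop (𝓝 0)) :
    {x : X | ∀ j k, k + 1 < h j → x ∉ floorSet X a w j k}.Subsingleton := by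
  have htop : ∀ x : X, (∀ j k, k + 1 < h j → x ∉ floorSet X a w j k) →
      ∃ i, ∀ j, i ≤ j → (x : ℝ) ∈ towerLevel a w j (h j - 1) := by
    intro x hx
    obtain ⟨i, hi⟩ := H.exists_mem_level x.2
    refine ⟨i, fun j hj => ?_⟩
    obtain ⟨k, hk, hxk⟩ := hi j hj
    have h1 : ¬ k + 1 < h j := fun h1 => hx j k h1 hxk
    rwa [show h j - 1 = k by omega]
  intro x hx y hy
  obtain ⟨i, hi⟩ := htop x hx
  obtain ⟨i', hi'⟩ := htop y hy
  by_contra hne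
  have hd : 0 < |(x : ℝ) - y| := abs_pos.2 (sub_ne_zero.2 fun h1 => hne (Subtype.ext h1))
  obtain ⟨j, hj1, hj2⟩ := ((hw.eventually (gt_mem_nhds hd)).and
    (eventually_ge_atTop (max i i'))).exists
  have h1 := hi j ((le_max_left _ _).trans hj2)
  have h2 := hi' j ((le_max_right _ _).trans hj2)
  simp only [towerLevel, Set.mem_Ico] at h1 h2
  have h3 : |(x : ℝ) - y| < w j := by rw [abs_lt]; constructor <;> linarith
  linarith

theorem floorSet_inter_preimage (H : IsCuttingAndStacking r s h a w X T) {j k : ℕ}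
    (hk : k + 1 < h j) (S : Set ℝ) :
    floorSet X a w j k ∩ T ⁻¹' (Subtype.val ⁻¹' S) =
      Subtype.val ⁻¹' (towerLevel a w j k ∩ (fun x => x + (a j (k + 1) - a j k)) ⁻¹' S) := by
  ext x
  simp only [Set.mem_inter_iff, floorSet, Set.mem_preimage]
  exact and_congr_right fun hx => by rw [H.move j k hk x hx]

/-- On all floors but the top ones `T` is a translation. Points that are never in such a floor form
a set of at most one element, where the value of `T` does not matter. -/
theorem measurable_map (H : IsCuttingAndStacking r s h a w X T) (hw : Tendsto w atTop (𝓝 0)) :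
    Measurable T := by
  rintro _ ⟨S, hS, rfl⟩
  have h1 : T ⁻¹' (Subtype.val ⁻¹' S) = (⋃ j, ⋃ k, ⋃ (_ : k + 1 < h j),
      floorSet X a w j k ∩ T ⁻¹' (Subtype.val ⁻¹' S)) ∪
      ({x : X | ∀ j k, k + 1 < h j → x ∉ floorSet X a w j k} ∩ T ⁻¹' (Subtype.val ⁻¹' S)) := by
    ext x
    simp only [Set.mem_union, Set.mem_iUnion, exists_prop, Set.mem_inter_iff, Set.mem_ofPred_eq]
    by_cases hx : ∀ j k, k + 1 < h j → x ∉ floorSet X a w j k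
    · constructor
      · exact fun h2 => Or.inr ⟨hx, h2⟩
      · rintro (⟨_, _, _, _, h2⟩ | ⟨-, h2⟩) <;> exact h2
    · push Not at hx
      obtain ⟨j, k, hk, hxk⟩ := hx
      constructor
      · exact fun h2 => Or.inl ⟨j, k, hk, hxk, h2⟩
      · rintro (⟨_, _, _, _, h2⟩ | ⟨-, h2⟩) <;> exact h2
  rw [h1]
  refine MeasurableSet.union (.iUnion fun j => .iUnion fun k => .iUnion fun hk => ?_)
    (((H.subsingleton_top hw).anti Set.inter_subset_left).measurableSet)
  rw [H.floorSet_inter_preimage hk]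
  exact measurable_subtype_coe ((measurableSet_level a w j k).inter
    ((measurable_id.add_const _) hS))

theorem lebesgueOn_floorSet_inter_preimage (H : IsCuttingAndStacking r s h a w X T) {j k : ℕ}
    (hk : k + 1 < h j) (S : Set ℝ) :
    lebesgueOn X (floorSet X a w j k ∩ T ⁻¹' (Subtype.val ⁻¹' S)) =
      lebesgueOn X (floorSet X a w j (k + 1) ∩ Subtype.val ⁻¹' S) := by
  rw [H.floorSet_inter_preimage hk, floorSet, ← Set.preimage_inter,
    H.lebesgueOn_preimage (Set.inter_subset_left.trans (H.level_subset_space (by omega))),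
    H.lebesgueOn_preimage (Set.inter_subset_left.trans (H.level_subset_space hk)),
    ← measure_preimage_add_right volume (a j (k + 1) - a j k)
      (towerLevel a w j (k + 1) ∩ S), Set.preimage_inter]
  congr 2
  ext x
  simp only [towerLevel, Set.mem_preimage, Set.mem_Ico]
  constructor <;> rintro ⟨h1, h2⟩ <;> constructor <;> linarith

theorem tendsto_measure_inter_of_tendsto {α : Type*} [MeasurableSpace α] {μ : Measure α}
    [IsFiniteMeasure μ] {G : ℕ → Set α} (hG : ∀ j, MeasurableSet (G j))
    (h : Tendsto (fun j => μ (G j)) atTop (𝓝 (μ Set.univ))) (S : Set α) :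
    Tendsto (fun j => μ (G j ∩ S)) atTop (𝓝 (μ S)) := by
  have h1 : Tendsto (fun j => μ (G j)ᶜ) atTop (𝓝 0) := by
    have := ENNReal.Tendsto.sub (tendsto_const_nhds (x := μ Set.univ)) h
      (Or.inl (measure_ne_top μ _))
    rw [tsub_self] at this
    exact this.congr fun j => (measure_compl (hG j) (measure_ne_top μ _)).symm
  have h2 : Tendsto (fun j => μ S - μ (G j)ᶜ) atTop (𝓝 (μ S)) := by
    have := ENNReal.Tendsto.sub (tendsto_const_nhds (x := μ S)) h1 (Or.inl (measure_ne_top μ _))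
    rwa [tsub_zero] at this
  refine tendsto_of_tendsto_of_tendsto_of_le_of_le h2 tendsto_const_nhds (fun j => ?_)
    fun j => measure_mono Set.inter_subset_right
  rw [tsub_le_iff_right]
  calc μ S ≤ μ (G j ∩ S ∪ (G j)ᶜ) := measure_mono fun x hx => by
        by_cases hxG : x ∈ G j
        · exact Or.inl ⟨hxG, hx⟩
        · exact Or.inr hxG
    _ ≤ _ := measure_union_le _ _

/-- The towers exhaust the space, and the one missing floor has measure `w j`, which tends to zero.
-/
theorem tendsto_lebesgueOn_floorUnion (H : IsCuttingAndStacking r s h a w X T)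
    (hw : Tendsto w atTop (𝓝 0)) {D : ℕ → Finset ℕ} (hD : ∀ j, D j ⊆ Finset.range (h j))
    (hc : ∀ j, (D j).card + 1 = h j) :
    Tendsto (fun j => lebesgueOn X (floorUnion X a w j (D j))) atTop (𝓝 (lebesgueOn X Set.univ)) := by
  have h1 : Tendsto (fun j => ENNReal.ofReal (w j)) atTop (𝓝 0) := by
    have := ENNReal.tendsto_ofReal hw
    rwa [ENNReal.ofReal_zero] at this
  have h2 := ENNReal.Tendsto.sub H.tendsto_lebesgueOn h1 (Or.inr ENNReal.zero_ne_top)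
  rw [tsub_zero] at h2
  refine h2.congr fun j => ?_
  rw [H.lebesgueOn_floorUnion (hD j), ← hc j, Nat.cast_succ, add_mul, one_mul,
    ENNReal.add_sub_cancel_right ENNReal.ofReal_ne_top]

/-- The transformation preserves Lebesgue measure. -/
theorem measurePreserving (H : IsCuttingAndStacking r s h a w X T) [IsFiniteMeasure (lebesgueOn X)]
    (hw : Tendsto w atTop (𝓝 0)) : MeasurePreserving T (lebesgueOn X) (lebesgueOn X) := by
  refine ⟨H.measurable_map hw, Measure.ext fun S hS => ?_⟩
  rw [Measure.map_apply (H.measurable_map hw) hS]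
  have hT := H.measurable_map hw hS
  -- `T` translates the floors `0, …, h - 2` onto `1, …, h - 1`; both families fill the space in the
  -- limit.
  have c1 : ∀ j, Finset.range (h j - 1) ⊆ Finset.range (h j) := fun j =>
    Finset.range_subset_range.2 (Nat.sub_le _ _)
  have c2 : ∀ j, Finset.Ico 1 (h j) ⊆ Finset.range (h j) := fun j k hk =>
    Finset.mem_range.2 (Finset.mem_Ico.1 hk).2
  have t1 := tendsto_measure_inter_of_tendsto
    (fun j => measurableSet_floorUnion X a w j (Finset.range (h j - 1)))
    (H.tendsto_lebesgueOn_floorUnion hw c1 fun j => by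
      have := H.height_pos j; rw [Finset.card_range]; omega) (T ⁻¹' S)
  have t2 := tendsto_measure_inter_of_tendsto
    (fun j => measurableSet_floorUnion X a w j (Finset.Ico 1 (h j)))
    (H.tendsto_lebesgueOn_floorUnion hw c2 fun j => by
      have := H.height_pos j; rw [Nat.card_Ico]; omega) S
  refine tendsto_nhds_unique t1 (t2.congr fun j => ?_)
  rw [H.lebesgueOn_floorUnion_inter (c1 j) hT, H.lebesgueOn_floorUnion_inter (c2 j) hS,
    Finset.sum_Ico_eq_sum_range]
  refine Finset.sum_congr rfl fun k hk => ?_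
  obtain ⟨S', hS', rfl⟩ := hS
  rw [add_comm 1 k, H.lebesgueOn_floorSet_inter_preimage]
  have := Finset.mem_range.1 hk; omega

end IsCuttingAndStacking

/-! ### The Koopman operator of a staircase construction -/

theorem sum_measureReal_inter_le {α ι : Type*} [MeasurableSpace α] {μ : Measure α}
    [IsFiniteMeasure μ] {D : Finset ι} {A : Set α} {G : ι → Set α} (hA : MeasurableSet A)
    (hG : ∀ i, MeasurableSet (G i)) (hd : (D : Set ι).PairwiseDisjoint G) :
    ∑ i ∈ D, μ.real (A ∩ G i) ≤ μ.real A := by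
  rw [← measureReal_biUnion_finset (hd.mono fun i => Set.inter_subset_right)
    fun i _ => hA.inter (hG i)]
  exact measureReal_mono (Set.iUnion₂_subset fun i _ => Set.inter_subset_left)

namespace IsCuttingAndStacking

variable {r : ℕ → ℕ} {s : ℕ → ℕ → ℕ} {h : ℕ → ℕ} {a : ℕ → ℕ → ℝ} {w : ℕ → ℝ} {X : Set ℝ} {T : X → X}

theorem two_mul_width_succ_le (H : IsCuttingAndStacking r s h a w X T) (h2 : ∀ j, 2 ≤ r j) (j : ℕ) :
    2 * w (j + 1) ≤ w j := by
  have h1 : (2 : ℝ) ≤ r j := by exact_mod_cast h2 j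
  rw [H.width_succ, ← mul_div_assoc, div_le_iff₀ (by linarith)]
  nlinarith [H.width_pos j]

theorem tendsto_width (H : IsCuttingAndStacking r s h a w X T) (h2 : ∀ j, 2 ≤ r j) :
    Tendsto w atTop (𝓝 0) := by
  have h1 : ∀ j, w j ≤ w 0 * (1 / 2) ^ j := by
    intro j
    induction j with
    | zero => simp
    | succ j ih => rw [pow_succ]; linarith [H.two_mul_width_succ_le h2 j]
  have h3 := (tendsto_pow_atTop_nhds_zero_of_lt_one (r := (1 / 2 : ℝ)) (by norm_num)
    (by norm_num)).const_mul (w 0)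
  rw [mul_zero] at h3
  exact squeeze_zero (fun j => (H.width_pos j).le) h1 h3

theorem height_mul_width_succ_le (H : IsCuttingAndStacking r s h a w X T)
    (hs : ∀ j, ∀ i < r j, s j i = if i + 1 < r j then i + 1 else 0) (j : ℕ) :
    h (j + 1) * w (j + 1) ≤ h j * w j + r j * w j := by
  have hr : (0 : ℝ) < r j := by exact_mod_cast H.cut_pos j
  have h1 : h (j + 1) ≤ r j * (h j + r j) := by
    rw [H.height_succ, columnBase]
    calc _ ≤ ∑ l ∈ Finset.range (r j), (h j + r j) := by
          refine Finset.sum_le_sum fun i hi => ?_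
          rw [hs j i (Finset.mem_range.1 hi)]
          split_ifs <;> omega
      _ = _ := by rw [Finset.sum_const, Finset.card_range, smul_eq_mul]
  have h2 : (h (j + 1) : ℝ) ≤ r j * (h j + r j) := by exact_mod_cast h1
  have hw := (H.width_pos j).le
  rw [H.width_succ]
  calc _ ≤ (r j * (h j + r j)) * (w j / r j) := by gcongr
    _ = _ := by field_simp

theorem isFiniteMeasure (H : IsCuttingAndStacking r s h a w X T)
    (hs : ∀ j, ∀ i < r j, s j i = if i + 1 < r j then i + 1 else 0) (h2 : ∀ j, 2 ≤ r j)
    (hr : ∀ j, r (j + 1) ≤ 2 * r j) : IsFiniteMeasure (lebesgueOn X) := by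
  -- This sum does not increase with `j`: the added spacers have measure at most `r (j + 1) w (j +
  -- 1) ≤ 2 w j`, and `4 w` drops by at least `2 w j`, as the widths are at least halved.
  have key : ∀ j, h (j + 1) * w (j + 1) + 4 * w j ≤ h 1 * w 1 + 4 * w 0 := by
    intro j
    induction j with
    | zero => rfl
    | succ j ih =>
      have h3 := H.height_mul_width_succ_le hs (j + 1)
      have h4 := H.two_mul_width_succ_le h2 j
      have h5 : (r (j + 1) : ℝ) ≤ 2 * r j := by exact_mod_cast hr j
      have h6 : r j * w (j + 1) = w j := by
        rw [H.width_succ]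
        have : (0 : ℝ) < r j := by exact_mod_cast H.cut_pos j
        field_simp
      have h7 : r (j + 1) * w (j + 1) ≤ 2 * w j := by
        have := (H.width_pos (j + 1)).le
        calc _ ≤ 2 * r j * w (j + 1) := by gcongr
          _ = _ := by rw [mul_assoc, h6]
      linarith
  refine H.isFiniteMeasure_of_le (M := h 1 * w 1 + 4 * w 0) ?_
  filter_upwards [eventually_ge_atTop 1] with j hj
  obtain ⟨i, rfl⟩ : ∃ i, j = i + 1 := ⟨j - 1, by omega⟩
  linarith [key i, H.width_pos i]

theorem measureReal_floorSet (H : IsCuttingAndStacking r s h a w X T) {j k : ℕ} (hk : k < h j) :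
    (lebesgueOn X).real (floorSet X a w j k) = w j := by
  rw [measureReal_def, H.lebesgueOn_floorSet hk, ENNReal.toReal_ofReal (H.width_pos j).le]

theorem staircase_height_succ (H : IsCuttingAndStacking r s h a w X T)
    (hs : ∀ j, ∀ i < r j, s j i = if i + 1 < r j then i + 1 else 0) (j : ℕ) :
    h (j + 1) = columnBase h s j (r j - 1) + h j := by
  have h1 := H.cut_pos j
  rw [H.height_succ]
  obtain ⟨m, hm⟩ : ∃ m, r j = m + 1 := ⟨r j - 1, by omega⟩
  rw [hm, columnBase_succ, hs j m (by omega), if_neg (by omega), Nat.add_sub_cancel, add_zero]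

variable [IsFiniteMeasure (lebesgueOn X)]

/-- The indicator of a floor. -/
def floorInd (X : Set ℝ) [IsFiniteMeasure (lebesgueOn X)] (a : ℕ → ℕ → ℝ) (w : ℕ → ℝ) (j k : ℕ) :
    Lp ℂ 2 (lebesgueOn X) :=
  ind (lebesgueOn X) (measurableSet_floorSet X a w j k)

theorem floorInd_cut (H : IsCuttingAndStacking r s h a w X T) {j k : ℕ} (hk : k < h j) :
    floorInd X a w j k =
      ∑ c ∈ Finset.range (r j), floorInd X a w (j + 1) (columnBase h s j c + k) := by
  refine ind_iUnion _ (fun c => measurableSet_floorSet X a w (j + 1) (columnBase h s j c + k)) _ ?_ ?_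
  · intro c hc c' hc' hne
    refine H.disjoint_floorSet (H.columnBase_add_lt (Finset.mem_range.1 hc) hk)
      (H.columnBase_add_lt (Finset.mem_range.1 hc') hk) fun heq => hne ?_
    have hmono : StrictMono (columnBase h s j) := strictMono_nat_of_lt_succ fun i => by
      rw [columnBase_succ]; have := H.height_pos j; omega
    exact hmono.injective (by omega)
  · ext x
    simp only [floorSet, Set.mem_preimage, Set.mem_iUnion, exists_prop, Finset.mem_range]
    rw [H.level_cut hk]
    simp only [Set.mem_iUnion, exists_prop]

theorem inner_floorInd (H : IsCuttingAndStacking r s h a w X T) {j k l : ℕ} (hk : k < h j)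
    (hl : l < h j) : inner ℂ (floorInd X a w j k) (floorInd X a w j l) =
      if k = l then (w j : ℂ) else 0 := by
  rw [floorInd, floorInd, inner_ind_ind]
  split_ifs with hkl
  · rw [hkl, Set.inter_self, H.measureReal_floorSet hl]
  · rw [(H.disjoint_floorSet hk hl hkl).inter_eq, measureReal_empty, Complex.ofReal_zero]

theorem eq_zero_of_inner_floorInd (H : IsCuttingAndStacking r s h a w X T)
    (hw : Tendsto w atTop (𝓝 0)) {z : Lp ℂ 2 (lebesgueOn X)}
    (hz : ∀ j k, k < h j → inner ℂ (floorInd X a w j k) z = 0) : z = 0 := by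
  have h1 : ∀ j k, k < h j → ∫ x in floorSet X a w j k, z x ∂lebesgueOn X = 0 := fun j k hk => by
    rw [← hz j k hk, floorInd, inner_ind]
  refine eq_zero_of_forall_setIntegral_eq_zero (H.generateFrom_floorSet hw) H.isPiSystem_floorSet z
    ?_ ?_
  · have h2 := tendsto_setIntegral_of_monotone (μ := lebesgueOn X) (f := (z : X → ℂ))
      (fun j => measurableSet_floorUnion X a w j (Finset.range (h j))) H.floorUnion_range_mono
      ((Lp.memLp z).integrable one_le_two).integrableOn
    rw [H.iUnion_floorUnion, Measure.restrict_univ] at h2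
    refine tendsto_nhds_unique h2 (tendsto_const_nhds.congr fun j => ?_)
    rw [floorUnion, integral_biUnion_finset]
    · exact (Finset.sum_eq_zero fun k hk => h1 j k (Finset.mem_range.1 hk)).symm
    · exact fun k _ => measurableSet_floorSet X a w j k
    · exact fun k hk l hl hkl => H.disjoint_floorSet (Finset.mem_range.1 hk)
        (Finset.mem_range.1 hl) hkl
    · exact fun k _ => ((Lp.memLp z).integrable one_le_two).integrableOn
  · rintro _ ⟨j, k, hk, rfl⟩
    exact h1 j k hk

/-- The floor `k` lies in the preimage of the floor `k + 1` and has the same measure, so the two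
agree almost everywhere even if `T` is not known to be injective. -/
theorem ind_preimage_floorSet (H : IsCuttingAndStacking r s h a w X T)
    (hT : MeasurePreserving T (lebesgueOn X) (lebesgueOn X)) {j k : ℕ} (hk : k + 1 < h j) :
    ind (lebesgueOn X) (hT.measurable (measurableSet_floorSet X a w j (k + 1))) =
      floorInd X a w j k := by
  refine (ind_congr _ _ (ae_eq_of_subset_of_measure_ge ?_ ?_
    (measurableSet_floorSet X a w j k).nullMeasurableSet (measure_ne_top _ _))).symm
  · intro x hx
    have h1 := H.move j k hk x hx
    simp only [floorSet, Set.mem_preimage, towerLevel, Set.mem_Ico] at hx ⊢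
    rw [h1]
    constructor <;> linarith
  · rw [hT.measure_preimage (measurableSet_floorSet X a w j (k + 1)).nullMeasurableSet,
      H.lebesgueOn_floorSet hk, H.lebesgueOn_floorSet (by omega)]

/-- Replaces invertibility of `T`, which is not given. The indicators of all floors except the top
ones are in the range, and they already span a dense subspace. -/
theorem surjective_koopman (H : IsCuttingAndStacking r s h a w X T)
    (hs : ∀ j, ∀ i < r j, s j i = if i + 1 < r j then i + 1 else 0)
    (hw : Tendsto w atTop (𝓝 0)) (hT : MeasurePreserving T (lebesgueOn X) (lebesgueOn X)) :
    Function.Surjective (Lp.compMeasurePreservingₗᵢ (p := 2) (E := ℂ) ℂ T hT) := by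
  refine surjective_of_span_dense _ (s := {x | ∃ j k, k + 1 < h j ∧ x = floorInd X a w j k})
    (span_topologicalClosure_eq_top fun z hz => ?_) ?_
  · have hz' : ∀ j k, k + 1 < h j → inner ℂ (floorInd X a w j k) z = 0 :=
      fun j k hk => hz _ ⟨j, k, hk, rfl⟩
    -- The top floor consists of the next top floor and of floors that are not top floors, as the
    -- last column has no spacers. So `z` pairs equally with all top floors, whose norms tend to
    -- zero.
    have hc : ∀ j, inner ℂ (floorInd X a w j (h j - 1)) z =
        inner ℂ (floorInd X a w (j + 1) (h (j + 1) - 1)) z := by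
      intro j
      have h0 := H.height_pos j
      have h1 := H.cut_pos j
      have h3 := H.staircase_height_succ hs j
      rw [H.floorInd_cut (by omega), sum_inner,
        Finset.sum_eq_single_of_mem (r j - 1) (Finset.mem_range.2 (by omega))]
      · congr 2; omega
      · intro c hc hne
        have hc' := Finset.mem_range.1 hc
        have h4 := columnBase_mono h s j (show c + 1 ≤ r j - 1 by omega)
        rw [columnBase_succ] at h4
        exact hz' _ _ (by omega)
    have hc' : ∀ i j, inner ℂ (floorInd X a w i (h i - 1)) z =
        inner ℂ (floorInd X a w (i + j) (h (i + j) - 1)) z := by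
      intro i j
      induction j with
      | zero => rfl
      | succ j ih => rw [ih, hc]; rfl
    have hn : ∀ j, ‖floorInd X a w j (h j - 1)‖ = √(w j) := fun j => by
      have h0 := H.height_pos j
      have h1 := H.inner_floorInd (j := j) (k := h j - 1) (l := h j - 1) (by omega) (by omega)
      rw [if_pos rfl, inner_self_eq_norm_sq_to_K] at h1
      have h2 : ‖floorInd X a w j (h j - 1)‖ ^ 2 = w j :=
        Complex.ofReal_injective (by push_cast; exact h1)
      rw [← h2, Real.sqrt_sq (norm_nonneg _)]
    have htop : ∀ i, inner ℂ (floorInd X a w i (h i - 1)) z = 0 := by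
      intro i
      have h1 : Tendsto (fun j => √(w (i + j)) * ‖z‖) atTop (𝓝 0) := by
        have h2 : Tendsto (fun j => w (i + j)) atTop (𝓝 0) := by
          simpa only [add_comm, Function.comp_def] using hw.comp (tendsto_add_atTop_nat i)
        have h3 := (Real.continuous_sqrt.tendsto 0).comp h2
        rw [Real.sqrt_zero] at h3
        simpa using h3.mul_const ‖z‖
      rw [← norm_le_zero_iff]
      refine ge_of_tendsto' h1 fun j => ?_
      rw [hc' i j, ← hn]
      exact norm_inner_le_norm _ _
    refine H.eq_zero_of_inner_floorInd hw fun j k hk => ?_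
    rcases Nat.lt_or_ge (k + 1) (h j) with h1 | h1
    · exact hz' j k h1
    · rw [show k = h j - 1 by omega]; exact htop j
  · rintro _ ⟨j, k, hk, rfl⟩
    exact ⟨floorInd X a w j (k + 1), H.ind_preimage_floorSet hT hk⟩

theorem inner_one_floorInd (H : IsCuttingAndStacking r s h a w X T) {j k : ℕ} (hk : k < h j) :
    inner ℂ (ind (lebesgueOn X) MeasurableSet.univ) (floorInd X a w j k) = (w j : ℂ) := by
  rw [floorInd, inner_ind_ind, Set.univ_inter, H.measureReal_floorSet hk]

/-- The inverse operator occurs because composition with `T` lowers the indicators of floors by one.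
The overlap bound is disjointness of the floors, for powers of either sign. -/
theorem isStaircaseModel (H : IsCuttingAndStacking r s h a w X T)
    (hs : ∀ j, ∀ i < r j, s j i = if i + 1 < r j then i + 1 else 0) (h2 : ∀ j, 2 ≤ r j)
    (hr : ∀ j, r (j + 1) ≤ 2 * r j ∧ r j ≤ 2 * r (j + 1)) (hh : 2 ≤ h 0)
    (hT : MeasurePreserving T (lebesgueOn X) (lebesgueOn X))
    (hsurj : Function.Surjective (Lp.compMeasurePreservingₗᵢ (p := 2) (E := ℂ) ℂ T hT)) :
    IsStaircaseModel (koopmanEquiv hT hsurj)⁻¹ (ind (lebesgueOn X) MeasurableSet.univ)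
      (floorInd X a w) r h (columnBase h s) w where
  two_le := h2
  succ_le j := (hr j).1
  le_succ j := (hr j).2
  two_le_height := hh
  base_zero j := Finset.sum_range_zero _
  base_succ j c hc := by
    rw [columnBase_succ, hs j c (by omega), if_pos hc]; ring
  height_succ := H.staircase_height_succ hs
  width_pos := H.width_pos
  width_succ j := by
    have : (0 : ℝ) < r j := by exact_mod_cast H.cut_pos j
    rw [H.width_succ]; field_simp
  move j k hk := by
    have h1 : koopmanEquiv hT hsurj (floorInd X a w j (k + 1)) = floorInd X a w j k :=
      H.ind_preimage_floorSet hT hk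
    rw [← h1]
    exact (koopmanEquiv hT hsurj).symm_apply_apply _
  cut j k hk := H.floorInd_cut hk
  inner_floor j k l hk hl := H.inner_floorInd hk hl
  one_ne h0 := by
    have h1 := H.inner_one_floorInd (H.height_pos 0)
    rw [h0, inner_zero_left] at h1
    exact (H.width_pos 0).ne' (by exact_mod_cast h1.symm)
  map_one := by
    have h1 : koopmanEquiv hT hsurj (ind (lebesgueOn X) MeasurableSet.univ) =
        ind (lebesgueOn X) MeasurableSet.univ := rfl
    conv_lhs => rw [← h1]
    exact (koopmanEquiv hT hsurj).symm_apply_apply _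
  inner_one j k hk := H.inner_one_floorInd hk
  overlap n i k j hk := by
    have hd : ((Finset.range (h j) : Finset ℕ) : Set ℕ).PairwiseDisjoint (floorSet X a w j) :=
      fun k hk l hl hkl => H.disjoint_floorSet (Finset.mem_range.1 hk) (Finset.mem_range.1 hl) hkl
    rw [← H.measureReal_floorSet hk]
    obtain ⟨m, rfl | rfl⟩ := n.eq_nat_or_neg
    · have h1 : ∀ l, ‖inner ℂ (((koopmanEquiv hT hsurj)⁻¹ ^ (m : ℤ)) (floorInd X a w i k))
          (floorInd X a w j l)‖ =
          (lebesgueOn X).real (floorSet X a w i k ∩ T^[m] ⁻¹' floorSet X a w j l) := fun l => by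
        rw [inv_zpow', ← inner_zpow_right, floorInd, floorInd, ind_zpow, norm_inner_ind_ind]
      rw [Finset.sum_congr rfl fun l _ => h1 l]
      exact sum_measureReal_inter_le (measurableSet_floorSet X a w i k)
        (fun l => (hT.iterate m).measurable (measurableSet_floorSet X a w j l))
        fun k hk l hl hkl => (hd hk hl hkl).preimage _
    · have h1 : ∀ l, ‖inner ℂ (((koopmanEquiv hT hsurj)⁻¹ ^ (-m : ℤ)) (floorInd X a w i k))
          (floorInd X a w j l)‖ =
          (lebesgueOn X).real (T^[m] ⁻¹' floorSet X a w i k ∩ floorSet X a w j l) := fun l => by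
        rw [inv_zpow', neg_neg, floorInd, floorInd, ind_zpow, norm_inner_ind_ind]
      rw [Finset.sum_congr rfl fun l _ => h1 l,
        ← (hT.iterate m).measureReal_preimage (measurableSet_floorSet X a w i k).nullMeasurableSet]
      exact sum_measureReal_inter_le ((hT.iterate m).measurable (measurableSet_floorSet X a w i k))
        (fun l => measurableSet_floorSet X a w j l) hd
  dense := span_topologicalClosure_eq_top fun z hz =>
    H.eq_zero_of_inner_floorInd (H.tendsto_width h2) fun j k hk => hz _ ⟨j, k, hk, rfl⟩

end IsCuttingAndStacking

end

/-! ### Assembly -/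

theorem mainTheorem1 (d : ℝ) (hd0 : 0 < d) (hd1 : d < 1 / 5) (r : ℕ → ℕ)
    (hr : (fun j : ℕ => (r j : ℝ)) ~[atTop] fun j : ℕ => (j : ℝ) ^ d)
    (X : Set ℝ) (T : X → X) (hT : IsStaircaseConstruction r X T) :
    IsFiniteMeasure (lebesgueOn X) ∧
    MeasurePreserving T (lebesgueOn X) (lebesgueOn X) ∧
    ∃ (U : Lp ℂ 2 (lebesgueOn X) ≃ₗᵢ[ℂ] Lp ℂ 2 (lebesgueOn X))
      (V : Lp ℂ 2 ((lebesgueOn X).prod (lebesgueOn X)) ≃ₗᵢ[ℂ]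
        Lp ℂ 2 ((lebesgueOn X).prod (lebesgueOn X))),
      IsKoopman T U ∧ IsKoopman (Prod.map T T) V ∧
      (∃ σ, IsMaximalSpectralType U (constSubspace (lebesgueOn X))ᗮ σ) ∧
      (∀ σ, IsMaximalSpectralType U (constSubspace (lebesgueOn X))ᗮ σ →
        ¬ HasGroupProperty σ ∧ Measure.MutuallySingular σ (Measure.conv σ σ)) ∧
      HasHomogeneousSpectrum V
        (constSubspace ((lebesgueOn X).prod (lebesgueOn X)))ᗮ 2 ∧
      HasHomogeneousSpectrum V (symmetricSubspace (lebesgueOn X)) 1 := by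
  obtain ⟨s, h, a, w, H₀, hs₀⟩ := hT
  have hr2 := (tendsto_of_isEquivalent_rpow hd0 hr).eventually_ge_atTop 2
  obtain ⟨n, hn⟩ := eventually_atTop.1 (hs₀.and (hr2.and (eventually_le_two_mul hr)))
  -- From stage `n` on, the staircase form and all bounds hold. One more stage is dropped so that
  -- the first tower, made of at least two columns, has height at least 2.
  have H := H₀.shift (n + 1)
  have hs : ∀ j, ∀ i < r (j + (n + 1)), s (j + (n + 1)) i =
      if i + 1 < r (j + (n + 1)) then i + 1 else 0 := fun j => (hn _ (by omega)).1
  have h2' : ∀ j, n ≤ j → 2 ≤ r j := fun j hj => by exact_mod_cast (hn j hj).2.1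
  have h2 : ∀ j, 2 ≤ r (j + (n + 1)) := fun j => h2' _ (by omega)
  have hle : ∀ j, r (j + 1 + (n + 1)) ≤ 2 * r (j + (n + 1)) ∧
      r (j + (n + 1)) ≤ 2 * r (j + 1 + (n + 1)) := fun j => by
    have := (hn (j + (n + 1)) (by omega)).2.2
    rwa [show j + (n + 1) + 1 = j + 1 + (n + 1) by ring] at this
  have hh : 2 ≤ h (0 + (n + 1)) := by
    have h1 := h2' n le_rfl
    have h3 := H₀.height_pos n
    have h4 := columnBase_mono h s n h1
    rw [← H₀.height_succ, columnBase_succ, columnBase_succ] at h4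
    rw [zero_add]; omega
  have hr' := isEquivalent_shift hr (n + 1)
  have hfin := H.isFiniteMeasure hs h2 fun j => (hle j).1
  have hw := H.tendsto_width h2
  have hMP := H.measurePreserving hw
  have hsurj := H.surjective_koopman hs hw hMP
  have M := H.isStaircaseModel hs h2 hle hh hMP hsurj
  obtain ⟨q, ρ, J, hJ⟩ := exists_isBlockSystem hd0 hd1 hr' M.le_height
  have hU : IsKoopman T (koopmanEquiv hMP hsurj) := coeFn_koopmanEquiv hMP hsurj
  have hom := M.isHomogeneous (tendsto_of_isEquivalent_rpow hd0 hr')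
    (tendsto_pow_mul_width (by linarith) hr' M.width_pos M.width_succ_le) hJ (tensorSquare hMP hU)
  refine ⟨hfin, hMP, koopmanEquiv hMP hsurj, (tensorSquare hMP hU).V, hU,
    isKoopman_tensorSquare hMP hU, ?_, ?_, ?_, ?_⟩
  · rw [constSubspace_eq_span]
    exact hom.exists_isMaximalSpectralType
  · rw [constSubspace_eq_span]
    exact fun σ hσ => hom.mutuallySingular_conv hσ
  · rw [constSubspace_prod_eq_span]
    exact hom.hasHomogeneousSpectrum_two
  · exact hom.hasHomogeneousSpectrum_one (mem_symmetricSubspace_iff hMP hU)
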